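/- Let $k$ be a field. A \emph{tensor category} is an additive $k$-linear category with a $k$-bilinear symmetric monoidal structure such that $k\to\operatorname{End}(\mathbf 1)$ is bijective, and a \emph{tensor functor} is a $k$-linear (strong) symmetric monoidal functor. For a rigid object $V$ with dual $V^*$, write $\underline{\operatorname{End}}(V)=V\otimes V^*$ for its internal endomorphism algebra. An algebra (associative and unital, not necessarily commutative) is \emph{split} if it is isomorphic, as an algebra, to $\underline{\operatorname{End}}(V)$ for some rigid object $V$. An algebra $A$ is \emph{Azumaya} if the object $A$ is rigid and the natural map $A\otimes A^{\mathrm{op}}\to\underline{\operatorname{End}}(A)$, $a\otimes b\mapsto (x\mapsto axb)$, is an isomorphism. For an algebra $A$, put $E=A\otimes A$, let $\tau\colon E\to E$ be the symmetry (an algebra automorphism), and for an $(E,E)$-bimodule $M$ let $M^\dagger$ be the bimodule with the same underlying object and left action as $M$, and with right action twisted by $\tau$; thus $M^{\dagger\dagger}=M$. We write $\tilde\eta(A)=1$ if there is an isomorphism of $(E,E)$-bimodules $i\colon E\to E^\dagger$ with $i^2=\mathrm{id}$, that is, such that the composite $E\xrightarrow{i}E^\dagger\xrightarrow{i^\dagger}E^{\dagger\dagger}=E$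 is the identity. Let $\mathfrak C$ be a Karoubian (idempotent complete) tensor category and let $B$ be an Azumaya algebra in $\mathfrak C$. Then the following are equivalent: (a) there exists a fully faithful tensor functor $\Phi\colon\mathfrak C\to\mathfrak D$, for some tensor category $\mathfrak D$, such that $\Phi(B)$ is split; (b) $\tilde\eta(B)=1$. (On the size of $\mathfrak D$: if (b) holds, $\mathfrak D$ can be taken with objects and morphisms in the same universes as those of $\mathfrak C$; and (a) for $\mathfrak D$ in any universes implies (b).) -/

import Mathlib

open CategoryTheory MonoidalCategory
open scoped MonObj

universe w v u v' u'

namespace TensorCat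

/-- A tensor category over the field `k`: an additive `k`-linear category with a `k`-bilinear
symmetric monoidal structure such that `k → End(𝟙)` is bijective. The linear, monoidal and
symmetric structures are carried by the other type classes. -/
class IsTensorCategory (k : Type w) [Field k] (C : Type u) [Category.{v} C] [Preadditive C]
    [Linear k C] [MonoidalCategory C] [SymmetricCategory C] : Prop extends
    MonoidalPreadditive C, MonoidalLinear k C, Limits.HasFiniteBiproducts C where
  bijective_algebraMap_end_unit : Function.Bijective (algebraMap k (End (𝟙_ C)))

section Monoidal

variable {C : Type u} [Category.{v} C] [MonoidalCategory C]

/-- The internal endomorphism algebra `V ⊗ W` of a rigid object `V` with dual `W`. The unit is the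
coevaluation `𝟙 → V ⊗ W` and the product contracts the two inner factors by the evaluation
`W ⊗ V → 𝟙`. -/
def internalEnd (V W : C) [ExactPairing V W] : Mon C where
  X := V ⊗ W
  mon :=
    { one := η_ V W
      mul := (α_ V W (V ⊗ W)).hom ≫ V ◁ ((α_ W V W).inv ≫ ε_ V W ▷ W ≫ (λ_ W).hom)
      one_mul := by
        calc _ = 𝟙 (𝟙_ C ⊗ V ⊗ W) ⊗≫ (η_ V W ▷ V ⊗≫ V ◁ ε_ V W) ▷ W ⊗≫ 𝟙 (V ⊗ W) := by monoidal
          _ = _ := by rw [ExactPairing.evaluation_coevaluation'']; monoidal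
      mul_one := by
        calc _ = 𝟙 _ ⊗≫ V ◁ (W ◁ η_ V W ⊗≫ ε_ V W ▷ W) ⊗≫ 𝟙 _ := by monoidal
          _ = _ := by rw [ExactPairing.coevaluation_evaluation'']; monoidal
      mul_assoc := by
        calc _ = 𝟙 _ ⊗≫ V ◁ (ε_ V W ▷ (W ⊗ V) ≫ 𝟙_ C ◁ ε_ V W) ▷ W ⊗≫ 𝟙 _ := by monoidal
          _ = _ := by rw [← whisker_exchange]; monoidal }

/-- An algebra is split if it is isomorphic, as an algebra, to the internal endomorphism algebra of
some rigid object. -/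
def IsSplit (A : Mon C) : Prop :=
  ∃ (V W : C) (_ : ExactPairing V W), Nonempty (A ≅ internalEnd V W)

/-- Restriction of the right action of a bimodule along an algebra homomorphism. -/
def twistRight {R S T : Mon C} (f : T ⟶ S) (M : Bimod R S) : Bimod R T where
  X := M.X
  actLeft := M.actLeft
  one_actLeft := M.one_actLeft
  left_assoc := M.left_assoc
  actRight := M.X ◁ f.hom ≫ M.actRight
  actRight_one := by
    rw [← Category.assoc, ← whiskerLeft_comp, IsMonHom.one_hom, M.actRight_one]
  right_assoc := by
    rw [← Category.assoc, ← whiskerLeft_comp, IsMonHom.mul_hom, whiskerLeft_comp, Category.assoc,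
      M.right_assoc, MonoidalCategory.tensorHom_def]
    simp [← whisker_exchange_assoc]
  middle_assoc := by
    rw [← whisker_exchange_assoc, M.middle_assoc]
    simp

end Monoidal

section Symmetric

variable {C : Type u} [Category.{v} C] [MonoidalCategory C] [SymmetricCategory C]

/-- The map `(a ⊗ b) ⊗ x ↦ a x b`. -/
def sandwich (A : Mon C) : (A.X ⊗ A.X) ⊗ A.X ⟶ A.X :=
  (α_ A.X A.X A.X).hom ≫ A.X ◁ ((β_ A.X A.X).hom ≫ μ[A.X]) ≫ μ[A.X]

/-- The natural map `A ⊗ Aᵒᵖ → End(A)`, `a ⊗ b ↦ (x ↦ a x b)`, where `A'` is a dual of `A` and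
`End(A)` has underlying object `A ⊗ A'`. It is the transpose of `sandwich A`. -/
def azumayaMap (A : Mon C) (A' : C) [ExactPairing A.X A'] :
    A.X ⊗ A.X ⟶ (internalEnd A.X A').X :=
  tensorRightHomEquiv (A.X ⊗ A.X) A.X A' A.X (sandwich A)

/-- An Azumaya algebra: the underlying object is rigid and `A ⊗ Aᵒᵖ → End(A)` is an isomorphism. -/
def IsAzumaya (A : Mon C) : Prop :=
  ∃ (A' : C) (_ : ExactPairing A.X A'), IsIso (azumayaMap A A')

/-- For a bimodule `M` over `A ⊗ A`, the bimodule `M†`: the same object and left action, with the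
right action twisted by the symmetry of `A ⊗ A` (which is an algebra automorphism). -/
def dagger {A : Mon C} (M : Bimod (A ⊗ A) (A ⊗ A)) : Bimod (A ⊗ A) (A ⊗ A) :=
  twistRight (β_ A A).hom M

/-- `(-)†` on morphisms: the underlying morphism does not change. -/
def daggerMap {A : Mon C} {M N : Bimod (A ⊗ A) (A ⊗ A)} (f : M ⟶ N) : dagger M ⟶ dagger N where
  hom := f.hom
  left_act_hom := f.left_act_hom
  right_act_hom := by
    change (M.X ◁ (β_ A A).hom.hom ≫ M.actRight) ≫ f.hom =
      f.hom ▷ (A ⊗ A).X ≫ N.X ◁ (β_ A A).hom.hom ≫ N.actRight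
    rw [Category.assoc, f.right_act_hom, whisker_exchange_assoc]

/-- The canonical isomorphism `M†† ≅ M`, the identity on underlying objects. -/
def daggerDagger {A : Mon C} (M : Bimod (A ⊗ A) (A ⊗ A)) : dagger (dagger M) ≅ M :=
  Bimod.isoOfIso (Iso.refl M.X)
    (by
      change M.actLeft ≫ 𝟙 M.X = (A ⊗ A).X ◁ 𝟙 M.X ≫ M.actLeft
      simp)
    (by
      change (M.X ◁ (β_ A A).hom.hom ≫ M.X ◁ (β_ A A).hom.hom ≫ M.actRight) ≫ 𝟙 M.X =
        𝟙 M.X ▷ (A ⊗ A).X ≫ M.actRight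
      simp [← whiskerLeft_comp_assoc])

/-- The condition `η̃(A) = 1`: for the algebra `B = A ⊗ A` there is an isomorphism of
`B`-bimodules `i : B → B†` whose square `B → B† → B†† = B` is the identity. -/
def TildeEtaTrivial (A : Mon C) : Prop :=
  ∃ i : Bimod.regular (A ⊗ A) ≅ dagger (Bimod.regular (A ⊗ A)),
    i.hom ≫ daggerMap i.hom ≫ (daggerDagger (Bimod.regular (A ⊗ A))).hom = 𝟙 _

end Symmetric

/-- There are a tensor category `D` over `k` (with objects in `Type u'` and morphisms in
`Type v'`) and a fully faithful tensor functor `F : C ⥤ D`, that is, a `k`-linear symmetric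
monoidal functor, such that the algebra `F(B)` is split in `D`. -/
def SplitsInFullyFaithfulExtension (k : Type w) [Field k] {C : Type u} [Category.{v} C]
    [Preadditive C] [Linear k C] [MonoidalCategory C] [SymmetricCategory C] (B : Mon C) : Prop :=
  ∃ (D : Type u') (_ : Category.{v'} D) (_ : Preadditive D) (_ : Linear k D)
    (_ : MonoidalCategory D) (_ : SymmetricCategory D) (_ : IsTensorCategory k D)
    (F : C ⥤ D) (_ : F.Braided),
    F.Additive ∧ F.Linear k ∧ F.Full ∧ F.Faithful ∧ IsSplit (F.mapMon.obj B)

end TensorCat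

set_option linter.unusedSectionVars false

universe v₁ u₁


/-! Everything goes through an element `s = s' ⊗ s''` of `B ⊗ B` with `s² = 1` and `x s = s τ(x)`
for all `x` in `B ⊗ B` (`IsSwap`). An isomorphism of bimodules `E ⟶ E†` with square one is right
multiplication by such an `s`, so (b) says that `s` exists (`tildeEtaTrivial_iff`).

If `B` is the internal endomorphism algebra of `V`, then `B ⊗ B` is that of `V ⊗ V`, and `s` is the
element acting on `V ⊗ V` as the symmetry (`exists_isSwap_of_action`). A fully faithful tensor
functor reflects the existence of `s` (`exists_isSwap_of_map`), so (a) implies (b), whatever the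
universes of the target.

Conversely, let `s` be given. If `B` were the endomorphism algebra of `V`, then `V ⊗ V*` would be
`B`, and objects `X ⊗ (V*)^{⊗ n}` would be described by objects of `C` with `n` commuting right
actions of `B`. These objects, for all `n`, form the category `PowMod B`. It contains `C` as its
part of degree zero, and its tensor product concatenates the slots. The symmetry of `C` permutes the
slots instead of preserving them, so it has to be corrected by operators permuting them back. Acting
by `s` through the slots `i` and `j` exchanges these slots, and such operators assemble into a well
defined action of the symmetric group (`PowMod.Rep.unique`). With this correction `PowMod B` is
symmetric monoidal (`PowMod.symmetricCategory`).

Let `R` be the regular right module, of degree one. It is to become rigid with endomorphism algebra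
`B`, but `PowMod B` has no negative degrees. They are adjoined by formal differences `pos - neg`, in
the manner of the Int construction on a traced category. Composition of formal differences needs
partial traces over `neg` satisfying the yanking identity. For `R` these come from the unit `1 → B`
and the reduced trace form `t` built from `s` and the duality of `B`; yanking is the identity `s'
t(s'') = 1` (`comp_whiskerLeft_swapTrace`, `PowMod.traceHom_regular`). In the category of formal
differences `0 - R` is dual to `R` (`Diff.exactPairing`), and `C` still embeds fully faithfully.

Finally `B` acts on `R` by left multiplication, and `X ⟶ B` corresponds bijectively to `X ⊗ R ⟶ R`:
the inverse is a partial trace against `s`, and it is inverse because `s` acts on `R ⊗ R` as the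
corrected symmetry (`PowMod.tensorμ_regularAction`, `bijective_action`). Hence `B` becomes split
(`isSplit_of_action`). Passing to matrices supplies direct sums, and restricting to objects named by
finite expressions (`Code`) brings the objects back to the universe of those of `C`. -/

namespace TensorCat

/-! ### The swap element of `B ⊗ B` and the reduced trace form -/

section Swap

variable {C : Type u} [Category.{v} C] [MonoidalCategory C] [SymmetricCategory C]

@[simp]
theorem whiskerLeft_braiding_braiding (X Y Z : C) :
    X ◁ (β_ Y Z).hom ≫ X ◁ (β_ Z Y).hom = 𝟙 _ := by
  rw [← whiskerLeft_comp, SymmetricCategory.symmetry, whiskerLeft_id]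

@[simp]
theorem whiskerLeft_braiding_braiding_assoc (X Y Z : C) {W : C} (f : X ⊗ Y ⊗ Z ⟶ W) :
    X ◁ (β_ Y Z).hom ≫ X ◁ (β_ Z Y).hom ≫ f = f := by
  rw [← Category.assoc, whiskerLeft_braiding_braiding, Category.id_comp]

@[simp]
theorem whiskerRight_braiding_braiding (X Y Z : C) :
    (β_ Y Z).hom ▷ X ≫ (β_ Z Y).hom ▷ X = 𝟙 _ := by
  rw [← comp_whiskerRight, SymmetricCategory.symmetry, id_whiskerRight]

@[simp]
theorem whiskerRight_braiding_braiding_assoc (X Y Z : C) {W : C} (f : (Y ⊗ Z) ⊗ X ⟶ W) :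
    (β_ Y Z).hom ▷ X ≫ (β_ Z Y).hom ▷ X ≫ f = f := by
  rw [← Category.assoc, whiskerRight_braiding_braiding, Category.id_comp]

section RightMul

variable {E : C} [MonObj E]

/-- Right multiplication by an element of an algebra. -/
def rightMul (q : 𝟙_ C ⟶ E) : E ⟶ E := (ρ_ E).inv ≫ E ◁ q ≫ μ[E]

theorem one_rightMul (q : 𝟙_ C ⟶ E) : η[E] ≫ rightMul q = q := by
  rw [rightMul, rightUnitor_inv_naturality_assoc, ← whisker_exchange_assoc, MonObj.one_mul,
    ← unitors_inv_equal]
  simp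

theorem rightMul_one : rightMul η[E] = 𝟙 E := by
  rw [rightMul, MonObj.mul_one, Iso.inv_hom_id]

theorem mul_rightMul (q : 𝟙_ C ⟶ E) : μ[E] ≫ rightMul q = E ◁ rightMul q ≫ μ[E] := by
  calc _ = (ρ_ _).inv ≫ (μ[E] ▷ 𝟙_ C ≫ E ◁ q) ≫ μ[E] := by rw [rightMul]; monoidal
    _ = (ρ_ _).inv ≫ (_ ◁ q ≫ μ[E] ▷ E) ≫ μ[E] := by rw [whisker_exchange]
    _ = _ := by
      rw [Category.assoc, MonObj.mul_assoc, rightMul]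
      monoidal

theorem rightMul_comp (q r : 𝟙_ C ⟶ E) : rightMul q ≫ rightMul r = rightMul (q ≫ rightMul r) := by
  conv_lhs => rw [rightMul, Category.assoc, Category.assoc, mul_rightMul]
  rw [← whiskerLeft_comp_assoc]
  rfl

theorem comp_rightMul (p q : 𝟙_ C ⟶ E) :
    p ≫ rightMul q = (λ_ (𝟙_ C)).inv ≫ (p ⊗ₘ q) ≫ μ[E] := by
  rw [rightMul, MonoidalCategory.tensorHom_def, unitors_inv_equal, Category.assoc,
    rightUnitor_inv_naturality_assoc]

end RightMul

/-- An element `s` of `B ⊗ B` of square one such that conjugation by `s` is the symmetry. -/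
structure IsSwap (B : C) [MonObj B] (s : 𝟙_ C ⟶ B ⊗ B) : Prop where
  sq : (λ_ (𝟙_ C)).inv ≫ (s ⊗ₘ s) ≫ μ[B ⊗ B] = η[B ⊗ B]
  comm : rightMul s =
    (λ_ (B ⊗ B)).inv ≫ s ▷ (B ⊗ B) ≫ (B ⊗ B) ◁ (β_ B B).hom ≫ μ[B ⊗ B]

/-- A left linear map out of `E` is right multiplication by the image `s` of the unit. Right
linearity into `E†` then reads `x s = s τ(x)`, and the square of the map is right multiplication by
`s²`. -/
theorem tildeEtaTrivial_iff (A : Mon C) :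
    TildeEtaTrivial A ↔ ∃ s : 𝟙_ C ⟶ A.X ⊗ A.X, IsSwap A.X s := by
  constructor
  · rintro ⟨i, hi⟩
    obtain ⟨f, hf⟩ : ∃ f : A.X ⊗ A.X ⟶ A.X ⊗ A.X, f = i.hom.hom := ⟨_, rfl⟩
    have hl : μ[A.X ⊗ A.X] ≫ f = (A.X ⊗ A.X) ◁ f ≫ μ[A.X ⊗ A.X] := by
      rw [hf]; exact i.hom.left_act_hom
    have hr : μ[A.X ⊗ A.X] ≫ f =
        f ▷ (A.X ⊗ A.X) ≫ (A.X ⊗ A.X) ◁ (β_ A.X A.X).hom ≫ μ[A.X ⊗ A.X] := by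
      rw [hf]; exact i.hom.right_act_hom
    have hff : f ≫ f = 𝟙 _ := by
      have h0 : f ≫ f ≫ 𝟙 (A.X ⊗ A.X) = 𝟙 _ := by
        rw [hf]; exact congrArg Bimod.Hom.hom hi
      rwa [Category.comp_id] at h0
    have h1 : rightMul (η[A.X ⊗ A.X] ≫ f) = f := by
      rw [rightMul, whiskerLeft_comp, Category.assoc, ← hl, MonObj.mul_one_assoc,
        Iso.inv_hom_id_assoc]
    refine ⟨η[A.X ⊗ A.X] ≫ f, ?_, ?_⟩
    · rw [← comp_rightMul, h1, Category.assoc, hff, Category.comp_id]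
    · rw [h1, comp_whiskerRight, Category.assoc, ← hr, MonObj.one_mul_assoc, Iso.inv_hom_id_assoc]
  · rintro ⟨s, hs⟩
    -- In elements: `x y s = s τ(x y) = s τ(x) τ(y) = (x s) τ(y)`, using that `τ` is multiplicative.
    have hr : μ[A.X ⊗ A.X] ≫ rightMul s =
        rightMul s ▷ (A.X ⊗ A.X) ≫ (A.X ⊗ A.X) ◁ (β_ A.X A.X).hom ≫ μ[A.X ⊗ A.X] := by
      have hb : μ[A.X ⊗ A.X] ≫ (β_ A.X A.X).hom =
          ((β_ A.X A.X).hom ⊗ₘ (β_ A.X A.X).hom) ≫ μ[A.X ⊗ A.X] := MonObj.mul_braiding A.X A.X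
      rw [hs.comm, leftUnitor_inv_naturality_assoc, whisker_exchange_assoc,
        ← whiskerLeft_comp_assoc, hb]
      simp only [comp_whiskerRight, Category.assoc, whiskerLeft_comp]
      rw [MonoidalCategory.tensorHom_def]
      calc _ = (λ_ _).inv ≫ s ▷ ((A.X ⊗ A.X) ⊗ A.X ⊗ A.X) ≫ (α_ _ _ _).inv ≫
            ((A.X ⊗ A.X) ◁ (β_ A.X A.X).hom) ▷ (A.X ⊗ A.X) ≫
            (((A.X ⊗ A.X) ⊗ A.X ⊗ A.X) ◁ (β_ A.X A.X).hom) ≫ (α_ _ _ _).hom ≫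
            (A.X ⊗ A.X) ◁ μ[A.X ⊗ A.X] ≫ μ[A.X ⊗ A.X] := by monoidal
        _ = _ := by
          rw [← MonObj.mul_assoc, whisker_exchange_assoc]
          monoidal
    have hff : rightMul s ≫ rightMul s = 𝟙 _ := by
      rw [rightMul_comp, comp_rightMul, hs.sq, rightMul_one]
    refine ⟨Bimod.isoOfIso (P := Bimod.regular (A ⊗ A)) (Q := dagger (Bimod.regular (A ⊗ A)))
      (Iso.mk (X := A.X ⊗ A.X) (Y := A.X ⊗ A.X) (rightMul s) (rightMul s) hff hff)
      (mul_rightMul s) hr, ?_⟩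
    refine Bimod.hom_ext _ _ ?_
    change rightMul s ≫ rightMul s ≫ 𝟙 (A.X ⊗ A.X) = 𝟙 _
    rw [Category.comp_id, hff]

variable {B : C} [MonObj B] {s : 𝟙_ C ⟶ B ⊗ B}

/-- Products with one-sided tensors, here and in `mul_inl`, turn `IsSwap.comm`, a statement about
all of `B ⊗ B`, into rules for moving a single element of `B` past `s`. -/
theorem inr_mul : ((λ_ B).inv ≫ η[B] ▷ B) ▷ (B ⊗ B) ≫ μ[B ⊗ B] =
    (α_ B B B).inv ≫ (β_ B B).hom ▷ B ≫ (α_ B B B).hom ≫ B ◁ μ[B] := by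
  rw [MonObj.tensorObj.mul_def, comp_whiskerRight, Category.assoc, ← tensorHom_id η[B] B,
    tensorμ_natural_left_assoc, tensorHom_comp_tensorHom, MonObj.one_mul, id_whiskerRight,
    Category.id_comp, tensorμ]
  simp only [MonoidalCategory.tensorHom_def]
  simp

theorem mul_inl : (B ⊗ B) ◁ ((ρ_ B).inv ≫ B ◁ η[B]) ≫ μ[B ⊗ B] =
    (α_ B B B).hom ≫ B ◁ (β_ B B).hom ≫ (α_ B B B).inv ≫ μ[B] ▷ B := by
  rw [MonObj.tensorObj.mul_def, whiskerLeft_comp, Category.assoc, ← id_tensorHom B η[B],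
    tensorμ_natural_right_assoc, tensorHom_comp_tensorHom, MonObj.mul_one, whiskerLeft_id,
    Category.id_comp, tensorμ]
  simp only [MonoidalCategory.tensorHom_def]
  simp

variable (s) in
/-- The map `y ↦ s' ⊗ y s''`. -/
def insertRight : B ⟶ B ⊗ B :=
  (λ_ B).inv ≫ s ▷ B ≫ (α_ B B B).hom ≫ B ◁ ((β_ B B).hom ≫ μ[B])

theorem insertRight_eq : insertRight s =
    (ρ_ B).inv ≫ B ◁ s ≫ (α_ B B B).inv ≫ (β_ B B).hom ▷ B ≫ (α_ B B B).hom ≫ B ◁ μ[B] := by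
  have e2 : (λ_ B).inv ≫ s ▷ B = (ρ_ B).inv ≫ B ◁ s ≫ (β_ B (B ⊗ B)).hom := by
    rw [BraidedCategory.braiding_naturality_right, braiding_tensorUnit_right]
    simp
  rw [insertRight, reassoc_of% e2]
  simp

/-- `(1 ⊗ y) s = s (y ⊗ 1)` -/
theorem IsSwap.mul_right_eq (hs : IsSwap B s) :
    insertRight s =
      (λ_ B).inv ≫ s ▷ B ≫ (α_ B B B).hom ≫ B ◁ (β_ B B).hom ≫ (α_ B B B).inv ≫ μ[B] ▷ B := by
  have h := ((λ_ B).inv ≫ η[B] ▷ B) ≫= hs.comm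
  have e : ((λ_ B).inv ≫ η[B] ▷ B) ≫ (β_ B B).hom = (ρ_ B).inv ≫ B ◁ η[B] := by
    simp
  rw [rightMul, rightUnitor_inv_naturality_assoc, ← whisker_exchange_assoc, inr_mul,
    leftUnitor_inv_naturality_assoc, whisker_exchange_assoc, ← whiskerLeft_comp_assoc, e,
    mul_inl] at h
  rw [← h, insertRight_eq]

/-- Taking `x = s` in `x s = s τ(x)` gives `s τ(s) = s s = 1`; multiply by `s` on the left. -/
theorem IsSwap.comp_braiding (hs : IsSwap B s) : s ≫ (β_ B B).hom = s := by
  have h0 : s ≫ rightMul s = η[B ⊗ B] := by rw [comp_rightMul, hs.sq]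
  have h1 : s ≫ rightMul (s ≫ (β_ B B).hom) = η[B ⊗ B] := by
    rw [← h0]
    conv_rhs => rw [hs.comm]
    rw [leftUnitor_inv_naturality_assoc, comp_rightMul, MonoidalCategory.tensorHom_def',
      whiskerLeft_comp, Category.assoc, Category.assoc, ← whisker_exchange_assoc]
  have h2 : s ≫ rightMul s ≫ rightMul (s ≫ (β_ B B).hom) = s := by
    rw [rightMul_comp, h1, rightMul_one, Category.comp_id]
  rw [reassoc_of% h0, one_rightMul] at h2
  exact h2

section Trace

variable {B' : C} [ExactPairing B B']

variable (s B') in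
/-- The reduced trace form attached to `s`. -/
def swapTrace : B ⟶ 𝟙_ C :=
  (ρ_ B).inv ≫ B ◁ (η_ B B' ≫ (insertRight s ≫ μ[B]) ▷ B') ≫ (α_ B B B').inv ≫
    ((β_ B B).hom ≫ μ[B]) ▷ B' ≫ (β_ B B').hom ≫ ε_ B B'

/-- This is `s² = 1` written as two nested copies of `s`, the form in which it occurs inside the
trace. -/
theorem comp_insertRight (hs : IsSwap B s) :
    s ≫ B ◁ insertRight s ≫ (α_ B B B).inv ≫ μ[B] ▷ B = η[B ⊗ B] := by
  rw [← hs.sq, ← comp_rightMul, rightMul, insertRight_eq, MonObj.tensorObj.mul_def, tensorμ,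
    MonoidalCategory.tensorHom_def']
  monoidal

/-- Write `T(y) = s' y s''` and `t(x) = Tr(y ↦ T(y) x)`; for a matrix algebra `T(y)` is the trace of
`y` times the unit, so `t` is the reduced trace and no division by the rank is needed. The rule `(1
⊗ y) s = s (y ⊗ 1)` turns `s' t(s'')` into `s' T(s'')`, which is the product of the two legs of `s²
= 1`. -/
theorem comp_whiskerLeft_swapTrace (hs : IsSwap B s) :
    s ≫ B ◁ swapTrace s B' ≫ (ρ_ B).hom = η[B] := by
  have h1 (w : 𝟙_ C ⟶ B ⊗ B') : s ≫ B ◁ ((ρ_ B).inv ≫ B ◁ w ≫ (α_ B B B').inv ≫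
      ((β_ B B).hom ≫ μ[B]) ▷ B' ≫ (β_ B B').hom ≫ ε_ B B') ≫ (ρ_ B).hom = w ≫
      insertRight s ▷ B' ≫ (α_ B B B').hom ≫ B ◁ ((β_ B B').hom ≫ ε_ B B') ≫ (ρ_ B).hom := by
    calc _ = (ρ_ _).inv ≫ (s ▷ 𝟙_ C ≫ (B ⊗ B) ◁ w) ≫ (α_ _ _ _).hom ≫ B ◁ ((α_ B B B').inv ≫
          ((β_ B B).hom ≫ μ[B]) ▷ B' ≫ (β_ B B').hom ≫ ε_ B B') ≫ (ρ_ B).hom := by monoidal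
      _ = _ := by
        rw [← whisker_exchange, insertRight]
        monoidal
  -- In a basis `e_i` with dual basis `e^i`, the left side is the sum of `s' e^i(T(e_i) s'')`.
  -- Moving `T(e_i)` to the other leg of `s` leaves `s' T(e_i) e^i(s'')`, where a zigzag identity
  -- removes the basis.
  have h2 (T : B ⟶ B) : (η_ B B' ≫ T ▷ B') ≫
      insertRight s ▷ B' ≫ (α_ B B B').hom ≫ B ◁ ((β_ B B').hom ≫ ε_ B B') ≫ (ρ_ B).hom =
      s ≫ B ◁ T ≫ μ[B] := by
    rw [hs.mul_right_eq]
    calc _ = 𝟙 _ ⊗≫ (𝟙_ C ◁ (η_ B B' ≫ T ▷ B') ≫ s ▷ (B ⊗ B')) ⊗≫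
            B ◁ (β_ B B).hom ▷ B' ⊗≫ (μ[B] ▷ (B ⊗ B') ≫ B ◁ (β_ B B').hom) ⊗≫ B ◁ ε_ B B' ⊗≫
            𝟙 _ := by monoidal
      _ = 𝟙 _ ⊗≫ s ⊗≫ (B ◁ B ◁ η_ B B') ⊗≫
            B ◁ (B ◁ T ≫ (β_ B B).hom) ▷ B' ⊗≫ B ◁ B ◁ (β_ B B').hom ⊗≫
            (μ[B] ▷ (B' ⊗ B) ≫ B ◁ ε_ B B') ⊗≫ 𝟙 _ := by
          rw [whisker_exchange, ← whisker_exchange μ[B] (β_ B B').hom]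
          monoidal
      _ = 𝟙 _ ⊗≫ s ⊗≫ (B ◁ B ◁ η_ B B') ⊗≫
            B ◁ (β_ B B).hom ▷ B' ⊗≫ B ◁ (T ▷ (B ⊗ B') ≫ B ◁ (β_ B B').hom) ⊗≫
            (μ[B] ▷ (B' ⊗ B) ≫ B ◁ ε_ B B') ⊗≫ 𝟙 _ := by
          rw [BraidedCategory.braiding_naturality_right]
          monoidal
      _ = 𝟙 _ ⊗≫ s ⊗≫ B ◁ (B ◁ η_ B B' ≫ (β_ B (B ⊗ B')).hom) ⊗≫
            B ◁ (T ▷ (B' ⊗ B) ≫ B ◁ ε_ B B') ⊗≫ μ[B] ⊗≫ 𝟙 _ := by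
          rw [← whisker_exchange, ← whisker_exchange,
            BraidedCategory.braiding_tensor_right_hom]
          monoidal
      _ = 𝟙 _ ⊗≫ s ⊗≫ B ◁ (η_ B B' ▷ B ⊗≫ B ◁ ε_ B B') ⊗≫ B ◁ T ⊗≫ μ[B] ⊗≫ 𝟙 _ := by
          rw [BraidedCategory.braiding_naturality_right, braiding_tensorUnit_right,
            ← whisker_exchange]
          monoidal
      _ = _ := by
          rw [ExactPairing.evaluation_coevaluation'']
          monoidal
  rw [swapTrace, h1, h2, whiskerLeft_comp_assoc]
  -- With two copies of `s`, the element is `s₁' s₂' s₁'' s₂''`, the image of `s²` under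
  -- multiplication.
  have h3 : s ≫ B ◁ insertRight s ≫ B ◁ μ[B] ≫ μ[B] = η[B ⊗ B] ≫ μ[B] := by
    rw [← comp_insertRight hs]
    simp only [Category.assoc, MonObj.mul_assoc, Iso.inv_hom_id_assoc]
  rw [h3, MonObj.tensorObj.one_def, MonoidalCategory.tensorHom_def]
  simp [unitors_inv_equal]

end Trace

end Swap
end TensorCat


namespace TensorCat

/-! ### Commuting right actions of `B` and the operators given by `s` -/

section PowMod

variable {C : Type u} [Category.{v} C] [MonoidalCategory C] [SymmetricCategory C]

/-- An object with `deg` commuting right actions of the algebra `B`. The entries of `act` beyond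
`deg` are irrelevant. -/
structure PowMod (B : C) [MonObj B] where
  deg : ℕ
  X : C
  act : ℕ → (X ⊗ B ⟶ X)
  act_one : ∀ i < deg, X ◁ η[B] ≫ act i = (ρ_ X).hom
  act_mul : ∀ i < deg, X ◁ μ[B] ≫ act i = (α_ X B B).inv ≫ act i ▷ B ≫ act i
  act_comm : ∀ i < deg, ∀ j < deg, i ≠ j →
    act i ▷ B ≫ act j = (α_ X B B).hom ≫ X ◁ (β_ B B).hom ≫ (α_ X B B).inv ≫ act j ▷ B ≫ act i

variable {B : C} [MonObj B] {s : 𝟙_ C ⟶ B ⊗ B}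

namespace PowMod

variable (M : PowMod B)

/-- The right action of `B ⊗ B` through the slots `i` and `j`. -/
def act₂ (i j : ℕ) : M.X ⊗ (B ⊗ B) ⟶ M.X :=
  (α_ M.X B B).inv ≫ M.act i ▷ B ≫ M.act j

variable {M} {i j k : ℕ}

/-- Two actions that commute combine to one action of the algebra `B ⊗ B`: the middle exchange in
the product of `B ⊗ B` is the commutation of slot `j` with slot `i`. -/
theorem act₂_mul (hi : i < M.deg) (hj : j < M.deg) (hij : i ≠ j) :
    M.X ◁ μ[B ⊗ B] ≫ M.act₂ i j = (α_ M.X _ _).inv ≫ M.act₂ i j ▷ (B ⊗ B) ≫ M.act₂ i j := by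
  rw [MonObj.tensorObj.mul_def, act₂]
  calc _ = M.X ◁ tensorμ B B B B ⊗≫ (M.X ◁ μ[B] ≫ M.act i) ▷ (B ⊗ B) ⊗≫
        (M.X ◁ μ[B] ≫ M.act j) := by
        rw [MonoidalCategory.tensorHom_def]
        calc _ = M.X ◁ tensorμ B B B B ⊗≫ (M.X ◁ μ[B]) ▷ (B ⊗ B) ⊗≫
                ((M.X ⊗ B) ◁ μ[B] ≫ M.act i ▷ B) ⊗≫ M.act j := by monoidal
          _ = _ := by rw [whisker_exchange]; monoidal
    _ = 𝟙 _ ⊗≫ (M.act i ▷ B ▷ B ▷ B ≫ ((α_ M.X B B).hom ≫ M.X ◁ (β_ B B).hom ≫ (α_ M.X B B).inv ≫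
          M.act i ▷ B ≫ M.act j) ▷ B) ⊗≫ M.act j := by
        rw [M.act_mul i hi, M.act_mul j hj, tensorμ]
        calc _ = 𝟙 _ ⊗≫ ((M.X ⊗ B) ◁ (β_ B B).hom ≫ M.act i ▷ (B ⊗ B)) ▷ B ⊗≫
              M.act i ▷ (B ⊗ B) ⊗≫ M.act j ▷ B ⊗≫ M.act j := by monoidal
          _ = _ := by rw [whisker_exchange]; monoidal
    _ = _ := by
        rw [← M.act_comm j hj i hi hij.symm]
        monoidal

theorem act₂_symm (hi : i < M.deg) (hj : j < M.deg) (hij : i ≠ j) :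
    M.act₂ j i = M.X ◁ (β_ B B).hom ≫ M.act₂ i j := by
  rw [act₂, act₂, M.act_comm j hj i hi hij.symm]
  simp

theorem act_act₂ (hi : i < M.deg) (hj : j < M.deg) (hk : k < M.deg) (hki : k ≠ i) (hkj : k ≠ j) :
    M.act k ▷ (B ⊗ B) ≫ M.act₂ i j =
      (α_ _ _ _).hom ≫ M.X ◁ (β_ B (B ⊗ B)).hom ≫ (α_ _ _ _).inv ≫ M.act₂ i j ▷ B ≫ M.act k := by
  calc _ = (α_ _ _ _).inv ≫ (M.act k ▷ B ≫ M.act i) ▷ B ≫ M.act j := by rw [act₂]; monoidal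
    _ = 𝟙 _ ⊗≫ M.X ◁ (β_ B B).hom ▷ B ⊗≫ M.act i ▷ (B ⊗ B) ⊗≫ (M.act k ▷ B ≫ M.act j) := by
      rw [M.act_comm k hk i hi hki]
      monoidal
    _ = 𝟙 _ ⊗≫ M.X ◁ (β_ B B).hom ▷ B ⊗≫ (M.act i ▷ (B ⊗ B) ≫ M.X ◁ (β_ B B).hom) ⊗≫
        M.act j ▷ B ≫ M.act k := by
      rw [M.act_comm k hk j hj hkj]
      monoidal
    _ = _ := by
      rw [← whisker_exchange, BraidedCategory.braiding_tensor_right_hom, act₂]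
      monoidal

/-- Viewing one slot as the action of `y ⊗ 1` (or of `1 ⊗ y` in `act_eq_inr`) lets its commutation
with the operator of `s` be computed inside `B ⊗ B`. -/
theorem act_eq_inl (hj : j < M.deg) :
    M.act i = M.X ◁ ((ρ_ B).inv ≫ B ◁ η[B]) ≫ M.act₂ i j := by
  calc _ = M.act i ≫ (ρ_ _).inv ≫ (ρ_ _).hom := by simp
    _ = 𝟙 _ ⊗≫ (M.act i ▷ 𝟙_ C ≫ M.X ◁ η[B]) ⊗≫ M.act j := by
      rw [← M.act_one j hj]; monoidal
    _ = _ := by rw [← whisker_exchange, act₂]; monoidal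

theorem act_eq_inr (hi : i < M.deg) :
    M.act j = M.X ◁ ((λ_ B).inv ≫ η[B] ▷ B) ≫ M.act₂ i j := by
  calc _ = 𝟙 _ ⊗≫ (ρ_ M.X).hom ▷ B ⊗≫ M.act j := by monoidal
    _ = _ := by rw [← M.act_one i hi, act₂]; monoidal

variable (s M i j) in
/-- Right multiplication by `s` through the slots `i` and `j`. -/
def swapOp : M.X ⟶ M.X := (ρ_ M.X).inv ≫ M.X ◁ s ≫ M.act₂ i j

theorem whiskerLeft_act₂_swapOp (hi : i < M.deg) (hj : j < M.deg) (hij : i ≠ j) {Z : C}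
    (y : Z ⟶ B ⊗ B) :
    (M.X ◁ y ≫ M.act₂ i j) ≫ M.swapOp s i j = M.X ◁ (y ≫ rightMul s) ≫ M.act₂ i j := by
  calc _ = 𝟙 _ ⊗≫ M.X ◁ y ⊗≫ (M.act₂ i j ▷ 𝟙_ C ≫ M.X ◁ s) ⊗≫ M.act₂ i j := by
        rw [swapOp]; monoidal
    _ = 𝟙 _ ⊗≫ M.X ◁ y ⊗≫ M.X ◁ (B ⊗ B) ◁ s ≫ (α_ M.X _ _).inv ≫ M.act₂ i j ▷ (B ⊗ B) ≫
        M.act₂ i j := by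
      rw [← whisker_exchange]; monoidal
    _ = _ := by
      rw [← act₂_mul hi hj hij, rightMul]; monoidal

theorem swapOp_whiskerRight_act₂ (hi : i < M.deg) (hj : j < M.deg) (hij : i ≠ j) {Z : C}
    (y : Z ⟶ B ⊗ B) :
    M.swapOp s i j ▷ Z ≫ M.X ◁ y ≫ M.act₂ i j =
      M.X ◁ ((λ_ Z).inv ≫ s ▷ Z ≫ (B ⊗ B) ◁ y ≫ μ[B ⊗ B]) ≫ M.act₂ i j := by
  calc _ = 𝟙 _ ⊗≫ M.X ◁ s ▷ Z ⊗≫ (M.act₂ i j ▷ Z ≫ M.X ◁ y) ≫ M.act₂ i j := by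
        rw [swapOp]; monoidal
    _ = 𝟙 _ ⊗≫ M.X ◁ s ▷ Z ⊗≫ M.X ◁ (B ⊗ B) ◁ y ≫ (α_ M.X _ _).inv ≫ M.act₂ i j ▷ (B ⊗ B) ≫
        M.act₂ i j := by
      rw [← whisker_exchange]; monoidal
    _ = _ := by
      rw [← act₂_mul hi hj hij]; monoidal

theorem swapOp_swapOp (hs : IsSwap B s) (hi : i < M.deg) (hj : j < M.deg) (hij : i ≠ j) :
    M.swapOp s i j ≫ M.swapOp s i j = 𝟙 M.X := by
  have h := whiskerLeft_act₂_swapOp (s := s) hi hj hij s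
  rw [comp_rightMul, hs.sq] at h
  have h2 : (ρ_ _).inv ≫ M.X ◁ η[B ⊗ B] ≫ M.act₂ i j = 𝟙 M.X := by
    calc _ = (ρ_ M.X).inv ≫ M.X ◁ η[B] ≫ M.X ◁ ((ρ_ B).inv ≫ B ◁ η[B]) ≫ M.act₂ i j := by
          rw [MonObj.tensorObj.one_def, MonoidalCategory.tensorHom_def]
          monoidal
      _ = _ := by
        rw [← act_eq_inl hj, M.act_one i hi, Iso.inv_hom_id]
  conv_lhs => lhs; rw [swapOp]
  rw [Category.assoc, h, h2]

theorem swapOp_symm (hs : IsSwap B s) (hi : i < M.deg) (hj : j < M.deg) (hij : i ≠ j) :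
    M.swapOp s j i = M.swapOp s i j := by
  rw [swapOp, act₂_symm hi hj hij, ← whiskerLeft_comp_assoc, hs.comp_braiding, swapOp]

/-- From `(y ⊗ 1) s = s (1 ⊗ y)`. This is why `s`, acting through two slots, exchanges them. -/
theorem act_swapOp_left (hs : IsSwap B s) (hi : i < M.deg) (hj : j < M.deg) (hij : i ≠ j) :
    M.act i ≫ M.swapOp s i j = M.swapOp s i j ▷ B ≫ M.act j := by
  conv_lhs => rw [act_eq_inl hj, whiskerLeft_act₂_swapOp hi hj hij, hs.comm]
  conv_rhs => rw [act_eq_inr hi, swapOp_whiskerRight_act₂ hi hj hij]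
  rw [leftUnitor_inv_naturality_assoc, whisker_exchange_assoc, ← whiskerLeft_comp_assoc]
  congr 6
  simp

theorem act_swapOp_right (hs : IsSwap B s) (hi : i < M.deg) (hj : j < M.deg) (hij : i ≠ j) :
    M.act j ≫ M.swapOp s i j = M.swapOp s i j ▷ B ≫ M.act i := by
  rw [← swapOp_symm hs hi hj hij, act_swapOp_left hs hj hi hij.symm]

theorem act_swapOp_of_ne (hi : i < M.deg) (hj : j < M.deg) (hk : k < M.deg)
    (hki : k ≠ i) (hkj : k ≠ j) :
    M.act k ≫ M.swapOp s i j = M.swapOp s i j ▷ B ≫ M.act k := by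
  calc _ = (ρ_ _).inv ≫ (M.act k ▷ 𝟙_ C ≫ M.X ◁ s) ≫ M.act₂ i j := by rw [swapOp]; monoidal
    _ = 𝟙 _ ⊗≫ M.X ◁ (B ◁ s ≫ (β_ B (B ⊗ B)).hom) ⊗≫ M.act₂ i j ▷ B ≫ M.act k := by
      rw [← whisker_exchange, Category.assoc, act_act₂ hi hj hk hki hkj]; monoidal
    _ = _ := by
      rw [BraidedCategory.braiding_naturality_right, braiding_tensorUnit_right, swapOp]
      monoidal

/-- The operator is built from `s` and the two slot actions alone, so a morphism carrying these
actions to others carries the operator along. Applied to the operators themselves, this gives their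
conjugation relations. -/
theorem swapOp_naturality {M N : PowMod B} {i j i' j' : ℕ} (f : M.X ⟶ N.X)
    (hi : M.act i ≫ f = f ▷ B ≫ N.act i') (hj : M.act j ≫ f = f ▷ B ≫ N.act j') :
    M.swapOp s i j ≫ f = f ≫ N.swapOp s i' j' := by
  calc _ = (ρ_ _).inv ≫ M.X ◁ s ≫ (α_ M.X B B).inv ≫ M.act i ▷ B ≫ M.act j ≫ f := by
        rw [swapOp, act₂]; simp
    _ = (ρ_ _).inv ≫ (M.X ◁ s ≫ f ▷ (B ⊗ B)) ≫ N.act₂ i' j' := by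
      rw [hj, ← comp_whiskerRight_assoc, hi, act₂]; monoidal
    _ = _ := by rw [whisker_exchange, swapOp]; monoidal

end PowMod
end PowMod
end TensorCat


namespace TensorCat

/-! ### The action of the symmetric group on the slots -/

section Rep

variable {C : Type u} [Category.{v} C] [MonoidalCategory C] [SymmetricCategory C]
variable {B : C} [MonObj B] {s : 𝟙_ C ⟶ B ⊗ B}

namespace PowMod

open Equiv (swap Perm)

/-- `u` is a product of operators `swapOp` lifting the permutation `ρ` of the first `n` slots. -/
inductive Rep (s : 𝟙_ C ⟶ B ⊗ B) (M : PowMod B) (n : ℕ) : Perm ℕ → (M.X ⟶ M.X) → Prop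
  | one : Rep s M n 1 (𝟙 M.X)
  | step {ρ : Perm ℕ} {u : M.X ⟶ M.X} {i j : ℕ} (h : Rep s M n ρ u) (hi : i < n) (hj : j < n)
      (hij : i ≠ j) : Rep s M n (swap i j * ρ) (u ≫ M.swapOp s i j)

variable {M N : PowMod B} {n m : ℕ} {ρ κ : Perm ℕ} {u u' : M.X ⟶ M.X}

theorem perm_lt_of_fix (hρ : ∀ k, n ≤ k → ρ k = k) {k : ℕ} (hk : k < n) : ρ k < n := by
  by_contra! h
  have := ρ.injective (hρ _ h)
  omega

namespace Rep

theorem fix (h : Rep s M n ρ u) : ∀ k, n ≤ k → ρ k = k := by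
  induction h with
  | one => intro k _; rfl
  | step h hi hj hij ih =>
    intro k hk
    rw [Equiv.Perm.mul_apply, ih k hk, Equiv.swap_apply_of_ne_of_ne (by omega) (by omega)]

theorem lt (h : Rep s M n ρ u) {k : ℕ} (hk : k < n) : ρ k < n := perm_lt_of_fix h.fix hk

theorem mono (h : Rep s M n ρ u) (hnm : n ≤ m) : Rep s M m ρ u := by
  induction h with
  | one => exact .one
  | step h hi hj hij ih => exact .step ih (by omega) (by omega) hij

theorem mul (h : Rep s M n ρ u) (h' : Rep s M n κ u') : Rep s M n (κ * ρ) (u ≫ u') := by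
  induction h' with
  | one => simpa using h
  | step h' hi hj hij ih =>
    rw [mul_assoc, ← Category.assoc]
    exact .step ih hi hj hij

theorem act_swapOp (hs : IsSwap B s) {i j k : ℕ} (hi : i < M.deg) (hj : j < M.deg) (hij : i ≠ j)
    (hk : k < M.deg) : M.act k ≫ M.swapOp s i j = M.swapOp s i j ▷ B ≫ M.act (swap i j k) := by
  rcases eq_or_ne k i with rfl | hki
  · rw [Equiv.swap_apply_left, act_swapOp_left hs hi hj hij]
  rcases eq_or_ne k j with rfl | hkj
  · rw [Equiv.swap_apply_right, act_swapOp_right hs hi hj hij]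
  · rw [Equiv.swap_apply_of_ne_of_ne hki hkj, act_swapOp_of_ne hi hj hk hki hkj]

theorem act_comp (hs : IsSwap B s) (h : Rep s M n ρ u) (hn : n ≤ M.deg) {k : ℕ} (hk : k < M.deg) :
    M.act k ≫ u = u ▷ B ≫ M.act (ρ k) := by
  induction h with
  | one => simp
  | step h hi hj hij ih =>
    rw [reassoc_of% ih, act_swapOp hs (by omega) (by omega) hij
      ((h.mono hn).lt hk), comp_whiskerRight_assoc]
    rfl

theorem swapOp_comp (hs : IsSwap B s) {i j a b : ℕ} (hi : i < M.deg) (hj : j < M.deg)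
    (hij : i ≠ j) (ha : a < M.deg) (hb : b < M.deg) :
    M.swapOp s a b ≫ M.swapOp s i j =
      M.swapOp s i j ≫ M.swapOp s (swap i j a) (swap i j b) :=
  swapOp_naturality _ (act_swapOp hs hi hj hij ha) (act_swapOp hs hi hj hij hb)

/-- A normal form along the cosets of `S_n` in `S_{n+1}`: a word in the operators is a word on the
first `n` slots followed by at most one operator involving the last slot. Only the involution and
conjugation relations of transpositions are needed. -/
theorem decompose (hs : IsSwap B s) (h : Rep s M (n + 1) ρ u) (hn : n + 1 ≤ M.deg) :
    ∃ (ρ' : Perm ℕ) (u' : M.X ⟶ M.X), Rep s M n ρ' u' ∧ ((ρ = ρ' ∧ u = u') ∨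
      ∃ j < n, ρ = swap n j * ρ' ∧ u = u' ≫ M.swapOp s n j) := by
  -- Appending a transposition `(n b)`: if `(n b)` was already last, the two cancel; if `(n j)` with
  -- `j ≠ b` was last, then `(n b)(n j) = (n j)(j b)`, and `(j b)` is absorbed by the word on the
  -- first `n` slots.
  have key {ρ : Perm ℕ} {u : M.X ⟶ M.X} {b : ℕ} (hb : b < n)
      (h : ∃ (ρ' : Perm ℕ) (u' : M.X ⟶ M.X), Rep s M n ρ' u' ∧ ((ρ = ρ' ∧ u = u') ∨
        ∃ j < n, ρ = swap n j * ρ' ∧ u = u' ≫ M.swapOp s n j)) :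
      ∃ (ρ' : Perm ℕ) (u' : M.X ⟶ M.X), Rep s M n ρ' u' ∧
        ((swap n b * ρ = ρ' ∧ u ≫ M.swapOp s n b = u') ∨
        ∃ j < n, swap n b * ρ = swap n j * ρ' ∧ u ≫ M.swapOp s n b = u' ≫ M.swapOp s n j) := by
    obtain ⟨ρ', u', h', ⟨rfl, rfl⟩ | ⟨j, hj, rfl, rfl⟩⟩ := h
    · exact ⟨_, _, h', Or.inr ⟨b, hb, rfl, rfl⟩⟩
    · rcases eq_or_ne b j with rfl | hbj
      · refine ⟨_, _, h', Or.inl ⟨?_, ?_⟩⟩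
        · rw [← mul_assoc, Equiv.swap_mul_self, one_mul]
        · rw [Category.assoc, swapOp_swapOp hs (by omega) (by omega) (by omega), Category.comp_id]
      · refine ⟨_, _, h'.step hj hb hbj.symm, Or.inr ⟨j, hj, ?_, ?_⟩⟩
        · rw [← mul_assoc, ← mul_assoc, Equiv.mul_swap_eq_swap_mul (swap n j) j b,
            Equiv.swap_apply_right, Equiv.swap_apply_of_ne_of_ne (by omega) hbj]
        · rw [Category.assoc, Category.assoc, swapOp_comp hs (i := n) (j := j) (a := j) (b := b)
            (by omega) (by omega) (by omega) (by omega) (by omega), Equiv.swap_apply_right,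
            Equiv.swap_apply_of_ne_of_ne (by omega) hbj]
  induction h with
  | one => exact ⟨1, 𝟙 _, .one, Or.inl ⟨rfl, rfl⟩⟩
  | @step ρ u a b h ha hb hab ih =>
    rcases eq_or_ne a n with rfl | han
    · exact key (by omega) ih
    rcases eq_or_ne b n with rfl | hbn
    · rw [Equiv.swap_comm, ← swapOp_symm hs (by omega) (by omega) hab]
      exact key (by omega) ih
    obtain ⟨ρ', u', h', ⟨rfl, rfl⟩ | ⟨j, hj, rfl, rfl⟩⟩ := ih
    · exact ⟨_, _, h'.step (by omega) (by omega) hab, Or.inl ⟨rfl, rfl⟩⟩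
    -- Here `a` and `b` are both below `n`, so moving `(a b)` past `(n j)` only replaces `j` by its
    -- image under `(a b)`.
    · have e : swap a b n = n := Equiv.swap_apply_of_ne_of_ne (by omega) (by omega)
      refine ⟨_, _, h'.step (show a < n by omega) (show b < n by omega) hab, Or.inr
        ⟨swap a b j, ?_, ?_, ?_⟩⟩
      · exact perm_lt_of_fix (fun k hk => Equiv.swap_apply_of_ne_of_ne (by omega) (by omega)) hj
      · rw [← mul_assoc, ← mul_assoc, Equiv.mul_swap_eq_swap_mul, e]
      · rw [Category.assoc, Category.assoc, swapOp_comp hs (by omega) (by omega) hab (by omega)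
          (by omega), e]

/-- The operator depends only on the permutation. By induction: in the normal form the image of `n`
determines the coset representative, and what remains is a permutation of `n` slots. So the
operators of `s` define an action of the symmetric group without recourse to a presentation. -/
theorem unique (hs : IsSwap B s) (hn : n ≤ M.deg) (h : Rep s M n ρ u) (h' : Rep s M n ρ u') :
    u = u' := by
  induction n generalizing ρ u u' with
  | zero =>
    have key {ρ : Perm ℕ} {u : M.X ⟶ M.X} (h : Rep s M 0 ρ u) : u = 𝟙 _ := by
      cases h with
      | one => rfl
      | step h hi hj hij => omega
    rw [key h, key h']
  | succ n ih =>
    have aux {ρ' : Perm ℕ} {v : M.X ⟶ M.X} (h : Rep s M n ρ' v) (j : ℕ) :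
        (swap n j * ρ') n = j := by
      rw [Equiv.Perm.mul_apply, h.fix n le_rfl, Equiv.swap_apply_left]
    obtain ⟨ρ₁, u₁, h₁, ⟨rfl, rfl⟩ | ⟨j, hj, rfl, rfl⟩⟩ := h.decompose hs hn <;>
    obtain ⟨ρ₂, u₂, h₂, ⟨e, rfl⟩ | ⟨j', hj', e, rfl⟩⟩ := h'.decompose hs hn
    · subst e
      exact ih (by omega) h₁ h₂
    · have := congrArg (· n) e
      simp only [aux h₂, h₁.fix n le_rfl] at this
      omega
    · have := congrArg (· n) e
      simp only [aux h₁, h₂.fix n le_rfl] at this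
      omega
    · have := congrArg (· n) e
      simp only [aux h₁, aux h₂] at this
      subst this
      obtain rfl := mul_left_cancel e
      rw [ih (by omega) h₁ h₂]

end Rep

variable (s M) in
theorem exists_rep (hρ : ∀ k, n ≤ k → ρ k = k) : ∃ u, Rep s M n ρ u := by
  induction n generalizing ρ with
  | zero =>
    obtain rfl : ρ = 1 := Equiv.ext fun k => hρ k (by omega)
    exact ⟨_, .one⟩
  | succ n ih =>
    have hlt : ρ n < n + 1 := perm_lt_of_fix hρ (by omega)
    rcases eq_or_ne (ρ n) n with e | hne
    · obtain ⟨u, hu⟩ := ih (ρ := ρ) fun k hk => by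
        rcases eq_or_lt_of_le hk with rfl | hk
        · exact e
        · exact hρ k hk
      exact ⟨u, hu.mono (by omega)⟩
    -- Composing with the transposition of `n` and `ρ n` makes `n` a fixed point; the same
    -- transposition is put back at the end as one more operator.
    · obtain ⟨u, hu⟩ := ih (ρ := swap n (ρ n) * ρ) fun k hk => by
        rw [Equiv.Perm.mul_apply]
        rcases eq_or_lt_of_le hk with rfl | hk
        · exact Equiv.swap_apply_right _ _
        · rw [hρ k hk]
          exact Equiv.swap_apply_of_ne_of_ne (by omega) (by omega)
      have := (hu.mono (show n ≤ n + 1 by omega)).step (show n < n + 1 by omega) hlt hne.symm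
      rw [← mul_assoc, Equiv.swap_mul_self, one_mul] at this
      exact ⟨_, this⟩

open Classical in
variable (s M) in
/-- The operator lifting the permutation `ρ` of the slots. -/
noncomputable def sym (ρ : Perm ℕ) : M.X ⟶ M.X :=
  -- The default value is irrelevant: an operator exists whenever the permutation fixes every index
  -- from `M.deg` on.
  if h : ∃ u, Rep s M M.deg ρ u then h.choose else 𝟙 _

theorem rep_sym (hρ : ∀ k, M.deg ≤ k → ρ k = k) : Rep s M M.deg ρ (M.sym s ρ) := by
  have h := exists_rep s M hρ
  rw [sym, dif_pos h]
  exact h.choose_spec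

theorem Rep.sym_eq (hs : IsSwap B s) (h : Rep s M M.deg ρ u) : M.sym s ρ = u :=
  (rep_sym h.fix).unique hs le_rfl h

theorem sym_one (hs : IsSwap B s) : M.sym s 1 = 𝟙 _ := Rep.one.sym_eq hs

theorem sym_mul (hs : IsSwap B s) (hρ : ∀ k, M.deg ≤ k → ρ k = k)
    (hκ : ∀ k, M.deg ≤ k → κ k = k) : M.sym s (κ * ρ) = M.sym s ρ ≫ M.sym s κ :=
  ((rep_sym hρ).mul (rep_sym hκ)).sym_eq hs

theorem act_sym (hs : IsSwap B s) (hρ : ∀ k, M.deg ≤ k → ρ k = k) {k : ℕ} (hk : k < M.deg) :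
    M.act k ≫ M.sym s ρ = M.sym s ρ ▷ B ≫ M.act (ρ k) :=
  (rep_sym hρ).act_comp hs le_rfl hk

/-- A morphism of the underlying objects which permutes the slots by `κ`. -/
structure SemiEquiv (κ : Perm ℕ) (M N : PowMod B) (f : M.X ⟶ N.X) : Prop where
  deg_eq : M.deg = N.deg
  fix : ∀ k, M.deg ≤ k → κ k = k
  act_comp : ∀ k < M.deg, M.act k ≫ f = f ▷ B ≫ N.act (κ k)

namespace SemiEquiv

variable {P : PowMod B} {f : M.X ⟶ N.X} {g : N.X ⟶ P.X}

theorem lt (hf : SemiEquiv κ M N f) {k : ℕ} (hk : k < M.deg) : κ k < M.deg :=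
  perm_lt_of_fix hf.fix hk

theorem comp (hf : SemiEquiv κ M N f) (hg : SemiEquiv ρ N P g) : SemiEquiv (ρ * κ) M P (f ≫ g) where
  deg_eq := hf.deg_eq.trans hg.deg_eq
  fix k hk := by
    rw [Equiv.Perm.mul_apply, hf.fix k hk, hg.fix k (by rw [← hf.deg_eq]; exact hk)]
  act_comp k hk := by
    rw [reassoc_of% hf.act_comp k hk, hg.act_comp _ (by rw [← hf.deg_eq]; exact hf.lt hk)]
    simp

theorem sym (hs : IsSwap B s) (hρ : ∀ k, M.deg ≤ k → ρ k = k) : SemiEquiv ρ M M (M.sym s ρ) :=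
  ⟨rfl, hρ, fun _ hk => act_sym hs hρ hk⟩

/-- A morphism permuting the slots by `κ` carries the operator of `(i j)` to that of `(κ i, κ j)`;
induct on a word for `ρ`. -/
theorem sym_naturality (hs : IsSwap B s) (hf : SemiEquiv κ M N f) (hρ : ∀ k, M.deg ≤ k → ρ k = k) :
    M.sym s ρ ≫ f = f ≫ N.sym s (κ * ρ * κ⁻¹) := by
  obtain ⟨u, hu⟩ : ∃ u, u = M.sym s ρ := ⟨_, rfl⟩
  have h := rep_sym (s := s) hρ
  rw [← hu] at h ⊢
  clear hu hρ
  suffices H : ∃ v, Rep s N N.deg (κ * ρ * κ⁻¹) v ∧ u ≫ f = f ≫ v by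
    obtain ⟨v, hv, e⟩ := H
    rw [e, hv.sym_eq hs]
  induction h with
  | one => exact ⟨𝟙 _, by simpa using Rep.one, by simp⟩
  | @step ρ u i j h hi hj hij ih =>
    obtain ⟨v, hv, e⟩ := ih
    refine ⟨v ≫ N.swapOp s (κ i) (κ j), ?_, ?_⟩
    · have := hv.step (hf.deg_eq ▸ hf.lt hi) (hf.deg_eq ▸ hf.lt hj) (κ.injective.ne hij)
      rwa [← mul_assoc, ← mul_assoc, ← Equiv.mul_swap_eq_swap_mul, mul_assoc κ] at this
    · rw [Category.assoc, swapOp_naturality f (hf.act_comp i hi) (hf.act_comp j hj),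
        reassoc_of% e]

/-- Two permuting morphisms, composed with the correcting operators. -/
theorem straighten_comp (hs : IsSwap B s) (hf : SemiEquiv κ M N f) (hg : SemiEquiv ρ N P g) :
    (f ≫ N.sym s κ⁻¹) ≫ g ≫ P.sym s ρ⁻¹ = (f ≫ g) ≫ P.sym s (ρ * κ)⁻¹ := by
  have hinv {κ : Perm ℕ} {n : ℕ} (h : ∀ k, n ≤ k → κ k = k) : ∀ k, n ≤ k → κ⁻¹ k = k :=
    fun k hk => by rw [Equiv.Perm.inv_eq_iff_eq, h k hk]
  have h1 := hinv hf.fix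
  rw [hf.deg_eq] at h1
  have h2 := hg.fix
  have h3 := hinv h2
  rw [hg.deg_eq] at h2 h3
  -- Moving the first correction past `g` conjugates `κ⁻¹` by `ρ`; the conjugate is then cancelled
  -- against `ρ⁻¹`.
  have e : (ρ * κ)⁻¹ = ρ⁻¹ * (ρ * κ⁻¹ * ρ⁻¹) := by group
  rw [e, sym_mul hs _ h3, Category.assoc, ← Category.assoc (N.sym s _),
    sym_naturality hs hg h1]
  · simp
  · intro k hk
    rw [Equiv.Perm.mul_apply, Equiv.Perm.mul_apply, h3 k hk, h1 k (by rwa [hg.deg_eq]), h2 k hk]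

end SemiEquiv

end PowMod
end Rep
end TensorCat


namespace TensorCat

/-! ### The monoidal category of objects with commuting actions -/

section PowModCategory

variable {C : Type u} [Category.{v} C] [Preadditive C] [MonoidalCategory C] [SymmetricCategory C]
  [MonoidalPreadditive C]
variable {B : C} [MonObj B]

namespace PowMod

/-- Morphisms: equivariant morphisms of objects, zero unless the degrees agree. -/
@[ext]
structure Hom (M N : PowMod B) where
  hom : M.X ⟶ N.X
  eq_zero : M.deg ≠ N.deg → hom = 0
  act_comp : ∀ k < M.deg, M.act k ≫ hom = hom ▷ B ≫ N.act k

instance : Category (PowMod B) where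
  Hom := Hom
  id M := ⟨𝟙 _, fun h => (h rfl).elim, by simp⟩
  comp {M N P} f g := ⟨f.hom ≫ g.hom, fun h => by
      by_cases h1 : M.deg = N.deg
      · rw [g.eq_zero (h1 ▸ h), Limits.comp_zero]
      · rw [f.eq_zero h1, Limits.zero_comp], fun k hk => by
      by_cases h1 : M.deg = N.deg
      · rw [reassoc_of% f.act_comp k hk, g.act_comp k (h1 ▸ hk), comp_whiskerRight_assoc]
      · simp [f.eq_zero h1]⟩

variable {M N P Q : PowMod B}

@[simp] theorem id_hom : (𝟙 M : Hom M M).hom = 𝟙 M.X := rfl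
@[simp] theorem comp_hom (f : M ⟶ N) (g : N ⟶ P) : (f ≫ g : Hom M P).hom = Hom.hom f ≫ Hom.hom g :=
  rfl

@[ext] theorem hom_ext {f g : M ⟶ N} (h : Hom.hom f = Hom.hom g) : f = g := Hom.ext h

/-- An isomorphism from an equivariant isomorphism of underlying objects. -/
@[simps]
def mkIso (e : M.X ≅ N.X) (hd : M.deg = N.deg)
    (h : ∀ k < M.deg, M.act k ≫ e.hom = e.hom ▷ B ≫ N.act k) : M ≅ N where
  hom := ⟨e.hom, fun h' => (h' hd).elim, h⟩
  inv := ⟨e.inv, fun h' => (h' hd.symm).elim, fun k hk => by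
    rw [Iso.comp_inv_eq, Category.assoc, h k (hd ▸ hk)]; simp⟩
  hom_inv_id := by ext; simp
  inv_hom_id := by ext; simp

/-- The action on the left factor of a tensor product. -/
def leftAct {X : C} (a : X ⊗ B ⟶ X) (Y : C) : (X ⊗ Y) ⊗ B ⟶ X ⊗ Y :=
  (α_ X Y B).hom ≫ X ◁ (β_ Y B).hom ≫ (α_ X B Y).inv ≫ a ▷ Y

/-- The action on the right factor of a tensor product. -/
def rightAct (X : C) {Y : C} (a : Y ⊗ B ⟶ Y) : (X ⊗ Y) ⊗ B ⟶ X ⊗ Y :=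
  (α_ X Y B).hom ≫ X ◁ a

section Act

variable {X Y Z : C} {a a' : X ⊗ B ⟶ X} {b b' : Y ⊗ B ⟶ Y}

theorem leftAct_one (ha : X ◁ η[B] ≫ a = (ρ_ X).hom) :
    (X ⊗ Y) ◁ η[B] ≫ leftAct a Y = (ρ_ (X ⊗ Y)).hom := by
  calc (X ⊗ Y) ◁ η[B] ≫ leftAct a Y
      = 𝟙 _ ⊗≫ X ◁ (Y ◁ η[B] ≫ (β_ Y B).hom) ⊗≫ a ▷ Y := by rw [leftAct]; monoidal
    _ = 𝟙 _ ⊗≫ X ◁ (ρ_ Y).hom ⊗≫ (X ◁ η[B] ≫ a) ▷ Y ⊗≫ 𝟙 _ := by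
      rw [BraidedCategory.braiding_naturality_right, braiding_tensorUnit_right]; monoidal
    _ = (ρ_ (X ⊗ Y)).hom := by rw [ha]; monoidal

theorem rightAct_one (hb : Y ◁ η[B] ≫ b = (ρ_ Y).hom) :
    (X ⊗ Y) ◁ η[B] ≫ rightAct X b = (ρ_ (X ⊗ Y)).hom := by
  calc _ = 𝟙 _ ⊗≫ X ◁ (Y ◁ η[B] ≫ b) := by rw [rightAct]; monoidal
    _ = _ := by rw [hb]; monoidal

theorem leftAct_mul (ha : X ◁ μ[B] ≫ a = (α_ X B B).inv ≫ a ▷ B ≫ a) :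
    (X ⊗ Y) ◁ μ[B] ≫ leftAct a Y = (α_ _ B B).inv ≫ leftAct a Y ▷ B ≫ leftAct a Y := by
  calc _ = 𝟙 _ ⊗≫ X ◁ (Y ◁ μ[B] ≫ (β_ Y B).hom) ⊗≫ a ▷ Y := by rw [leftAct]; monoidal
    _ = 𝟙 _ ⊗≫ X ◁ (β_ Y (B ⊗ B)).hom ⊗≫ (X ◁ μ[B] ≫ a) ▷ Y ⊗≫ 𝟙 _ := by
      rw [BraidedCategory.braiding_naturality_right]; monoidal
    _ = 𝟙 _ ⊗≫ X ◁ (β_ Y B).hom ▷ B ⊗≫ ((X ⊗ B) ◁ (β_ Y B).hom ≫ a ▷ (B ⊗ Y)) ⊗≫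
        a ▷ Y ⊗≫ 𝟙 _ := by
      rw [ha, BraidedCategory.braiding_tensor_right_hom]; monoidal
    _ = _ := by rw [whisker_exchange, leftAct]; monoidal

theorem rightAct_mul (hb : Y ◁ μ[B] ≫ b = (α_ Y B B).inv ≫ b ▷ B ≫ b) :
    (X ⊗ Y) ◁ μ[B] ≫ rightAct X b = (α_ _ B B).inv ≫ rightAct X b ▷ B ≫ rightAct X b := by
  calc _ = 𝟙 _ ⊗≫ X ◁ (Y ◁ μ[B] ≫ b) := by rw [rightAct]; monoidal
    _ = _ := by rw [hb, rightAct]; monoidal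

/-- Two right actions commute. -/
def ActComm (a a' : X ⊗ B ⟶ X) : Prop :=
  a ▷ B ≫ a' = (α_ X B B).hom ≫ X ◁ (β_ B B).hom ≫ (α_ X B B).inv ≫ a' ▷ B ≫ a

theorem ActComm.symm (h : ActComm a a') : ActComm a' a := by
  rw [ActComm, h]; simp

theorem ActComm.leftAct (h : ActComm a a') : ActComm (leftAct a Y) (leftAct a' Y) := by
  have e (a a' : X ⊗ B ⟶ X) : PowMod.leftAct a Y ▷ B ≫ PowMod.leftAct a' Y =
      𝟙 _ ⊗≫ X ◁ (β_ Y (B ⊗ B)).hom ⊗≫ (a ▷ B ≫ a') ▷ Y := by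
    calc _ = 𝟙 _ ⊗≫ X ◁ (β_ Y B).hom ▷ B ⊗≫ (a ▷ (Y ⊗ B) ≫ X ◁ (β_ Y B).hom) ⊗≫ a' ▷ Y := by
          rw [PowMod.leftAct, PowMod.leftAct]; monoidal
      _ = _ := by
        rw [← whisker_exchange, BraidedCategory.braiding_tensor_right_hom]; monoidal
  rw [ActComm, e, e, h]
  calc _ = 𝟙 _ ⊗≫ X ◁ ((β_ Y (B ⊗ B)).hom ≫ (β_ B B).hom ▷ Y) ⊗≫ (a' ▷ B ≫ a) ▷ Y := by
        monoidal
    _ = _ := by rw [← BraidedCategory.braiding_naturality_right]; monoidal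

theorem ActComm.rightAct (h : ActComm b b') : ActComm (rightAct X b) (rightAct X b') := by
  calc _ = 𝟙 _ ⊗≫ X ◁ (b ▷ B ≫ b') := by rw [PowMod.rightAct, PowMod.rightAct]; monoidal
    _ = _ := by rw [h, PowMod.rightAct, PowMod.rightAct]; monoidal

theorem actComm_leftAct_rightAct (a : X ⊗ B ⟶ X) (b : Y ⊗ B ⟶ Y) :
    ActComm (leftAct a Y) (rightAct X b) := by
  calc _ = 𝟙 _ ⊗≫ X ◁ (β_ Y B).hom ▷ B ⊗≫ (a ▷ (Y ⊗ B) ≫ X ◁ b) := by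
        rw [PowMod.rightAct, PowMod.leftAct]; monoidal
    _ = 𝟙 _ ⊗≫ X ◁ ((β_ Y B).hom ▷ B ⊗≫ B ◁ b) ⊗≫ a ▷ Y := by
        rw [← whisker_exchange]; monoidal
    _ = 𝟙 _ ⊗≫ X ◁ (Y ◁ (β_ B B).hom ⊗≫ (b ▷ B ≫ (β_ Y B).hom)) ⊗≫ a ▷ Y := by
        rw [BraidedCategory.braiding_naturality_left, BraidedCategory.braiding_tensor_left_hom]
        calc _ = 𝟙 _ ⊗≫ X ◁ ((β_ Y B).hom ▷ B ⊗≫ B ◁ b) ⊗≫ a ▷ Y := by monoidal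
          _ = 𝟙 _ ⊗≫ X ◁ (Y ◁ ((β_ B B).hom ≫ (β_ B B).hom) ⊗≫ (β_ Y B).hom ▷ B ⊗≫ B ◁ b) ⊗≫
              a ▷ Y := by rw [SymmetricCategory.symmetry]; monoidal
          _ = _ := by monoidal
    _ = _ := by rw [PowMod.rightAct, PowMod.leftAct]; monoidal

theorem leftAct_comp {a : X ⊗ B ⟶ X} {b : Y ⊗ B ⟶ Y} {f : X ⟶ Y} (h : a ≫ f = f ▷ B ≫ b) :
    leftAct a Z ≫ f ▷ Z = (f ▷ Z) ▷ B ≫ leftAct b Z := by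
  calc _ = 𝟙 _ ⊗≫ X ◁ (β_ Z B).hom ⊗≫ (a ≫ f) ▷ Z := by rw [leftAct]; monoidal
    _ = 𝟙 _ ⊗≫ (X ◁ (β_ Z B).hom ≫ f ▷ _) ⊗≫ b ▷ Z := by rw [h]; monoidal
    _ = _ := by rw [whisker_exchange, leftAct]; monoidal

theorem leftAct_whiskerLeft (a : X ⊗ B ⟶ X) (f : Y ⟶ Z) :
    leftAct a Y ≫ X ◁ f = (X ◁ f) ▷ B ≫ leftAct a Z := by
  calc _ = 𝟙 _ ⊗≫ X ◁ (β_ Y B).hom ⊗≫ (a ▷ Y ≫ X ◁ f) := by rw [leftAct]; monoidal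
    _ = 𝟙 _ ⊗≫ X ◁ ((β_ Y B).hom ≫ B ◁ f) ⊗≫ a ▷ Z := by rw [← whisker_exchange]; monoidal
    _ = _ := by rw [← BraidedCategory.braiding_naturality_left, leftAct]; monoidal

theorem rightAct_comp {a : X ⊗ B ⟶ X} {b : Y ⊗ B ⟶ Y} {f : X ⟶ Y} (h : a ≫ f = f ▷ B ≫ b) :
    rightAct Z a ≫ Z ◁ f = (Z ◁ f) ▷ B ≫ rightAct Z b := by
  calc _ = 𝟙 _ ⊗≫ Z ◁ (a ≫ f) := by rw [rightAct]; monoidal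
    _ = _ := by rw [h, rightAct]; monoidal

theorem rightAct_whiskerRight (a : X ⊗ B ⟶ X) (f : Y ⟶ Z) :
    rightAct Y a ≫ f ▷ X = (f ▷ X) ▷ B ≫ rightAct Z a := by
  calc _ = 𝟙 _ ⊗≫ (Y ◁ a ≫ f ▷ X) := by rw [rightAct]; monoidal
    _ = _ := by rw [whisker_exchange, rightAct]; monoidal

theorem leftAct_associator (a : X ⊗ B ⟶ X) :
    leftAct (leftAct a Y) Z ≫ (α_ X Y Z).hom = (α_ X Y Z).hom ▷ B ≫ leftAct a (Y ⊗ Z) := by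
  rw [leftAct, leftAct, leftAct, BraidedCategory.braiding_tensor_left_hom]
  monoidal

theorem leftAct_rightAct_associator (a : Y ⊗ B ⟶ Y) :
    leftAct (rightAct X a) Z ≫ (α_ X Y Z).hom = (α_ X Y Z).hom ▷ B ≫ rightAct X (leftAct a Z) := by
  rw [leftAct, rightAct, leftAct, rightAct]
  monoidal

theorem rightAct_associator (a : Z ⊗ B ⟶ Z) :
    rightAct (X ⊗ Y) a ≫ (α_ X Y Z).hom = (α_ X Y Z).hom ▷ B ≫ rightAct X (rightAct Y a) := by
  rw [rightAct, rightAct, rightAct]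
  monoidal

theorem leftAct_braiding (a : X ⊗ B ⟶ X) :
    leftAct a Y ≫ (β_ X Y).hom = (β_ X Y).hom ▷ B ≫ rightAct Y a := by
  rw [leftAct, rightAct, Category.assoc, Category.assoc, Category.assoc,
    BraidedCategory.braiding_naturality_left, BraidedCategory.braiding_tensor_left_hom]
  calc _ = 𝟙 _ ⊗≫ X ◁ ((β_ Y B).hom ≫ (β_ B Y).hom) ⊗≫ (β_ X Y).hom ▷ B ⊗≫ Y ◁ a := by monoidal
    _ = _ := by rw [SymmetricCategory.symmetry]; monoidal

theorem rightAct_braiding (b : Y ⊗ B ⟶ Y) :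
    rightAct X b ≫ (β_ X Y).hom = (β_ X Y).hom ▷ B ≫ leftAct b X := by
  rw [leftAct, rightAct, Category.assoc, BraidedCategory.braiding_naturality_right,
    BraidedCategory.braiding_tensor_right_hom]
  monoidal

theorem leftAct_rightUnitor (a : X ⊗ B ⟶ X) :
    leftAct a (𝟙_ C) ≫ (ρ_ X).hom = (ρ_ X).hom ▷ B ≫ a := by
  rw [leftAct, braiding_tensorUnit_left]
  monoidal

theorem rightAct_leftUnitor (a : X ⊗ B ⟶ X) :
    rightAct (𝟙_ C) a ≫ (λ_ X).hom = (λ_ X).hom ▷ B ≫ a := by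
  rw [rightAct]
  monoidal

end Act

/-- The tensor product, with slots concatenated. -/
@[simps, reducible]
def tensor (M N : PowMod B) : PowMod B where
  deg := M.deg + N.deg
  X := M.X ⊗ N.X
  act k := if k < M.deg then leftAct (M.act k) N.X else rightAct M.X (N.act (k - M.deg))
  act_one k hk := by
    split_ifs with h
    · exact leftAct_one (M.act_one k h)
    · exact rightAct_one (N.act_one _ (by omega))
  act_mul k hk := by
    split_ifs with h
    · exact leftAct_mul (M.act_mul k h)
    · exact rightAct_mul (N.act_mul _ (by omega))
  act_comm i hi j hj hij := by
    change ActComm _ _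
    split_ifs with h h' h'
    · exact ActComm.leftAct (M.act_comm i h j h' hij)
    · exact actComm_leftAct_rightAct _ _
    · exact (actComm_leftAct_rightAct _ _).symm
    · exact ActComm.rightAct (N.act_comm _ (by omega) _ (by omega) (by omega))

variable (B) in
/-- The object of degree zero on an object of the base category. -/
@[simps, reducible]
def ofObj (X : C) : PowMod B where
  deg := 0
  X := X
  act _ := 0
  act_one _ h := by omega
  act_mul _ h := by omega
  act_comm _ h := by omega

/-- Concatenation of slots is associative and unital on the nose for the numbering of the slots, so
the associators and unitors of `C` are equivariant as they stand. Only the symmetry will need a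
correction. -/
instance : MonoidalCategoryStruct (PowMod B) where
  tensorObj := tensor
  tensorUnit := ofObj B (𝟙_ C)
  whiskerLeft M {N P} f := ⟨M.X ◁ f.hom, fun h => by
      rw [f.eq_zero (fun h' => h (congrArg (M.deg + ·) h')), MonoidalPreadditive.whiskerLeft_zero],
    fun k hk => by
      dsimp only [tensor] at hk ⊢
      split_ifs with h
      · exact leftAct_whiskerLeft _ _
      · exact rightAct_comp (f.act_comp _ (by omega))⟩
  whiskerRight {N P} f M := ⟨f.hom ▷ M.X, fun h => by
      rw [f.eq_zero (fun h' => h (congrArg (· + M.deg) h')), MonoidalPreadditive.zero_whiskerRight],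
    fun k hk => by
      dsimp only [tensor] at hk ⊢
      -- When the degrees differ, the slots of `M` sit at different positions in source and target,
      -- and equivariance holds only because the morphism is zero.
      by_cases hd : N.deg = P.deg
      · rw [← hd]
        split_ifs with h
        · exact leftAct_comp (f.act_comp _ h)
        · exact rightAct_whiskerRight _ _
      · rw [f.eq_zero hd]
        simp⟩
  associator M N P := mkIso (α_ M.X N.X P.X) (Nat.add_assoc _ _ _) fun k hk => by
    dsimp only [tensor] at hk ⊢
    split_ifs <;> first | omega | skip
    · exact leftAct_associator _
    · exact leftAct_rightAct_associator _
    · rw [rightAct_associator, Nat.sub_sub]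
  leftUnitor M := mkIso (λ_ M.X) (Nat.zero_add _) fun k hk => by
    dsimp only [tensor, ofObj]
    rw [if_neg (Nat.not_lt_zero _), Nat.sub_zero]
    exact rightAct_leftUnitor _
  rightUnitor M := mkIso (ρ_ M.X) (Nat.add_zero _) fun k hk => by
    dsimp only [tensor, ofObj, Nat.add_zero] at hk ⊢
    rw [if_pos hk]
    exact leftAct_rightUnitor _

@[simp] theorem tensorObj_deg : (M ⊗ N).deg = M.deg + N.deg := rfl
@[simp] theorem tensorObj_X : (M ⊗ N).X = M.X ⊗ N.X := rfl
theorem tensorObj_act (k : ℕ) : (M ⊗ N).act k =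
  if k < M.deg then leftAct (M.act k) N.X else rightAct M.X (N.act (k - M.deg)) := rfl
@[simp] theorem tensorUnit_deg : (𝟙_ (PowMod B)).deg = 0 := rfl
@[simp] theorem tensorUnit_X : (𝟙_ (PowMod B)).X = 𝟙_ C := rfl
@[simp] theorem whiskerLeft_hom (f : N ⟶ P) : (M ◁ f : Hom _ _).hom = M.X ◁ f.hom := rfl
@[simp] theorem whiskerRight_hom (f : N ⟶ P) : (f ▷ M : Hom _ _).hom = f.hom ▷ M.X := rfl
@[simp] theorem tensorHom_hom (f : M ⟶ N) (g : P ⟶ Q) :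
    (f ⊗ₘ g : Hom _ _).hom = f.hom ⊗ₘ g.hom := (MonoidalCategory.tensorHom_def _ _).symm
@[simp] theorem associator_hom_hom : Hom.hom (α_ M N P).hom = (α_ M.X N.X P.X).hom := rfl
@[simp] theorem associator_inv_hom : Hom.hom (α_ M N P).inv = (α_ M.X N.X P.X).inv := rfl
@[simp] theorem leftUnitor_hom_hom : Hom.hom (λ_ M).hom = (λ_ M.X).hom := rfl
@[simp] theorem leftUnitor_inv_hom : Hom.hom (λ_ M).inv = (λ_ M.X).inv := rfl
@[simp] theorem rightUnitor_hom_hom : Hom.hom (ρ_ M).hom = (ρ_ M.X).hom := rfl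
@[simp] theorem rightUnitor_inv_hom : Hom.hom (ρ_ M).inv = (ρ_ M.X).inv := rfl

instance : MonoidalCategory (PowMod B) where
  tensorHom_def _ _ := rfl
  id_tensorHom_id _ _ := by ext; simp
  tensorHom_comp_tensorHom _ _ _ _ := by ext; simp
  whiskerLeft_id _ _ := by ext; simp
  id_whiskerRight _ _ := by ext; simp
  associator_naturality _ _ _ := by ext; simp
  leftUnitor_naturality _ := by ext; simp
  rightUnitor_naturality _ := by ext; simp
  pentagon _ _ _ _ := by ext; simp
  triangle _ _ := by ext; simp

end PowMod
end PowModCategory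
end TensorCat


namespace TensorCat

/-! ### The corrected symmetry -/

section PowModBraiding

variable {C : Type u} [Category.{v} C] [Preadditive C] [MonoidalCategory C] [SymmetricCategory C]
  [MonoidalPreadditive C]
variable {B : C} [MonObj B] {s : 𝟙_ C ⟶ B ⊗ B}

namespace PowMod

open Equiv (swap Perm)

variable {M N P Q : PowMod B} {κ ρ : Perm ℕ}

theorem inv_fix {n : ℕ} (h : ∀ k, n ≤ k → κ k = k) : ∀ k, n ≤ k → κ⁻¹ k = k :=
  fun k hk => by rw [Equiv.Perm.inv_eq_iff_eq, h k hk]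

/-- Correct a slot permuting morphism to an equivariant one. -/
@[simps]
noncomputable def straighten (hs : IsSwap B s) {f : M.X ⟶ N.X} (hf : SemiEquiv κ M N f) : M ⟶ N where
  hom := f ≫ N.sym s κ⁻¹
  eq_zero h := (h hf.deg_eq).elim
  act_comp k hk := by
    have h := hf.comp (SemiEquiv.sym hs (inv_fix (hf.deg_eq ▸ hf.fix)))
    have h2 := h.act_comp k hk
    rwa [inv_mul_cancel] at h2

/-- Together with the compatibility of `straighten` with composition and whiskering, this splits
every coherence identity for the corrected symmetry into the same identity in `C` and an identity
between permutations of the slots. -/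
theorem straighten_congr (hs : IsSwap B s) {f f' : M.X ⟶ N.X} (hf : SemiEquiv κ M N f)
    (hf' : SemiEquiv ρ M N f') (h : κ = ρ) (h' : f = f') : straighten hs hf = straighten hs hf' := by
  subst h h'; rfl

theorem straighten_comp_straighten (hs : IsSwap B s) {f : M.X ⟶ N.X} {g : N.X ⟶ P.X}
    (hf : SemiEquiv κ M N f) (hg : SemiEquiv ρ N P g) :
    straighten hs hf ≫ straighten hs hg = straighten hs (hf.comp hg) := by
  ext
  exact SemiEquiv.straighten_comp hs hf hg

theorem semiEquiv_hom (f : M ⟶ N) (h : M.deg = N.deg) : SemiEquiv 1 M N (Hom.hom f) :=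
  ⟨h, fun _ _ => rfl, Hom.act_comp f⟩

theorem straighten_of_hom (hs : IsSwap B s) (f : M ⟶ N) (h : M.deg = N.deg) :
    straighten hs (semiEquiv_hom f h) = f := by
  ext
  simp [sym_one hs]

theorem SemiEquiv.whiskerRight {f : M.X ⟶ N.X} (hf : SemiEquiv κ M N f) (P : PowMod B) :
    SemiEquiv κ (M ⊗ P) (N ⊗ P) (f ▷ P.X) where
  deg_eq := congrArg (· + P.deg) hf.deg_eq
  fix k hk := hf.fix k (by rw [tensorObj_deg] at hk; omega)
  act_comp k hk := by
    rw [tensorObj_act, tensorObj_act, ← hf.deg_eq]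
    by_cases h : k < M.deg
    · rw [if_pos h, if_pos (hf.lt h)]
      exact leftAct_comp (hf.act_comp k h)
    · rw [hf.fix k (by omega), if_neg h, if_neg h]
      exact rightAct_whiskerRight _ _

/-- A permutation acting on the slots from `p` on. -/
def shiftPerm (p : ℕ) (κ : Perm ℕ) : Perm ℕ where
  toFun k := if k < p then k else p + κ (k - p)
  invFun k := if k < p then k else p + κ⁻¹ (k - p)
  left_inv k := by
    by_cases h : k < p
    · simp [h]
    · simp [h]; omega
  right_inv k := by
    by_cases h : k < p
    · simp [h]
    · simp [h]; omega

theorem shiftPerm_apply (p : ℕ) (κ : Perm ℕ) (k : ℕ) :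
    shiftPerm p κ k = if k < p then k else p + κ (k - p) := rfl

theorem shiftPerm_inv (p : ℕ) (κ : Perm ℕ) : (shiftPerm p κ)⁻¹ = shiftPerm p κ⁻¹ := rfl

theorem shiftPerm_one (p : ℕ) : shiftPerm p 1 = 1 := by
  ext k
  rw [shiftPerm_apply, Equiv.Perm.one_apply, Equiv.Perm.one_apply]
  split_ifs <;> omega

theorem shiftPerm_swap_mul (p i j : ℕ) (κ : Perm ℕ) :
    shiftPerm p (swap i j * κ) = swap (p + i) (p + j) * shiftPerm p κ := by
  ext k
  simp only [shiftPerm_apply, Equiv.Perm.mul_apply, Equiv.swap_apply_def]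
  split_ifs <;> omega

theorem SemiEquiv.whiskerLeft {f : M.X ⟶ N.X} (hf : SemiEquiv κ M N f) (P : PowMod B) :
    SemiEquiv (shiftPerm P.deg κ) (P ⊗ M) (P ⊗ N) (P.X ◁ f) where
  deg_eq := congrArg (P.deg + ·) hf.deg_eq
  fix k hk := by
    rw [tensorObj_deg] at hk
    rw [shiftPerm_apply, hf.fix _ (by omega)]
    split_ifs <;> omega
  act_comp k hk := by
    rw [tensorObj_deg] at hk
    rw [tensorObj_act, tensorObj_act, shiftPerm_apply]
    by_cases h : k < P.deg
    · rw [if_pos h, if_pos h, if_pos h]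
      exact leftAct_whiskerLeft _ _
    · rw [if_neg h, if_neg h, if_neg (by omega), Nat.add_sub_cancel_left]
      exact rightAct_comp (hf.act_comp _ (by omega))

theorem swapOp_whiskerRight (P : PowMod B) {i j : ℕ} (hi : i < M.deg) (hj : j < M.deg) :
    M.swapOp s i j ▷ P.X = (M ⊗ P).swapOp s i j := by
  rw [swapOp, swapOp, act₂, act₂, tensorObj_act, tensorObj_act, if_pos hi, if_pos hj]
  symm
  calc _ = (ρ_ (M.X ⊗ P.X)).inv ≫ (M.X ⊗ P.X) ◁ s ⊗≫ M.X ◁ (β_ P.X B).hom ▷ B ⊗≫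
        (M.act i ▷ (P.X ⊗ B) ≫ M.X ◁ (β_ P.X B).hom) ⊗≫ M.act j ▷ P.X := by
        rw [leftAct, leftAct]; dsimp only [tensorObj_X]; monoidal
    _ = (ρ_ (M.X ⊗ P.X)).inv ≫ 𝟙 _ ⊗≫ M.X ◁ (P.X ◁ s ≫ (β_ P.X (B ⊗ B)).hom) ⊗≫
        M.act i ▷ B ▷ P.X ⊗≫ M.act j ▷ P.X := by
        rw [← whisker_exchange, BraidedCategory.braiding_tensor_right_hom]; monoidal
    _ = _ := by
        rw [BraidedCategory.braiding_naturality_right, braiding_tensorUnit_right]; monoidal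

theorem swapOp_whiskerLeft (P : PowMod B) (i j : ℕ) :
    P.X ◁ M.swapOp s i j = (P ⊗ M).swapOp s (P.deg + i) (P.deg + j) := by
  rw [swapOp, swapOp, act₂, act₂, tensorObj_act, tensorObj_act, if_neg (by omega),
    if_neg (by omega), Nat.add_sub_cancel_left, Nat.add_sub_cancel_left, rightAct, rightAct]
  dsimp only [tensorObj_X]
  monoidal

/-- On generators: acting by `s` through two slots of `M` does not involve the other tensor factor.
Permutations of the slots of `M` thus enter as a block of permutations of all slots. -/
theorem sym_whiskerRight (hs : IsSwap B s) (P : PowMod B) (hκ : ∀ k, M.deg ≤ k → κ k = k) :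
    M.sym s κ ▷ P.X = (M ⊗ P).sym s κ := by
  suffices H : ∀ {u}, Rep s M M.deg κ u → Rep s (M ⊗ P) (M ⊗ P).deg κ (u ▷ P.X) from
    ((H (rep_sym hκ)).sym_eq hs).symm
  intro u h
  clear hκ
  induction h with
  | one => simpa using Rep.one (s := s) (M := M ⊗ P)
  | step h hi hj hij ih =>
    rw [comp_whiskerRight, swapOp_whiskerRight P hi hj]
    exact ih.step (by rw [tensorObj_deg]; omega) (by rw [tensorObj_deg]; omega) hij

theorem sym_whiskerLeft (hs : IsSwap B s) (P : PowMod B) (hκ : ∀ k, M.deg ≤ k → κ k = k) :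
    P.X ◁ M.sym s κ = (P ⊗ M).sym s (shiftPerm P.deg κ) := by
  suffices H : ∀ {u}, Rep s M M.deg κ u →
      Rep s (P ⊗ M) (P ⊗ M).deg (shiftPerm P.deg κ) (P.X ◁ u) from
    ((H (rep_sym hκ)).sym_eq hs).symm
  intro u h
  clear hκ
  induction h with
  | one => simpa [shiftPerm_one] using Rep.one (s := s) (M := P ⊗ M)
  | step h hi hj hij ih =>
    rw [MonoidalCategory.whiskerLeft_comp, swapOp_whiskerLeft, shiftPerm_swap_mul]
    exact ih.step (by rw [tensorObj_deg]; omega) (by rw [tensorObj_deg]; omega) (by omega)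

theorem straighten_whiskerRight (hs : IsSwap B s) {f : M.X ⟶ N.X} (hf : SemiEquiv κ M N f)
    (P : PowMod B) : straighten hs hf ▷ P = straighten hs (hf.whiskerRight P) := by
  ext
  simp only [whiskerRight_hom, straighten_hom, comp_whiskerRight]
  rw [sym_whiskerRight hs P (inv_fix (hf.deg_eq ▸ hf.fix))]

theorem straighten_whiskerLeft (hs : IsSwap B s) {f : M.X ⟶ N.X} (hf : SemiEquiv κ M N f)
    (P : PowMod B) : P ◁ straighten hs hf = straighten hs (hf.whiskerLeft P) := by
  ext
  simp only [whiskerLeft_hom, straighten_hom, MonoidalCategory.whiskerLeft_comp]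
  rw [sym_whiskerLeft hs P (inv_fix (hf.deg_eq ▸ hf.fix)), shiftPerm_inv]

/-- The permutation exchanging blocks of slots of lengths `m` and `n`. -/
def blockPerm (m n : ℕ) : Perm ℕ where
  toFun k := if k < m then k + n else if k < m + n then k - m else k
  invFun k := if k < n then k + m else if k < m + n then k - n else k
  left_inv k := by dsimp only; split_ifs <;> omega
  right_inv k := by dsimp only; split_ifs <;> omega

theorem blockPerm_apply (m n k : ℕ) :
    blockPerm m n k = if k < m then k + n else if k < m + n then k - m else k := rfl

theorem semiEquiv_braiding (M N : PowMod B) :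
    SemiEquiv (blockPerm M.deg N.deg) (M ⊗ N) (N ⊗ M) (β_ M.X N.X).hom where
  deg_eq := Nat.add_comm _ _
  fix k hk := by
    rw [tensorObj_deg] at hk
    rw [blockPerm_apply, if_neg (by omega), if_neg (by omega)]
  act_comp k hk := by
    rw [tensorObj_deg] at hk
    rw [tensorObj_act, tensorObj_act, blockPerm_apply]
    by_cases h : k < M.deg
    · rw [if_pos h, if_pos h, if_neg (by omega), Nat.add_sub_cancel]
      exact leftAct_braiding _
    · rw [if_neg h, if_neg h, if_pos hk, if_pos (by omega)]
      exact rightAct_braiding _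

/-- The symmetry of the category of modules, corrected by `s`. -/
noncomputable def braidingHom (hs : IsSwap B s) (M N : PowMod B) : M ⊗ N ⟶ N ⊗ M :=
  straighten hs (semiEquiv_braiding M N)

theorem braidingHom_braidingHom (hs : IsSwap B s) (M N : PowMod B) :
    braidingHom hs M N ≫ braidingHom hs N M = 𝟙 _ := by
  rw [braidingHom, braidingHom, straighten_comp_straighten, ← straighten_of_hom hs (𝟙 (M ⊗ N)) rfl]
  refine straighten_congr hs _ _ ?_ (by simp)
  ext k
  simp only [Equiv.Perm.mul_apply, blockPerm_apply, Equiv.Perm.one_apply]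
  split_ifs <;> omega

-- In each axiom both sides are corrections of slot permuting morphisms. The underlying morphisms
-- agree by the axiom in `C`, and the permutations of blocks agree by arithmetic. In the naturality
-- axioms a morphism between different degrees is zero.
@[reducible]
noncomputable def braidedCategory (hs : IsSwap B s) : BraidedCategory (PowMod B) where
  braiding M N := ⟨braidingHom hs M N, braidingHom hs N M, braidingHom_braidingHom hs M N,
    braidingHom_braidingHom hs N M⟩
  braiding_naturality_right X {Y Z} f := by
    dsimp only
    by_cases h : Y.deg = Z.deg
    · rw [← straighten_of_hom hs (X ◁ f) (congrArg (X.deg + ·) h),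
        ← straighten_of_hom hs (f ▷ X) (congrArg (· + X.deg) h), braidingHom, braidingHom,
        straighten_comp_straighten, straighten_comp_straighten]
      refine straighten_congr hs _ _ (by simp [h]) ?_
      exact BraidedCategory.braiding_naturality_right _ _
    · ext
      simp [Hom.eq_zero f h]
  braiding_naturality_left {X Y} f Z := by
    dsimp only
    by_cases h : X.deg = Y.deg
    · rw [← straighten_of_hom hs (Z ◁ f) (congrArg (Z.deg + ·) h),
        ← straighten_of_hom hs (f ▷ Z) (congrArg (· + Z.deg) h), braidingHom, braidingHom,
        straighten_comp_straighten, straighten_comp_straighten]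
      refine straighten_congr hs _ _ (by simp [h]) ?_
      exact BraidedCategory.braiding_naturality_left _ _
    · ext
      simp [Hom.eq_zero f h]
  hexagon_forward X Y Z := by
    dsimp only
    rw [braidingHom, braidingHom, braidingHom, straighten_whiskerRight, straighten_whiskerLeft,
      ← straighten_of_hom hs (α_ X Y Z).hom (Nat.add_assoc _ _ _),
      ← straighten_of_hom hs (α_ Y Z X).hom (Nat.add_assoc _ _ _),
      ← straighten_of_hom hs (α_ Y X Z).hom (Nat.add_assoc _ _ _)]
    simp only [straighten_comp_straighten]
    refine straighten_congr hs _ _ ?_ (BraidedCategory.hexagon_forward _ _ _)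
    ext k
    simp only [Equiv.Perm.mul_apply, shiftPerm_apply, blockPerm_apply, Equiv.Perm.one_apply,
      tensorObj_deg]
    split_ifs <;> omega
  hexagon_reverse X Y Z := by
    dsimp only
    rw [braidingHom, braidingHom, braidingHom, straighten_whiskerRight, straighten_whiskerLeft,
      ← straighten_of_hom hs (α_ X Y Z).inv (Nat.add_assoc _ _ _).symm,
      ← straighten_of_hom hs (α_ Z X Y).inv (Nat.add_assoc _ _ _).symm,
      ← straighten_of_hom hs (α_ X Z Y).inv (Nat.add_assoc _ _ _).symm]
    simp only [straighten_comp_straighten]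
    refine straighten_congr hs _ _ ?_ (BraidedCategory.hexagon_reverse _ _ _)
    ext k
    simp only [Equiv.Perm.mul_apply, shiftPerm_apply, blockPerm_apply, Equiv.Perm.one_apply,
      tensorObj_deg]
    split_ifs <;> omega

@[reducible]
noncomputable def symmetricCategory (hs : IsSwap B s) : SymmetricCategory (PowMod B) where
  toBraidedCategory := braidedCategory hs
  symmetry M N := braidingHom_braidingHom hs M N

end PowMod
end PowModBraiding
end TensorCat


/-! ### Partial traces, and the partial traces on `PowMod B` -/

namespace TensorCat

/-- Partial traces over objects carrying data in a symmetric monoidal category. -/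
structure TraceSystem (T : Type u) [Category.{v} T] [MonoidalCategory T] [SymmetricCategory T] where
  Data : T → Type v
  one : Data (𝟙_ T)
  mul {U W : T} : Data U → Data W → Data (U ⊗ W)
  tr {U A A' : T} (d : Data U) (f : A ⊗ U ⟶ A' ⊗ U) : A ⟶ A'
  tr_pre {U A A' A'' : T} (d : Data U) (a : A'' ⟶ A) (f : A ⊗ U ⟶ A' ⊗ U) :
    tr d (a ▷ U ≫ f) = a ≫ tr d f
  tr_post {U A A' A'' : T} (d : Data U) (a : A' ⟶ A'') (f : A ⊗ U ⟶ A' ⊗ U) :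
    tr d (f ≫ a ▷ U) = tr d f ≫ a
  whiskerLeft_tr {U A A' : T} (X : T) (d : Data U) (f : A ⊗ U ⟶ A' ⊗ U) :
    X ◁ tr d f = tr d ((α_ X A U).hom ≫ X ◁ f ≫ (α_ X A' U).inv)
  tr_tr {U W A A' : T} (d : Data U) (e : Data W) (f : (A ⊗ U) ⊗ W ⟶ (A' ⊗ U) ⊗ W) :
    tr d (tr e f) = tr e (tr d (((α_ A W U).hom ≫ A ◁ (β_ W U).hom ≫ (α_ A U W).inv) ≫ f ≫
      (α_ A' U W).hom ≫ A' ◁ (β_ U W).hom ≫ (α_ A' W U).inv))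
  tr_one {A A' : T} (f : A ⊗ 𝟙_ T ⟶ A' ⊗ 𝟙_ T) : tr one f = (ρ_ A).inv ≫ f ≫ (ρ_ A').hom
  tr_mul {U W A A' : T} (d : Data U) (e : Data W) (f : A ⊗ (U ⊗ W) ⟶ A' ⊗ (U ⊗ W)) :
    tr (mul d e) f = tr d (tr e ((α_ A U W).hom ≫ f ≫ (α_ A' U W).inv))
  tr_tensor {U W A A' Z Z' : T} (d : Data U) (e : Data W) (f : A ⊗ U ⟶ A' ⊗ U)
    (g : Z ⊗ W ⟶ Z' ⊗ W) : tr (mul d e) (tensorμ A Z U W ≫ (f ⊗ₘ g) ≫ tensorμ A' U Z' W) =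
      tr d f ⊗ₘ tr e g
  yank {U : T} (d : Data U) : tr d (β_ U U).hom = 𝟙 U

section Caps

variable {C : Type u} [Category.{v} C] [MonoidalCategory C] [SymmetricCategory C]
variable {M N P Q U W : C} {c : 𝟙_ C ⟶ U} {e : U ⟶ 𝟙_ C} {c' : 𝟙_ C ⟶ W} {e' : W ⟶ 𝟙_ C}

@[simp]
theorem tensorμ_tensorμ (X₁ X₂ Y₁ Y₂ : C) :
    tensorμ X₁ X₂ Y₁ Y₂ ≫ tensorμ X₁ Y₁ X₂ Y₂ = 𝟙 _ := by
  have : tensorμ X₁ Y₁ X₂ Y₂ = tensorδ X₁ X₂ Y₁ Y₂ := by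
    rw [tensorμ, tensorδ, SymmetricCategory.braiding_swap_eq_inv_braiding X₂ Y₁]
  rw [this, tensorμ_tensorδ]

@[simp]
theorem tensorμ_tensorμ_assoc (X₁ X₂ Y₁ Y₂ : C) {Z : C} (h : (X₁ ⊗ X₂) ⊗ Y₁ ⊗ Y₂ ⟶ Z) :
    tensorμ X₁ X₂ Y₁ Y₂ ≫ tensorμ X₁ Y₁ X₂ Y₂ ≫ h = h := by
  rw [← Category.assoc, tensorμ_tensorμ, Category.id_comp]

theorem tensorμ_braiding_braiding (X₁ X₂ Y₁ Y₂ : C) :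
    tensorμ X₁ X₂ Y₁ Y₂ ≫ ((β_ X₁ Y₁).hom ⊗ₘ (β_ X₂ Y₂).hom) ≫ tensorμ Y₁ X₁ Y₂ X₂ =
      (β_ (X₁ ⊗ X₂) (Y₁ ⊗ Y₂)).hom := by
  rw [BraidedCategory.braiding_tensor_left_hom, BraidedCategory.braiding_tensor_right_hom,
    BraidedCategory.braiding_tensor_right_hom, MonoidalCategory.tensorHom_def]
  simp only [tensorμ]
  calc _ = 𝟙 _ ⊗≫ X₁ ◁ (β_ X₂ Y₁).hom ▷ Y₂ ⊗≫ ((β_ X₁ Y₁).hom ▷ (X₂ ⊗ Y₂) ≫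
        (Y₁ ⊗ X₁) ◁ (β_ X₂ Y₂).hom) ⊗≫ Y₁ ◁ (β_ X₁ Y₂).hom ▷ X₂ ⊗≫ 𝟙 _ := by monoidal
    _ = _ := by rw [← whisker_exchange]; monoidal

/-- Cups and caps on different tensor factors slide past one another by naturality of the symmetry.
-/
theorem cap_cap_exchange (f : (M ⊗ U) ⊗ W ⟶ (N ⊗ U) ⊗ W) :
    (ρ_ M).inv ≫ M ◁ c ≫ ((ρ_ (M ⊗ U)).inv ≫ (M ⊗ U) ◁ c' ≫ f ≫ (N ⊗ U) ◁ e' ≫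
      (ρ_ (N ⊗ U)).hom) ≫ N ◁ e ≫ (ρ_ N).hom =
    (ρ_ M).inv ≫ M ◁ c' ≫ ((ρ_ (M ⊗ W)).inv ≫ (M ⊗ W) ◁ c ≫ (α_ M W U).hom ≫
      M ◁ (β_ W U).hom ≫ (α_ M U W).inv ≫ f ≫ (α_ N U W).hom ≫ N ◁ (β_ U W).hom ≫
      (α_ N W U).inv ≫ (N ⊗ W) ◁ e ≫ (ρ_ (N ⊗ W)).hom) ≫ N ◁ e' ≫ (ρ_ N).hom := by
  have e1 : c ▷ (𝟙_ C) ≫ U ◁ c' = 𝟙 _ ⊗≫ c' ▷ 𝟙_ C ≫ W ◁ c ≫ (β_ W U).hom := by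
    rw [BraidedCategory.braiding_naturality_right, braiding_tensorUnit_right, ← whisker_exchange]
    monoidal
  have e2 : U ◁ e' ≫ e ▷ 𝟙_ C = (β_ U W).hom ≫ W ◁ e ≫ e' ▷ 𝟙_ C ⊗≫ 𝟙 _ := by
    rw [← BraidedCategory.braiding_naturality_left_assoc, braiding_tensorUnit_left,
      whisker_exchange]
    monoidal
  calc _ = 𝟙 _ ⊗≫ M ◁ (c ▷ (𝟙_ C) ≫ U ◁ c') ⊗≫ f ⊗≫ N ◁ (U ◁ e' ≫ e ▷ 𝟙_ C) ⊗≫ 𝟙 _ := by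
        monoidal
    _ = _ := by rw [e1, e2]; monoidal

theorem cap_tensorHom (f : M ⊗ U ⟶ N ⊗ U) (g : P ⊗ W ⟶ Q ⊗ W) :
    (ρ_ (M ⊗ P)).inv ≫ (M ⊗ P) ◁ ((λ_ (𝟙_ C)).inv ≫ (c ⊗ₘ c')) ≫
      (tensorμ M P U W ≫ (f ⊗ₘ g) ≫ tensorμ N U Q W) ≫
      (N ⊗ Q) ◁ ((e ⊗ₘ e') ≫ (λ_ (𝟙_ C)).hom) ≫ (ρ_ (N ⊗ Q)).hom =
    ((ρ_ M).inv ≫ M ◁ c ≫ f ≫ N ◁ e ≫ (ρ_ N).hom) ⊗ₘ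
      ((ρ_ P).inv ≫ P ◁ c' ≫ g ≫ Q ◁ e' ≫ (ρ_ Q).hom) := by
  have h1 : (ρ_ (M ⊗ P)).inv ≫ (M ⊗ P) ◁ (λ_ (𝟙_ C)).inv ≫ tensorμ M P (𝟙_ C) (𝟙_ C) =
      (ρ_ M).inv ⊗ₘ (ρ_ P).inv := by
    rw [Iso.inv_comp_eq, tensor_right_unitality]
    simp
  have h2 : tensorμ N (𝟙_ C) Q (𝟙_ C) ≫ (N ⊗ Q) ◁ (λ_ (𝟙_ C)).hom ≫ (ρ_ (N ⊗ Q)).hom =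
      (ρ_ N).hom ⊗ₘ (ρ_ Q).hom := by
    rw [tensor_right_unitality, ← MonoidalCategory.whiskerLeft_comp_assoc]
    simp
  have h3 : tensorμ N U Q W ≫ (N ⊗ Q) ◁ (e ⊗ₘ e') = ((N ◁ e) ⊗ₘ (Q ◁ e')) ≫ tensorμ _ _ _ _ := by
    have := tensorμ_natural (𝟙 N) e (𝟙 Q) e'
    simp only [id_tensorHom] at this
    rw [this]
    simp
  simp only [MonoidalCategory.whiskerLeft_comp, Category.assoc]
  rw [tensorμ_natural_right_assoc, reassoc_of% h1, reassoc_of% h3, h2]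
  simp

end Caps

section PowModTrace

variable {C : Type u} [Category.{v} C] [Preadditive C] [MonoidalCategory C] [SymmetricCategory C]
  [MonoidalPreadditive C]
variable {B : C} [MonObj B] {s : 𝟙_ C ⟶ B ⊗ B}

namespace PowMod

open Equiv (swap Perm)

variable {M N P Q : PowMod B} {κ ρ : Perm ℕ}

/-- The corrections on the two sides of an equivariant morphism commute with it, so they cancel when
the permutations are inverse to each other. This is what lets the trace axioms for the corrected
symmetry follow from computations with the plain symmetry of `C`. -/
theorem conj_hom (hs : IsSwap B s) {a : M.X ⟶ N.X} {b : P.X ⟶ Q.X} (ha : SemiEquiv κ M N a)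
    (f : N ⟶ P) (hb : SemiEquiv ρ P Q b) (h : N.deg = P.deg → ρ * κ = 1) :
    Hom.hom (straighten hs ha ≫ f ≫ straighten hs hb) = a ≫ Hom.hom f ≫ b := by
  by_cases hd : N.deg = P.deg
  · rw [← straighten_of_hom hs f hd, straighten_comp_straighten, straighten_comp_straighten,
      straighten_hom, mul_one, h hd, inv_one]
    simp [sym_one hs]
  · simp [Hom.eq_zero f hd]

/-- The partial trace with respect to a cup and a cap. -/
@[simps]
def traceHom {U : PowMod B} (c : 𝟙_ C ⟶ U.X) (e : U.X ⟶ 𝟙_ C) (f : M ⊗ U ⟶ N ⊗ U) : M ⟶ N where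
  hom := (ρ_ M.X).inv ≫ M.X ◁ c ≫ Hom.hom f ≫ N.X ◁ e ≫ (ρ_ N.X).hom
  eq_zero h := by
    rw [Hom.eq_zero f (by rw [tensorObj_deg, tensorObj_deg]; omega)]
    simp
  -- The cup and the cap are morphisms of `C` only, with no equivariance for the slots of `U`. This
  -- does no harm: the slots of `M` precede those of `U`, and only they survive in the trace.
  act_comp k hk := by
    by_cases hd : M.deg = N.deg
    · have h := Hom.act_comp f k (by rw [tensorObj_deg]; omega)
      rw [tensorObj_act, tensorObj_act, if_pos hk, if_pos (hd ▸ hk)] at h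
      have h1 : M.act k ≫ (ρ_ M.X).inv ≫ M.X ◁ c =
          ((ρ_ M.X).inv ≫ M.X ◁ c) ▷ B ≫ leftAct (M.act k) U.X := by
        rw [comp_whiskerRight, Category.assoc, ← leftAct_whiskerLeft, ← Category.assoc,
          ← Category.assoc]
        congr 1
        rw [← cancel_mono (ρ_ M.X).hom, Category.assoc, Category.assoc, leftAct_rightUnitor]
        simp
      have h2 : leftAct (N.act k) U.X ≫ N.X ◁ e ≫ (ρ_ N.X).hom =
          (N.X ◁ e ≫ (ρ_ N.X).hom) ▷ B ≫ N.act k := by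
        rw [← Category.assoc, leftAct_whiskerLeft, Category.assoc, leftAct_rightUnitor]
        simp
      simp only [← Category.assoc] at h1 ⊢
      simp only [h1, Category.assoc, reassoc_of% h, h2, comp_whiskerRight]
    · rw [Hom.eq_zero f (by rw [tensorObj_deg, tensorObj_deg]; omega)]
      simp

variable {U W : PowMod B} {c : 𝟙_ C ⟶ U.X} {e : U.X ⟶ 𝟙_ C} {c' : 𝟙_ C ⟶ W.X} {e' : W.X ⟶ 𝟙_ C}

theorem traceHom_pre (a : P ⟶ M) (f : M ⊗ U ⟶ N ⊗ U) :
    traceHom c e (a ▷ U ≫ f) = a ≫ traceHom c e f := by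
  ext
  simp [whisker_exchange_assoc]

theorem traceHom_post (a : N ⟶ P) (f : M ⊗ U ⟶ N ⊗ U) :
    traceHom c e (f ≫ a ▷ U) = traceHom c e f ≫ a := by
  ext
  simp [← whisker_exchange_assoc]

theorem whiskerLeft_traceHom (X : PowMod B) (f : M ⊗ U ⟶ N ⊗ U) :
    X ◁ traceHom c e f = traceHom c e ((α_ X M U).hom ≫ X ◁ f ≫ (α_ X N U).inv) := by
  ext
  simp

theorem traceHom_tensorUnit (f : M ⊗ 𝟙_ _ ⟶ N ⊗ 𝟙_ _) :
    traceHom (U := 𝟙_ (PowMod B)) (𝟙 (𝟙_ C)) (𝟙 (𝟙_ C)) f = (ρ_ M).inv ≫ f ≫ (ρ_ N).hom := by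
  ext
  simp

theorem traceHom_tensorObj (f : M ⊗ (U ⊗ W) ⟶ N ⊗ (U ⊗ W)) :
    traceHom (U := U ⊗ W) ((λ_ (𝟙_ C)).inv ≫ (c ⊗ₘ c')) ((e ⊗ₘ e') ≫ (λ_ (𝟙_ C)).hom) f =
      traceHom c e (traceHom c' e' ((α_ M U W).hom ≫ f ≫ (α_ N U W).inv)) := by
  ext
  simp only [traceHom_hom, comp_hom, associator_hom_hom, associator_inv_hom, tensorObj_X]
  rw [MonoidalCategory.tensorHom_def, MonoidalCategory.tensorHom_def']
  monoidal

theorem traceHom_traceHom (hs : IsSwap B s) (f : (M ⊗ U) ⊗ W ⟶ (N ⊗ U) ⊗ W) :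
    traceHom c e (traceHom c' e' f) =
      traceHom c' e' (traceHom c e
        (((α_ M W U).hom ≫ M ◁ braidingHom hs W U ≫ (α_ M U W).inv) ≫ f ≫
          (α_ N U W).hom ≫ N ◁ braidingHom hs U W ≫ (α_ N W U).inv)) := by
  have h := conj_hom hs ((semiEquiv_braiding W U).whiskerLeft M)
    ((α_ M U W).inv ≫ f ≫ (α_ N U W).hom) ((semiEquiv_braiding U W).whiskerLeft N) (by
      intro h
      have hd : M.deg = N.deg := by simpa using h
      ext k
      simp only [Equiv.Perm.mul_apply, shiftPerm_apply, blockPerm_apply, Equiv.Perm.one_apply, hd]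
      split_ifs <;> omega)
  rw [← straighten_whiskerLeft hs (semiEquiv_braiding W U),
    ← straighten_whiskerLeft hs (semiEquiv_braiding U W)] at h
  ext
  simp only [comp_hom, Category.assoc, traceHom_hom] at h ⊢
  rw [braidingHom, braidingHom, reassoc_of% h]
  simpa using cap_cap_exchange (M := M.X) (N := N.X) (U := U.X) (W := W.X) (Hom.hom f)

/-- The corrections of the two middle exchanges cancel by `conj_hom` when `f` and `g` preserve
degrees; otherwise one of them is zero. What remains is `cap_tensorHom` in `C`. -/
theorem traceHom_tensorHom (hs : IsSwap B s) (f : M ⊗ U ⟶ N ⊗ U) (g : P ⊗ W ⟶ Q ⊗ W) :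
    letI := symmetricCategory hs
    traceHom (U := U ⊗ W) ((λ_ (𝟙_ C)).inv ≫ (c ⊗ₘ c')) ((e ⊗ₘ e') ≫ (λ_ (𝟙_ C)).hom)
      (tensorμ M P U W ≫ (f ⊗ₘ g) ≫ tensorμ N U Q W) = traceHom c e f ⊗ₘ traceHom c' e' g := by
  have h : Hom.hom ((M ◁ braidingHom hs P U ▷ W) ≫ (M ◁ (α_ U P W).hom ≫ (α_ M U (P ⊗ W)).inv ≫
      (f ⊗ₘ g) ≫ (α_ N U (Q ⊗ W)).hom ≫ N ◁ (α_ U Q W).inv) ≫ (N ◁ braidingHom hs U Q ▷ W)) =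
      M.X ◁ (β_ P.X U.X).hom ▷ W.X ≫ (M.X ◁ (α_ U.X P.X W.X).hom ≫ (α_ M.X U.X (P.X ⊗ W.X)).inv ≫
      (f.hom ⊗ₘ g.hom) ≫ (α_ N.X U.X (Q.X ⊗ W.X)).hom ≫ N.X ◁ (α_ U.X Q.X W.X).inv) ≫
      N.X ◁ (β_ U.X Q.X).hom ▷ W.X := by
    by_cases hd : M.deg = N.deg
    · by_cases hd' : P.deg = Q.deg
      · rw [braidingHom, braidingHom, straighten_whiskerRight, straighten_whiskerLeft,
          straighten_whiskerRight, straighten_whiskerLeft]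
        refine (conj_hom hs _ _ _ fun _ => ?_).trans (by simp)
        ext k
        simp only [Equiv.Perm.mul_apply, shiftPerm_apply, blockPerm_apply, Equiv.Perm.one_apply,
          hd, hd']
        split_ifs <;> omega
      · have : Hom.hom g = 0 := Hom.eq_zero g (by rw [tensorObj_deg, tensorObj_deg]; omega)
        simp [this]
    · have : Hom.hom f = 0 := Hom.eq_zero f (by rw [tensorObj_deg, tensorObj_deg]; omega)
      simp [this]
  ext
  simp only [comp_hom, Category.assoc, traceHom_hom, tensorHom_hom] at h ⊢
  rw [← cap_tensorHom]
  simp only [tensorμ, comp_hom, Category.assoc] at h ⊢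
  have h' := congr((ρ_ (M.X ⊗ P.X)).inv ≫ (M.X ⊗ P.X) ◁ ((λ_ (𝟙_ C)).inv ≫ (c ⊗ₘ c')) ≫
    (α_ M.X P.X (U.X ⊗ W.X)).hom ≫ M.X ◁ (α_ P.X U.X W.X).inv ≫ $h ≫ N.X ◁ (α_ Q.X U.X W.X).hom ≫
    (α_ N.X Q.X (U.X ⊗ W.X)).inv ≫ (N.X ⊗ Q.X) ◁ ((e ⊗ₘ e') ≫ (λ_ (𝟙_ C)).hom) ≫
    (ρ_ (N.X ⊗ Q.X)).hom)
  simp only [Category.assoc] at h'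
  exact h'

/-- A cup and a cap satisfying the yanking identity for the corrected symmetry. -/
structure Cap (hs : IsSwap B s) (U : PowMod B) where
  cup : 𝟙_ C ⟶ U.X
  cap : U.X ⟶ 𝟙_ C
  yank : traceHom cup cap (braidingHom hs U U) = 𝟙 U

variable (B s) in
/-- The trace system of objects with a cup and a cap. -/
@[reducible]
def traceSystem (hs : IsSwap B s) :
    letI := symmetricCategory hs
    TraceSystem (PowMod B) :=
  letI := symmetricCategory hs
  { Data := Cap hs
    one := ⟨𝟙 _, 𝟙 _, by
      refine (traceHom_tensorUnit _).trans ?_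
      have := braiding_tensorUnit_left (𝟙_ (PowMod B))
      change braidingHom hs _ _ = _ at this
      rw [this]
      simp [unitors_equal]⟩
    -- The symmetry of `U ⊗ W` with itself is the tensor product of the two symmetries up to middle
    -- exchanges, so its trace is the tensor product of the two yanking identities.
    mul {U W} d e := ⟨(λ_ (𝟙_ C)).inv ≫ (d.cup ⊗ₘ e.cup), (d.cap ⊗ₘ e.cap) ≫ (λ_ (𝟙_ C)).hom, by
      have h := tensorμ_braiding_braiding U W U W
      change _ = braidingHom hs _ _ at h
      rw [← h]
      refine (traceHom_tensorHom hs _ _).trans ?_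
      refine (congrArg₂ (· ⊗ₘ ·) d.yank e.yank).trans (id_tensorHom_id _ _)⟩
    tr d f := traceHom d.cup d.cap f
    tr_pre d a f := traceHom_pre a f
    tr_post d a f := traceHom_post a f
    whiskerLeft_tr X d f := whiskerLeft_traceHom X f
    tr_tr d e f := traceHom_traceHom hs f
    tr_one f := traceHom_tensorUnit f
    tr_mul d e f := traceHom_tensorObj f
    tr_tensor d e f g := traceHom_tensorHom hs f g
    yank d := d.yank }

end PowMod
end PowModTrace
end TensorCat


namespace TensorCat

/-! ### The yanking identity for the regular module -/

section PowModRegular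

variable {C : Type u} [Category.{v} C] [Preadditive C] [MonoidalCategory C] [SymmetricCategory C]
  [MonoidalPreadditive C]
variable {B : C} [MonObj B] {s : 𝟙_ C ⟶ B ⊗ B}

namespace PowMod

open Equiv (swap Perm)

variable (B) in
/-- The algebra `B` as a right module over itself. -/
@[simps, reducible]
def regular : PowMod B where
  deg := 1
  X := B
  act _ := μ[B]
  act_one _ _ := MonObj.mul_one B
  act_mul _ _ := by simp
  act_comm i hi j hj hij := by omega

/-- The corrected symmetry of `R ⊗ R` is the symmetry of `B` followed by right multiplication by
`s`. Hence the trace sends `b` to `s' t(b s'') = s' b t(s'')`, which is `b` since `s' t(s'') = 1`.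
-/
theorem traceHom_regular (hs : IsSwap B s) {B' : C} [ExactPairing B B'] :
    traceHom (U := regular B) η[B] (swapTrace s B') (braidingHom hs (regular B) (regular B)) =
      𝟙 _ := by
  ext
  have h1 : blockPerm 1 1 = swap 0 1 * 1 := by
    ext k
    rw [blockPerm_apply, mul_one, Equiv.swap_apply_def]
    split_ifs <;> omega
  have h2 : (regular B ⊗ regular B).sym s (blockPerm 1 1)⁻¹ =
      (regular B ⊗ regular B).swapOp s 0 1 := by
    rw [h1, mul_one, Equiv.swap_inv, ← Category.id_comp (swapOp _ _ _ _), ← mul_one (swap 0 1)]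
    exact Rep.sym_eq hs (Rep.step Rep.one Nat.zero_lt_two Nat.one_lt_two zero_ne_one)
  -- In elements: `b ⊗ 1 ↦ 1 ⊗ b ↦ (1 ⊗ b) s = s' ⊗ b s''`.
  have h3 : (ρ_ B).inv ≫ B ◁ η[B] ≫ (β_ B B).hom ≫ (regular B ⊗ regular B).swapOp s 0 1 =
      insertRight s := by
    rw [insertRight_eq, BraidedCategory.braiding_naturality_right_assoc, braiding_tensorUnit_right, swapOp, act₂,
      tensorObj_act, tensorObj_act, if_pos Nat.zero_lt_one, if_neg (lt_irrefl 1), leftAct, rightAct]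
    dsimp
    calc _ = 𝟙 _ ⊗≫ (η[B] ▷ (B ⊗ 𝟙_ C) ≫ B ◁ (B ◁ s)) ⊗≫ B ◁ (β_ B B).hom ▷ B ⊗≫
          μ[B] ▷ (B ⊗ B) ⊗≫ B ◁ μ[B] := by monoidal
      _ = 𝟙 _ ⊗≫ B ◁ s ⊗≫ (𝟙_ C ◁ (β_ B B).hom ≫ η[B] ▷ (B ⊗ B)) ▷ B ⊗≫
          μ[B] ▷ (B ⊗ B) ⊗≫ B ◁ μ[B] := by
        rw [whisker_exchange, ← whisker_exchange (η[B]) (B ◁ s)]; monoidal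
      _ = 𝟙 _ ⊗≫ B ◁ s ⊗≫ (β_ B B).hom ▷ B ⊗≫ (η[B] ▷ B ≫ μ[B]) ▷ (B ⊗ B) ⊗≫ B ◁ μ[B] := by
        monoidal
      _ = _ := by rw [MonObj.one_mul]; monoidal
  have h4 : insertRight s ≫ B ◁ swapTrace s B' ≫ (ρ_ B).hom = 𝟙 B := by
    rw [hs.mul_right_eq]
    calc _ = 𝟙 _ ⊗≫ s ▷ B ⊗≫ B ◁ (β_ B B).hom ⊗≫ (μ[B] ▷ B ≫ B ◁ swapTrace s B') ⊗≫ 𝟙 _ := by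
          monoidal
      _ = 𝟙 _ ⊗≫ s ▷ B ⊗≫ B ◁ ((β_ B B).hom ≫ B ◁ swapTrace s B') ⊗≫ μ[B] ⊗≫ 𝟙 _ := by
        rw [← whisker_exchange]; monoidal
      _ = 𝟙 _ ⊗≫ (s ≫ B ◁ swapTrace s B' ≫ (ρ_ B).hom) ▷ B ⊗≫ μ[B] ⊗≫ 𝟙 _ := by
        rw [← BraidedCategory.braiding_naturality_left, braiding_tensorUnit_left]; monoidal
      _ = (λ_ B).inv ≫ η[B] ▷ B ≫ μ[B] := by
        rw [comp_whiskerLeft_swapTrace hs]; monoidal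
      _ = _ := by rw [MonObj.one_mul]; simp
  have h5 := h3 =≫ (B ◁ swapTrace s B' ≫ (ρ_ B).hom)
  simp only [Category.assoc] at h5
  simpa [braidingHom, h2, h4] using h5

end PowMod
end PowModRegular
end TensorCat


/-! ### Calculus of traces over a middle factor -/

namespace TensorCat

namespace TraceSystem

variable {T : Type u} [Category.{v} T] [MonoidalCategory T] [SymmetricCategory T]
variable (𝒯 : TraceSystem T) {U W X X' X'' Y Y' Y'' Z : T}

/-- Conjugate the rule for whiskering on the left by the symmetry. -/
theorem tr_whiskerRight (d : 𝒯.Data U) (f : X ⊗ U ⟶ X' ⊗ U) (Z : T) :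
    𝒯.tr d f ▷ Z = 𝒯.tr d ((α_ X Z U).hom ≫ X ◁ (β_ Z U).hom ≫ (α_ X U Z).inv ≫ f ▷ Z ≫
      (α_ X' U Z).hom ≫ X' ◁ (β_ U Z).hom ≫ (α_ X' Z U).inv) := by
  have h : 𝒯.tr d f ▷ Z = (β_ X Z).hom ≫ Z ◁ 𝒯.tr d f ≫ (β_ Z X').hom := by
    rw [← BraidedCategory.braiding_naturality_left_assoc]; simp
  rw [h, whiskerLeft_tr, ← tr_post, ← tr_pre]
  congr 1
  have h2 : (α_ X Z U).hom ≫ X ◁ (β_ Z U).hom ≫ (α_ X U Z).inv ≫ (β_ (X ⊗ U) Z).hom =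
      (β_ X Z).hom ▷ U ≫ (α_ Z X U).hom := by
    rw [BraidedCategory.braiding_tensor_left_hom]; simp
  have h3 : (β_ Z (X' ⊗ U)).hom ≫ (α_ X' U Z).hom ≫ X' ◁ (β_ U Z).hom ≫ (α_ X' Z U).inv =
      (α_ Z X' U).inv ≫ (β_ Z X').hom ▷ U := by
    rw [BraidedCategory.braiding_tensor_right_hom]; simp
  have h4 : f ▷ Z = (β_ _ Z).hom ≫ Z ◁ f ≫ (β_ Z _).hom := by
    rw [← BraidedCategory.braiding_naturality_left_assoc]; simp
  rw [h4]
  simp only [Category.assoc]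
  rw [h3, reassoc_of% h2]

/-- Trace over a middle factor. -/
def trMid (d : 𝒯.Data U) (f : X ⊗ (U ⊗ Y) ⟶ X' ⊗ (U ⊗ Y')) : X ⊗ Y ⟶ X' ⊗ Y' :=
  𝒯.tr d ((α_ X Y U).hom ≫ X ◁ (β_ Y U).hom ≫ f ≫ X' ◁ (β_ U Y').hom ≫ (α_ X' Y' U).inv)

variable {𝒯} (d : 𝒯.Data U) (e : 𝒯.Data W)

theorem trMid_whiskerRight_comp (a : X'' ⟶ X) (f : X ⊗ (U ⊗ Y) ⟶ X' ⊗ (U ⊗ Y')) :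
    𝒯.trMid d (a ▷ (U ⊗ Y) ≫ f) = a ▷ Y ≫ 𝒯.trMid d f := by
  rw [trMid, trMid, ← tr_pre]
  congr 1
  calc _ = 𝟙 _ ⊗≫ (X'' ◁ (β_ Y U).hom ≫ a ▷ (U ⊗ Y)) ⊗≫ f ≫ X' ◁ (β_ U Y').hom ≫
        (α_ X' Y' U).inv := by monoidal
    _ = _ := by rw [whisker_exchange]; monoidal

theorem trMid_comp_whiskerRight (a : X' ⟶ X'') (f : X ⊗ (U ⊗ Y) ⟶ X' ⊗ (U ⊗ Y')) :
    𝒯.trMid d (f ≫ a ▷ (U ⊗ Y')) = 𝒯.trMid d f ≫ a ▷ Y' := by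
  rw [trMid, trMid, ← tr_post]
  congr 1
  calc _ = 𝟙 _ ⊗≫ X ◁ (β_ Y U).hom ≫ f ⊗≫ (a ▷ (U ⊗ Y') ≫ X'' ◁ (β_ U Y').hom) ⊗≫ 𝟙 _ := by
        monoidal
    _ = _ := by rw [← whisker_exchange]; monoidal

theorem trMid_whiskerLeft_comp (b : Y'' ⟶ Y) (f : X ⊗ (U ⊗ Y) ⟶ X' ⊗ (U ⊗ Y')) :
    𝒯.trMid d (X ◁ U ◁ b ≫ f) = X ◁ b ≫ 𝒯.trMid d f := by
  rw [trMid, trMid, ← tr_pre]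
  congr 1
  calc _ = 𝟙 _ ⊗≫ X ◁ ((β_ Y'' U).hom ≫ U ◁ b) ≫ f ≫ X' ◁ (β_ U Y').hom ≫
        (α_ X' Y' U).inv := by monoidal
    _ = _ := by rw [← BraidedCategory.braiding_naturality_left]; monoidal

theorem trMid_comp_whiskerLeft (b : Y' ⟶ Y'') (f : X ⊗ (U ⊗ Y) ⟶ X' ⊗ (U ⊗ Y')) :
    𝒯.trMid d (f ≫ X' ◁ U ◁ b) = 𝒯.trMid d f ≫ X' ◁ b := by
  rw [trMid, trMid, ← tr_post]
  congr 1
  calc _ = 𝟙 _ ⊗≫ X ◁ (β_ Y U).hom ≫ f ≫ X' ◁ (U ◁ b ≫ (β_ U Y'').hom) ⊗≫ 𝟙 _ := by monoidal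
    _ = _ := by rw [BraidedCategory.braiding_naturality_right]; monoidal

theorem whiskerLeft_trMid (f : X ⊗ (U ⊗ Y) ⟶ X' ⊗ (U ⊗ Y')) (Z : T) :
    (α_ Z X Y).hom ≫ Z ◁ 𝒯.trMid d f = 𝒯.trMid d ((α_ Z X (U ⊗ Y)).hom ≫ Z ◁ f ≫
      (α_ Z X' (U ⊗ Y')).inv) ≫ (α_ Z X' Y').hom := by
  rw [trMid, trMid, whiskerLeft_tr, ← tr_pre, ← tr_post]
  congr 1
  monoidal

theorem trMid_whiskerRight (f : X ⊗ (U ⊗ Y) ⟶ X' ⊗ (U ⊗ Y')) (Z : T) :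
    (α_ X Y Z).inv ≫ 𝒯.trMid d f ▷ Z ≫ (α_ X' Y' Z).hom =
      𝒯.trMid d (X ◁ (α_ U Y Z).inv ≫ (α_ X (U ⊗ Y) Z).inv ≫ f ▷ Z ≫ (α_ X' (U ⊗ Y') Z).hom ≫
        X' ◁ (α_ U Y' Z).hom) := by
  rw [trMid, trMid, tr_whiskerRight, ← tr_post, ← tr_pre]
  congr 1
  rw [BraidedCategory.braiding_tensor_left_hom, BraidedCategory.braiding_tensor_right_hom]
  monoidal

/-- Once the symmetries around `f` are collected by the hexagon identities, this is the independence
of a double trace of the order, `tr_tr`. -/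
theorem trMid_exchange (f : (X ⊗ W) ⊗ (U ⊗ Y) ⟶ (X' ⊗ W) ⊗ (U ⊗ Y')) :
    𝒯.trMid e ((α_ X W Y).inv ≫ 𝒯.trMid d f ≫ (α_ X' W Y').hom) =
      𝒯.trMid d (𝒯.trMid e ((α_ X W (U ⊗ Y)).inv ≫ f ≫ (α_ X' W (U ⊗ Y')).hom)) := by
  simp only [trMid, ← tr_post, ← tr_pre, Category.assoc]
  rw [tr_tr]
  congr 2
  have h1 : (α_ (X ⊗ Y) U W).hom ≫ (X ⊗ Y) ◁ (β_ U W).hom ≫ (α_ (X ⊗ Y) W U).inv ≫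
      (α_ X Y W).hom ▷ U ≫ (X ◁ (β_ Y W).hom) ▷ U ≫ (α_ X W Y).inv ▷ U ≫ (α_ (X ⊗ W) Y U).hom ≫
      (X ⊗ W) ◁ (β_ Y U).hom = (α_ X Y U).hom ▷ W ≫ (X ◁ (β_ Y U).hom) ▷ W ≫
      (α_ X (U ⊗ Y) W).hom ≫ X ◁ (β_ (U ⊗ Y) W).hom ≫ (α_ X W (U ⊗ Y)).inv := by
    calc _ = 𝟙 _ ⊗≫ X ◁ (Y ◁ (β_ U W).hom ⊗≫ (β_ Y W).hom ▷ U ⊗≫ W ◁ (β_ Y U).hom) ⊗≫ 𝟙 _ := by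
          monoidal
      _ = 𝟙 _ ⊗≫ X ◁ ((β_ (Y ⊗ U) W).hom ≫ W ◁ (β_ Y U).hom) ⊗≫ 𝟙 _ := by
        rw [BraidedCategory.braiding_tensor_left_hom]; monoidal
      _ = _ := by
        rw [← BraidedCategory.braiding_naturality_left]; monoidal
  have h2 : (X' ⊗ W) ◁ (β_ U Y').hom ≫ (α_ (X' ⊗ W) Y' U).inv ≫ (α_ X' W Y').hom ▷ U ≫
      (X' ◁ (β_ W Y').hom) ▷ U ≫ (α_ X' Y' W).inv ▷ U ≫ (α_ (X' ⊗ Y') W U).hom ≫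
      (X' ⊗ Y') ◁ (β_ W U).hom ≫ (α_ (X' ⊗ Y') U W).inv = (α_ X' W (U ⊗ Y')).hom ≫
      X' ◁ (β_ W (U ⊗ Y')).hom ≫ (α_ X' (U ⊗ Y') W).inv ≫ (X' ◁ (β_ U Y').hom) ▷ W ≫
      (α_ X' Y' U).inv ▷ W := by
    calc _ = 𝟙 _ ⊗≫ X' ◁ (W ◁ (β_ U Y').hom ⊗≫ (β_ W Y').hom ▷ U ⊗≫ Y' ◁ (β_ W U).hom) ⊗≫
          𝟙 _ := by monoidal
      _ = 𝟙 _ ⊗≫ X' ◁ (W ◁ (β_ U Y').hom ≫ (β_ W (Y' ⊗ U)).hom) ⊗≫ 𝟙 _ := by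
        rw [BraidedCategory.braiding_tensor_right_hom]; monoidal
      _ = _ := by
        rw [BraidedCategory.braiding_naturality_right]; monoidal
  simp only [Category.assoc]
  simp only [comp_whiskerRight, Category.assoc]
  rw [h2, reassoc_of% h1]

end TraceSystem
end TensorCat


namespace TensorCat

/-! ### Composition of formal differences -/

section TensorMu

variable {T : Type u} [Category.{v} T] [MonoidalCategory T] [SymmetricCategory T]

/-- Serves to obtain a coherence identity from the one already proved for the inverse morphisms,
instead of repeating the computation. -/
theorem eq_of_inverses {X Y : T} {a a' : X ⟶ Y} {b b' : Y ⟶ X} (h : a = a') (h1 : a ≫ b = 𝟙 X)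
    (h2 : b' ≫ a' = 𝟙 Y) : b = b' := by
  subst h
  rw [← Category.id_comp b, ← h2, Category.assoc, h1, Category.comp_id]

theorem tensorμ_comp_braiding (Y S U W : T) :
    tensorμ Y S U W ≫ ((β_ Y U).hom ⊗ₘ (β_ S W).hom) =
      (β_ (Y ⊗ S) (U ⊗ W)).hom ≫ tensorμ U W Y S := by
  rw [← tensorμ_braiding_braiding]; simp

theorem tensorμ_middle_in (X Z Y S U W : T) :
    tensorμ X Z Y S ▷ (U ⊗ W) ≫ tensorμ (X ⊗ Y) (Z ⊗ S) U W ≫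
      (((α_ X Y U).hom ≫ X ◁ (β_ Y U).hom) ⊗ₘ ((α_ Z S W).hom ≫ Z ◁ (β_ S W).hom)) =
    (α_ (X ⊗ Z) (Y ⊗ S) (U ⊗ W)).hom ≫ (X ⊗ Z) ◁ (β_ (Y ⊗ S) (U ⊗ W)).hom ≫
      (X ⊗ Z) ◁ tensorμ U W Y S ≫ tensorμ X Z (U ⊗ Y) (W ⊗ S) := by
  rw [← tensorHom_comp_tensorHom, tensor_associativity_assoc, ← tensorμ_natural_right,
    ← whiskerLeft_comp_assoc, ← whiskerLeft_comp_assoc, tensorμ_comp_braiding]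

theorem tensorμ_middle_out (X Z Y S U W : T) :
    ((X ◁ (β_ U Y).hom ≫ (α_ X Y U).inv) ⊗ₘ (Z ◁ (β_ W S).hom ≫ (α_ Z S W).inv)) ≫
      tensorμ (X ⊗ Y) U (Z ⊗ S) W ≫ tensorμ X Y Z S ▷ (U ⊗ W) =
    tensorμ X (U ⊗ Y) Z (W ⊗ S) ≫ (X ⊗ Z) ◁ tensorμ U Y W S ≫
      (X ⊗ Z) ◁ (β_ (U ⊗ W) (Y ⊗ S)).hom ≫ (α_ (X ⊗ Z) (Y ⊗ S) (U ⊗ W)).inv := by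
  refine eq_of_inverses (tensorμ_middle_in X Z Y S U W) ?_ ?_
  · have h : (((α_ X Y U).hom ≫ X ◁ (β_ Y U).hom) ⊗ₘ ((α_ Z S W).hom ≫ Z ◁ (β_ S W).hom)) ≫
        ((X ◁ (β_ U Y).hom ≫ (α_ X Y U).inv) ⊗ₘ (Z ◁ (β_ W S).hom ≫ (α_ Z S W).inv)) = 𝟙 _ := by
      rw [tensorHom_comp_tensorHom]; simp
    simp only [Category.assoc]
    rw [reassoc_of% h, tensorμ_tensorμ_assoc, ← comp_whiskerRight, tensorμ_tensorμ,
      id_whiskerRight]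
  · simp only [Category.assoc, Iso.inv_hom_id_assoc]
    rw [← whiskerLeft_comp_assoc _ (β_ _ _).hom, SymmetricCategory.symmetry, whiskerLeft_id,
      Category.id_comp, ← whiskerLeft_comp_assoc, tensorμ_tensorμ, whiskerLeft_id,
      Category.id_comp, tensorμ_tensorμ]

end TensorMu

namespace TraceSystem

variable {T : Type u} [Category.{v} T] [MonoidalCategory T] [SymmetricCategory T]
variable {𝒯 : TraceSystem T} {U W X X' X'' Y Y' Y'' Z Z' S S' : T}
variable (d : 𝒯.Data U) (e : 𝒯.Data W)

theorem trMid_tensor (f : X ⊗ (U ⊗ Y) ⟶ X' ⊗ (U ⊗ Y')) (g : Z ⊗ (W ⊗ S) ⟶ Z' ⊗ (W ⊗ S')) :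
    𝒯.trMid (𝒯.mul d e) ((X ⊗ Z) ◁ tensorμ U W Y S ≫ tensorμ X Z (U ⊗ Y) (W ⊗ S) ≫ (f ⊗ₘ g) ≫
      tensorμ X' (U ⊗ Y') Z' (W ⊗ S') ≫ (X' ⊗ Z') ◁ tensorμ U Y' W S') =
    tensorμ X Z Y S ≫ (𝒯.trMid d f ⊗ₘ 𝒯.trMid e g) ≫ tensorμ X' Y' Z' S' := by
  rw [trMid, trMid, trMid, ← tr_tensor, ← tr_post, ← tr_pre]
  congr 1
  have h1 := tensorμ_middle_in X Z Y S U W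
  have h2 := tensorμ_middle_out X' Z' Y' S' U W
  simp only [← tensorHom_comp_tensorHom, Category.assoc] at h1 h2 ⊢
  rw [h2, reassoc_of% h1]

/-- Composition in the category of formal differences. -/
def diffComp {A A₁ A₂ U U₁ U₂ : T} (d : 𝒯.Data U₁) (f : A ⊗ U₁ ⟶ U ⊗ A₁) (g : A₁ ⊗ U₂ ⟶ U₁ ⊗ A₂) :
    A ⊗ U₂ ⟶ U ⊗ A₂ :=
  𝒯.trMid d ((α_ A U₁ U₂).inv ≫ f ▷ U₂ ≫ (α_ U A₁ U₂).hom ≫ U ◁ g)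

section DiffComp

variable {A A₁ A₂ A₃ U U₁ U₂ U₃ : T} (d₁ : 𝒯.Data U₁) (d₂ : 𝒯.Data U₂)

/-- Both sides are the double trace, over `U₁` and `U₂`, of `f`, `g` and `h` joined in a row; only
the order of the two traces differs. -/
theorem diffComp_assoc (f : A ⊗ U₁ ⟶ U ⊗ A₁) (g : A₁ ⊗ U₂ ⟶ U₁ ⊗ A₂) (h : A₂ ⊗ U₃ ⟶ U₂ ⊗ A₃) :
    diffComp d₂ (diffComp d₁ f g) h = diffComp d₁ f (diffComp d₂ g h) := by
  have h1 : diffComp d₂ (diffComp d₁ f g) h = 𝒯.trMid d₂ (𝒯.trMid d₁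
      ((α_ _ _ _).inv ≫ f ▷ (U₂ ⊗ U₃) ≫ (α_ _ _ _).hom ≫ U ◁ ((α_ _ _ _).inv ≫ g ▷ U₃ ≫
        (α_ _ _ _).hom ≫ U₁ ◁ h))) := by
    rw [diffComp, diffComp]
    have := reassoc_of% trMid_whiskerRight d₁
      ((α_ A U₁ U₂).inv ≫ f ▷ U₂ ≫ (α_ U A₁ U₂).hom ≫ U ◁ g) U₃
    rw [this, ← trMid_comp_whiskerLeft]
    congr 2
    monoidal
  have h2 : diffComp d₁ f (diffComp d₂ g h) = 𝒯.trMid d₁ ((α_ _ _ _).inv ≫ 𝒯.trMid d₂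
      (f ▷ (U₂ ⊗ U₃) ≫ (α_ _ _ _).hom ≫ U ◁ ((α_ _ _ _).inv ≫ g ▷ U₃ ≫
        (α_ _ _ _).hom ≫ U₁ ◁ h) ≫ (α_ _ _ _).inv) ≫ (α_ _ _ _).hom) := by
    rw [diffComp, diffComp, whiskerLeft_trMid, trMid_whiskerRight_comp, Category.assoc]
  rw [h1, h2, trMid_exchange]
  congr 2
  simp

/-- The symmetry represents the identity. Composing with it leaves a symmetry of `U₁` with itself
under the trace, and yanking removes it. -/
theorem diffComp_braiding (f : A ⊗ U₁ ⟶ U ⊗ A₁) :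
    diffComp d₁ f (β_ A₁ U₁).hom = f := by
  rw [diffComp, trMid]
  calc _ = 𝒯.tr d₁ ((α_ A U₁ U₁).hom ≫ A ◁ (β_ U₁ U₁).hom ≫ (α_ A U₁ U₁).inv ≫ f ▷ U₁) := by
        simp [← whiskerLeft_comp_assoc]
    _ = _ := by
      have := 𝒯.whiskerLeft_tr A d₁ (β_ U₁ U₁).hom
      rw [yank] at this
      have h := 𝒯.tr_post d₁ f ((α_ A U₁ U₁).hom ≫ A ◁ (β_ U₁ U₁).hom ≫ (α_ A U₁ U₁).inv)
      rw [← this] at h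
      simpa using h

theorem braiding_diffComp (g : A₁ ⊗ U₂ ⟶ U₁ ⊗ A₂) :
    diffComp d₁ (β_ A₁ U₁).hom g = g := by
  rw [diffComp, trMid]
  have h1 : (α_ A₁ U₂ U₁).hom ≫ A₁ ◁ (β_ U₂ U₁).hom ≫ ((α_ A₁ U₁ U₂).inv ≫ (β_ A₁ U₁).hom ▷ U₂ ≫
      (α_ U₁ A₁ U₂).hom ≫ U₁ ◁ g) ≫ U₁ ◁ (β_ U₁ A₂).hom ≫ (α_ U₁ A₂ U₁).inv = g ▷ U₁ ≫
      (α_ U₁ A₂ U₁).hom ≫ U₁ ◁ (β_ A₂ U₁).hom ≫ (α_ _ _ _).inv ≫ (β_ U₁ U₁).hom ▷ A₂ ≫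
      (α_ _ _ _).hom ≫ U₁ ◁ (β_ U₁ A₂).hom ≫ (α_ U₁ A₂ U₁).inv := by
    have := BraidedCategory.braiding_naturality_left g U₁
    rw [BraidedCategory.braiding_tensor_left_hom, BraidedCategory.braiding_tensor_left_hom] at this
    simp only [Category.assoc]
    rw [← reassoc_of% this]
  have h2 := tr_whiskerRight 𝒯 d₁ (β_ U₁ U₁).hom A₂
  rw [yank] at h2
  rw [h1, tr_pre, ← h2]
  simp

theorem diffComp_whiskerLeft {A₂' : T} (f : A ⊗ U₁ ⟶ U ⊗ A₁) (g : A₁ ⊗ U₂ ⟶ U₁ ⊗ A₂) (b : A₂ ⟶ A₂') :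
    diffComp d₁ f (g ≫ U₁ ◁ b) = diffComp d₁ f g ≫ U ◁ b := by
  rw [diffComp, diffComp, ← trMid_comp_whiskerLeft]
  simp

theorem diffComp_whiskerLeft_pre {U₂' : T} (f : A ⊗ U₁ ⟶ U ⊗ A₁) (g : A₁ ⊗ U₂ ⟶ U₁ ⊗ A₂)
    (b : U₂' ⟶ U₂) : diffComp d₁ f (A₁ ◁ b ≫ g) = A ◁ b ≫ diffComp d₁ f g := by
  rw [diffComp, diffComp, ← trMid_whiskerLeft_comp]
  congr 1
  calc _ = 𝟙 _ ⊗≫ (f ▷ U₂' ≫ (U ⊗ A₁) ◁ b) ⊗≫ U ◁ g := by monoidal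
    _ = _ := by rw [← whisker_exchange]; monoidal

theorem whiskerRight_diffComp {U' : T} (f : A ⊗ U₁ ⟶ U ⊗ A₁) (g : A₁ ⊗ U₂ ⟶ U₁ ⊗ A₂)
    (b : U ⟶ U') : diffComp d₁ (f ≫ b ▷ A₁) g = diffComp d₁ f g ≫ b ▷ A₂ := by
  rw [diffComp, diffComp, ← trMid_comp_whiskerRight]
  congr 1
  calc _ = 𝟙 _ ⊗≫ f ▷ U₂ ⊗≫ (b ▷ (A₁ ⊗ U₂) ≫ U' ◁ g) := by monoidal
    _ = _ := by rw [← whisker_exchange]; monoidal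

theorem whiskerRight_diffComp_pre {A' : T} (f : A ⊗ U₁ ⟶ U ⊗ A₁) (g : A₁ ⊗ U₂ ⟶ U₁ ⊗ A₂)
    (b : A' ⟶ A) : diffComp d₁ (b ▷ U₁ ≫ f) g = b ▷ U₂ ≫ diffComp d₁ f g := by
  rw [diffComp, diffComp, ← trMid_whiskerRight_comp]
  simp

theorem diffComp_slide_pos {A₁' : T} (f : A ⊗ U₁ ⟶ U ⊗ A₁) (g : A₁' ⊗ U₂ ⟶ U₁ ⊗ A₂)
    (b : A₁ ⟶ A₁') : diffComp d₁ (f ≫ U ◁ b) g = diffComp d₁ f (b ▷ U₂ ≫ g) := by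
  rw [diffComp, diffComp]
  simp

end DiffComp
end TraceSystem
end TensorCat


namespace TensorCat

/-! ### Coherence for the tensor product of formal differences -/

section DiffStep

variable {T : Type u} [Category.{v} T] [MonoidalCategory T] [SymmetricCategory T]
variable {𝒯 : TraceSystem T}

open TraceSystem

theorem associator_tensorμ (X₁ X₂ X₃ Y₁ Y₂ Y₃ : T) :
    (α_ (X₁ ⊗ Y₁) (X₂ ⊗ Y₂) (X₃ ⊗ Y₃)).hom ≫ (X₁ ⊗ Y₁) ◁ tensorμ X₂ Y₂ X₃ Y₃ ≫
      tensorμ X₁ Y₁ (X₂ ⊗ X₃) (Y₂ ⊗ Y₃) ≫ ((α_ X₁ X₂ X₃).inv ⊗ₘ (α_ Y₁ Y₂ Y₃).inv) =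
    tensorμ X₁ Y₁ X₂ Y₂ ▷ (X₃ ⊗ Y₃) ≫ tensorμ (X₁ ⊗ X₂) (Y₁ ⊗ Y₂) X₃ Y₃ := by
  rw [← tensor_associativity_assoc, tensorHom_comp_tensorHom]
  simp

theorem associator_tensorμ' (X₁ X₂ X₃ Y₁ Y₂ Y₃ : T) :
    (α_ (X₁ ⊗ Y₁) (X₂ ⊗ Y₂) (X₃ ⊗ Y₃)).hom ≫ (X₁ ⊗ Y₁) ◁ tensorμ X₂ Y₂ X₃ Y₃ ≫
      tensorμ X₁ Y₁ (X₂ ⊗ X₃) (Y₂ ⊗ Y₃) =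
    tensorμ X₁ Y₁ X₂ Y₂ ▷ (X₃ ⊗ Y₃) ≫ tensorμ (X₁ ⊗ X₂) (Y₁ ⊗ Y₂) X₃ Y₃ ≫
      ((α_ X₁ X₂ X₃).hom ⊗ₘ (α_ Y₁ Y₂ Y₃).hom) := by
  rw [tensor_associativity]

theorem tensorμ_associator_inv (X₁ X₂ X₃ Y₁ Y₂ Y₃ : T) :
    (X₁ ⊗ X₂) ◁ tensorμ Y₁ Y₂ X₃ Y₃ ≫ tensorμ X₁ X₂ (Y₁ ⊗ X₃) (Y₂ ⊗ Y₃) ≫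
      ((α_ X₁ Y₁ X₃).inv ⊗ₘ (α_ X₂ Y₂ Y₃).inv) =
    (α_ _ _ _).inv ≫ tensorμ X₁ X₂ Y₁ Y₂ ▷ (X₃ ⊗ Y₃) ≫ tensorμ (X₁ ⊗ Y₁) (X₂ ⊗ Y₂) X₃ Y₃ := by
  rw [← associator_tensorμ, Iso.inv_hom_id_assoc]

theorem tensorμ_associator_hom (X₁ X₂ X₃ Y₁ Y₂ Y₃ : T) :
    tensorμ (X₁ ⊗ Y₁) (X₂ ⊗ Y₂) X₃ Y₃ ≫ ((α_ X₁ Y₁ X₃).hom ⊗ₘ (α_ X₂ Y₂ Y₃).hom) =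
    tensorμ X₁ Y₁ X₂ Y₂ ▷ (X₃ ⊗ Y₃) ≫ (α_ _ _ _).hom ≫
      (X₁ ⊗ X₂) ◁ tensorμ Y₁ Y₂ X₃ Y₃ ≫ tensorμ X₁ X₂ (Y₁ ⊗ X₃) (Y₂ ⊗ Y₃) := by
  rw [associator_tensorμ', ← comp_whiskerRight_assoc, tensorμ_tensorμ]
  simp

/-- The interchange law of the tensor product. It rests on `tr_tensor`, the trace of a tensor
product being the tensor product of traces; the rest is rearrangement of factors. -/
theorem diffComp_tensor {A A₁ A₂ U U₁ U₂ P P₁ P₂ W W₁ W₂ : T} (d : 𝒯.Data U₁) (e : 𝒯.Data W₁)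
    (f : A ⊗ U₁ ⟶ U ⊗ A₁) (g : A₁ ⊗ U₂ ⟶ U₁ ⊗ A₂) (f' : P ⊗ W₁ ⟶ W ⊗ P₁)
    (g' : P₁ ⊗ W₂ ⟶ W₁ ⊗ P₂) :
    diffComp (𝒯.mul d e) (tensorμ A P U₁ W₁ ≫ (f ⊗ₘ f') ≫ tensorμ U A₁ W P₁)
      (tensorμ A₁ P₁ U₂ W₂ ≫ (g ⊗ₘ g') ≫ tensorμ U₁ A₂ W₁ P₂) =
    tensorμ A P U₂ W₂ ≫ (diffComp d f g ⊗ₘ diffComp e f' g') ≫ tensorμ U A₂ W P₂ := by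
  rw [diffComp, diffComp, diffComp, ← trMid_tensor]
  congr 1
  symm
  calc _ = ((A ⊗ P) ◁ tensorμ U₁ W₁ U₂ W₂ ≫ tensorμ A P (U₁ ⊗ U₂) (W₁ ⊗ W₂) ≫
        ((α_ A U₁ U₂).inv ⊗ₘ (α_ P W₁ W₂).inv)) ≫ (f ▷ U₂ ⊗ₘ f' ▷ W₂) ≫
        ((α_ U A₁ U₂).hom ⊗ₘ (α_ W P₁ W₂).hom) ≫ (U ◁ g ⊗ₘ W ◁ g') ≫
        tensorμ U (U₁ ⊗ A₂) W (W₁ ⊗ P₂) ≫ (U ⊗ W) ◁ tensorμ U₁ A₂ W₁ P₂ := by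
        simp only [← tensorHom_comp_tensorHom, Category.assoc]
    _ = _ := by
      rw [tensorμ_associator_inv]
      simp only [Category.assoc, comp_whiskerRight, MonoidalCategory.whiskerLeft_comp]
      rw [← tensorμ_natural_left_assoc, reassoc_of% tensorμ_associator_hom U W U₂ A₁ P₁ W₂,
        ← tensorμ_natural_right_assoc, tensorμ_tensorμ_assoc]

theorem braiding_tensorUnit_tensorUnit : (β_ (𝟙_ T) (𝟙_ T)).hom = 𝟙 _ := by
  rw [braiding_tensorUnit_left, unitors_equal]; simp

theorem leftUnitor_tensorμ {A A' U U' : T} (f : A ⊗ U' ⟶ U ⊗ A') :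
    (𝟙_ T ⊗ A) ◁ (λ_ U').inv ≫ (tensorμ (𝟙_ T) A (𝟙_ T) U' ≫ (𝟙 (𝟙_ T ⊗ 𝟙_ T) ⊗ₘ f) ≫
      tensorμ (𝟙_ T) (𝟙_ T) U A') ≫ (𝟙_ T ⊗ U) ◁ (λ_ A').hom =
    (λ_ A).hom ▷ U' ≫ f ≫ (λ_ U).inv ▷ A' := by
  have h1 : tensorμ (𝟙_ T) A (𝟙_ T) U' =
      ((λ_ A).hom ⊗ₘ (λ_ U').hom) ≫ (λ_ _).inv ≫ (λ_ (𝟙_ T)).inv ▷ _ := by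
    rw [leftUnitor_monoidal]; simp
  have h2 : (λ_ _).inv ≫ (λ_ (𝟙_ T)).inv ▷ _ ≫ tensorμ (𝟙_ T) (𝟙_ T) U A' =
      (λ_ U).inv ⊗ₘ (λ_ A').inv := by
    rw [Iso.inv_comp_eq, tensor_left_unitality]; simp
  have h3 : ((λ_ (A ⊗ U')).inv ≫ (λ_ (𝟙_ T)).inv ▷ _) ≫ (𝟙 (𝟙_ T ⊗ 𝟙_ T) ⊗ₘ f) =
      f ≫ (λ_ (U ⊗ A')).inv ≫ (λ_ (𝟙_ T)).inv ▷ _ := by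
    rw [id_tensorHom, Category.assoc, ← whisker_exchange, leftUnitor_inv_naturality_assoc]
  rw [h1]
  simp only [Category.assoc] at h3 ⊢
  rw [reassoc_of% h3, reassoc_of% h2]
  simp [MonoidalCategory.tensorHom_def]

theorem rightUnitor_tensorμ {A A' U U' : T} (f : A ⊗ U' ⟶ U ⊗ A') :
    (A ⊗ 𝟙_ T) ◁ (ρ_ U').inv ≫ (tensorμ A (𝟙_ T) U' (𝟙_ T) ≫ (f ⊗ₘ 𝟙 (𝟙_ T ⊗ 𝟙_ T)) ≫
      tensorμ U A' (𝟙_ T) (𝟙_ T)) ≫ (U ⊗ 𝟙_ T) ◁ (ρ_ A').hom =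
    (ρ_ A).hom ▷ U' ≫ f ≫ (ρ_ U).inv ▷ A' := by
  have h1 : tensorμ A (𝟙_ T) U' (𝟙_ T) =
      ((ρ_ A).hom ⊗ₘ (ρ_ U').hom) ≫ (ρ_ _).inv ≫ _ ◁ (λ_ (𝟙_ T)).inv := by
    rw [rightUnitor_monoidal]; simp
  have h2 : (ρ_ _).inv ≫ _ ◁ (λ_ (𝟙_ T)).inv ≫ tensorμ U A' (𝟙_ T) (𝟙_ T) =
      (ρ_ U).inv ⊗ₘ (ρ_ A').inv := by
    rw [Iso.inv_comp_eq, tensor_right_unitality]; simp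
  have h3 : ((ρ_ (A ⊗ U')).inv ≫ _ ◁ (λ_ (𝟙_ T)).inv) ≫ (f ⊗ₘ 𝟙 (𝟙_ T ⊗ 𝟙_ T)) =
      f ≫ (ρ_ (U ⊗ A')).inv ≫ _ ◁ (λ_ (𝟙_ T)).inv := by
    rw [tensorHom_id, Category.assoc, whisker_exchange, rightUnitor_inv_naturality_assoc]
  rw [h1]
  simp only [Category.assoc] at h3 ⊢
  rw [reassoc_of% h3, reassoc_of% h2]
  simp [MonoidalCategory.tensorHom_def]

theorem associator_whiskerRight_tensorμ (A B D U W R : T) :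
    (α_ A B D).hom ▷ (U ⊗ W ⊗ R) ≫ tensorμ A (B ⊗ D) U (W ⊗ R) ≫
      (A ⊗ U) ◁ tensorμ B D W R = ((A ⊗ B) ⊗ D) ◁ (α_ U W R).inv ≫
      tensorμ (A ⊗ B) D (U ⊗ W) R ≫ tensorμ A B U W ▷ (D ⊗ R) ≫ (α_ _ _ _).hom := by
  rw [associator_monoidal, MonoidalCategory.tensorHom_def']
  simp

theorem tensorμ_associator_inv_whiskerRight (A B D U W R : T) :
    (A ⊗ U) ◁ tensorμ B W D R ≫ tensorμ A U (B ⊗ D) (W ⊗ R) ≫ (α_ A B D).inv ▷ (U ⊗ W ⊗ R) =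
      (α_ _ _ _).inv ≫ tensorμ A U B W ▷ (D ⊗ R) ≫ tensorμ (A ⊗ B) (U ⊗ W) D R ≫
        ((A ⊗ B) ⊗ D) ◁ (α_ U W R).hom := by
  refine eq_of_inverses (associator_whiskerRight_tensorμ A B D U W R) ?_ ?_
  · simp only [Category.assoc]
    rw [← whiskerLeft_comp_assoc, tensorμ_tensorμ, whiskerLeft_id, Category.id_comp,
      tensorμ_tensorμ_assoc, hom_inv_whiskerRight]
  · simp only [Category.assoc]
    rw [whiskerLeft_hom_inv_assoc, tensorμ_tensorμ_assoc, ← comp_whiskerRight_assoc,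
      tensorμ_tensorμ, id_whiskerRight, Category.id_comp, Iso.inv_hom_id]

theorem associator_tensorμ_tensorμ {A B D A' B' D' U W R U' W' R' : T} (f : A ⊗ U' ⟶ U ⊗ A')
    (g : B ⊗ W' ⟶ W ⊗ B') (h : D ⊗ R' ⟶ R ⊗ D') :
    ((A ⊗ B) ⊗ D) ◁ (α_ U' W' R').inv ≫ (tensorμ (A ⊗ B) D (U' ⊗ W') R' ≫
      ((tensorμ A B U' W' ≫ (f ⊗ₘ g) ≫ tensorμ U A' W B') ⊗ₘ h) ≫
      tensorμ (U ⊗ W) (A' ⊗ B') R D') ≫ ((U ⊗ W) ⊗ R) ◁ (α_ A' B' D').hom =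
    (α_ A B D).hom ▷ (U' ⊗ W' ⊗ R') ≫ (tensorμ A (B ⊗ D) U' (W' ⊗ R') ≫
      (f ⊗ₘ (tensorμ B D W' R' ≫ (g ⊗ₘ h) ≫ tensorμ W B' R D')) ≫
      tensorμ U A' (W ⊗ R) (B' ⊗ D')) ≫ (α_ U W R).inv ▷ (A' ⊗ B' ⊗ D') := by
  have e1 : (f ⊗ₘ (tensorμ B D W' R' ≫ (g ⊗ₘ h) ≫ tensorμ W B' R D')) =
      (A ⊗ U') ◁ tensorμ B D W' R' ≫ (f ⊗ₘ (g ⊗ₘ h)) ≫ (U ⊗ A') ◁ tensorμ W B' R D' := by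
    rw [← id_tensorHom, ← id_tensorHom, tensorHom_comp_tensorHom, tensorHom_comp_tensorHom]
    simp
  have e2 : ((tensorμ A B U' W' ≫ (f ⊗ₘ g) ≫ tensorμ U A' W B') ⊗ₘ h) =
      tensorμ A B U' W' ▷ (D ⊗ R') ≫ ((f ⊗ₘ g) ⊗ₘ h) ≫ tensorμ U A' W B' ▷ (R ⊗ D') := by
    rw [← tensorHom_id, ← tensorHom_id, tensorHom_comp_tensorHom, tensorHom_comp_tensorHom]
    simp
  rw [e1, e2]
  simp only [Category.assoc]
  rw [reassoc_of% associator_whiskerRight_tensorμ A B D U' W' R',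
    tensorμ_associator_inv_whiskerRight, ← associator_naturality_assoc, Iso.hom_inv_id_assoc]

theorem braiding_whiskerRight_tensorμ (A B U W : T) :
    (β_ A B).hom ▷ (W ⊗ U) ≫ tensorμ B A W U =
      (A ⊗ B) ◁ (β_ W U).hom ≫ tensorμ A B U W ≫ (β_ (A ⊗ U) (B ⊗ W)).hom := by
  rw [← tensorμ_braiding_braiding, tensorμ_tensorμ_assoc, MonoidalCategory.tensorHom_def',
    Category.assoc, ← whiskerLeft_comp_assoc, SymmetricCategory.symmetry]
  simp

theorem tensorμ_braiding_whiskerRight (A B U W : T) :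
    tensorμ B W A U ≫ (β_ B A).hom ▷ (W ⊗ U) =
      (β_ (B ⊗ W) (A ⊗ U)).hom ≫ tensorμ A U B W ≫ (A ⊗ B) ◁ (β_ U W).hom := by
  refine eq_of_inverses (braiding_whiskerRight_tensorμ A B U W) ?_ ?_
  · simp only [Category.assoc]
    rw [tensorμ_tensorμ_assoc, ← comp_whiskerRight, SymmetricCategory.symmetry, id_whiskerRight]
  · simp only [Category.assoc]
    rw [← whiskerLeft_comp_assoc, SymmetricCategory.symmetry, whiskerLeft_id, Category.id_comp,
      tensorμ_tensorμ_assoc, SymmetricCategory.symmetry]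

theorem braiding_tensorμ {A B A' B' U W U' W' : T} (f : A ⊗ U' ⟶ U ⊗ A') (g : B ⊗ W' ⟶ W ⊗ B') :
    (A ⊗ B) ◁ (β_ W' U').hom ≫ (tensorμ A B U' W' ≫ (f ⊗ₘ g) ≫ tensorμ U A' W B') ≫
      (U ⊗ W) ◁ (β_ A' B').hom =
    (β_ A B).hom ▷ (W' ⊗ U') ≫ (tensorμ B A W' U' ≫ (g ⊗ₘ f) ≫ tensorμ W B' U A') ≫
      (β_ W U).hom ▷ (B' ⊗ A') := by
  simp only [Category.assoc]
  rw [reassoc_of% braiding_whiskerRight_tensorμ A B U' W', tensorμ_braiding_whiskerRight,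
    BraidedCategory.braiding_naturality_assoc, SymmetricCategory.symmetry_assoc]

end DiffStep
end TensorCat


namespace TensorCat

/-! ### The symmetric monoidal category of formal differences -/

section DiffCategory

variable {T : Type u} [Category.{v} T] [MonoidalCategory T] [SymmetricCategory T]

/-- Formal differences `pos - neg` of objects, where `neg` admits traces. -/
structure Diff (𝒯 : TraceSystem T) where
  pos : T
  neg : T
  data : 𝒯.Data neg

namespace Diff

open TraceSystem

variable {𝒯 : TraceSystem T} {X Y Z W X' Y' Z' : Diff 𝒯}

-- A morphism `A - U ⟶ A' - U'` is what it becomes when the negative parts are moved to the other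
-- side.
@[ext]
structure Hom (X Y : Diff 𝒯) where
  val : X.pos ⊗ Y.neg ⟶ X.neg ⊗ Y.pos

instance : Category (Diff 𝒯) where
  Hom := Hom
  id X := ⟨(β_ X.pos X.neg).hom⟩
  comp {_ Y _} f g := ⟨diffComp Y.data f.val g.val⟩
  id_comp {X _} f := Hom.ext (braiding_diffComp X.data f.val)
  comp_id {_ Y} f := Hom.ext (diffComp_braiding Y.data f.val)
  assoc {_ Y Z _} f g h := Hom.ext (diffComp_assoc Y.data Z.data f.val g.val h.val)

@[ext] theorem hom_ext {f g : X ⟶ Y} (h : Hom.val f = Hom.val g) : f = g := Hom.ext h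

theorem id_val (X : Diff 𝒯) : Hom.val (𝟙 X) = (β_ X.pos X.neg).hom := rfl
theorem comp_val (f : X ⟶ Y) (g : Y ⟶ Z) :
    Hom.val (f ≫ g) = diffComp Y.data (Hom.val f) (Hom.val g) := rfl

/-- The morphism given by a pair of morphisms. -/
@[simps]
def pair (a : X.pos ⟶ Y.pos) (u : Y.neg ⟶ X.neg) : X ⟶ Y where
  val := (β_ X.pos Y.neg).hom ≫ (u ⊗ₘ a)

/-- The trace in this composition is removed by yanking. Since all structural isomorphisms are
pairs, coherence and naturality in the category of formal differences involve no traces. -/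
theorem comp_pair (f : X ⟶ Y) (a : Y.pos ⟶ Z.pos) (u : Z.neg ⟶ Y.neg) :
    Hom.val (f ≫ pair a u) = X.pos ◁ u ≫ Hom.val f ≫ X.neg ◁ a := by
  have h : Hom.val (pair a u) = Y.pos ◁ u ≫ (β_ Y.pos Y.neg).hom ≫ Y.neg ◁ a := by
    rw [pair_val, MonoidalCategory.tensorHom_def]; simp
  rw [comp_val, h, diffComp_whiskerLeft_pre, diffComp_whiskerLeft, diffComp_braiding]

theorem pair_comp (a : X.pos ⟶ Y.pos) (u : Y.neg ⟶ X.neg) (f : Y ⟶ Z) :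
    Hom.val (pair a u ≫ f) = a ▷ Z.neg ≫ Hom.val f ≫ u ▷ Z.pos := by
  have h : Hom.val (pair a u) = a ▷ Y.neg ≫ (β_ Y.pos Y.neg).hom ≫ u ▷ Y.pos := by
    rw [pair_val, MonoidalCategory.tensorHom_def']; simp
  rw [comp_val, h, whiskerRight_diffComp_pre, whiskerRight_diffComp, braiding_diffComp]

theorem pair_id : pair (𝟙 X.pos) (𝟙 X.neg) = 𝟙 X := by
  ext; simp [id_val]

@[simp]
theorem pair_comp_pair (a : X.pos ⟶ Y.pos) (u : Y.neg ⟶ X.neg) (b : Y.pos ⟶ Z.pos)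
    (w : Z.neg ⟶ Y.neg) : pair a u ≫ pair b w = pair (X := X) (Y := Z) (a ≫ b) (w ≫ u) := by
  ext
  rw [comp_pair, pair_val, pair_val, Category.assoc,
    BraidedCategory.braiding_naturality_right_assoc,
    MonoidalCategory.tensorHom_def, MonoidalCategory.tensorHom_def, comp_whiskerRight,
    MonoidalCategory.whiskerLeft_comp]
  simp only [Category.assoc]

/-- The isomorphism given by a pair of isomorphisms. -/
@[simps]
def pairIso (a : X.pos ≅ Y.pos) (u : Y.neg ≅ X.neg) : X ≅ Y where
  hom := pair a.hom u.hom
  inv := pair a.inv u.inv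
  hom_inv_id := by rw [pair_comp_pair]; simp [pair_id]
  inv_hom_id := by rw [pair_comp_pair]; simp [pair_id]

@[simps, reducible]
def tensor (X Y : Diff 𝒯) : Diff 𝒯 := ⟨X.pos ⊗ Y.pos, X.neg ⊗ Y.neg, 𝒯.mul X.data Y.data⟩

@[simps, reducible]
def unit (𝒯 : TraceSystem T) : Diff 𝒯 := ⟨𝟙_ T, 𝟙_ T, 𝒯.one⟩

def homTensor (f : X ⟶ Y) (g : X' ⟶ Y') : tensor X X' ⟶ tensor Y Y' where
  val := tensorμ X.pos X'.pos Y.neg Y'.neg ≫ (Hom.val f ⊗ₘ Hom.val g) ≫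
    tensorμ X.neg Y.pos X'.neg Y'.pos

instance : MonoidalCategoryStruct (Diff 𝒯) where
  tensorObj := tensor
  tensorUnit := unit 𝒯
  tensorHom := homTensor
  whiskerLeft X _ _ f := homTensor (𝟙 X) f
  whiskerRight f X := homTensor f (𝟙 X)
  associator _ _ _ := pairIso (α_ _ _ _) (α_ _ _ _).symm
  leftUnitor _ := pairIso (λ_ _) (λ_ _).symm
  rightUnitor _ := pairIso (ρ_ _) (ρ_ _).symm

@[simp] theorem tensorObj_pos : (X ⊗ Y).pos = X.pos ⊗ Y.pos := rfl
@[simp] theorem tensorObj_neg : (X ⊗ Y).neg = X.neg ⊗ Y.neg := rfl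
@[simp] theorem tensorUnit_pos : (𝟙_ (Diff 𝒯)).pos = 𝟙_ T := rfl
@[simp] theorem tensorUnit_neg : (𝟙_ (Diff 𝒯)).neg = 𝟙_ T := rfl
theorem tensorHom_val (f : X ⟶ Y) (g : X' ⟶ Y') : Hom.val (f ⊗ₘ g) =
  tensorμ X.pos X'.pos Y.neg Y'.neg ≫ (Hom.val f ⊗ₘ Hom.val g) ≫
    tensorμ X.neg Y.pos X'.neg Y'.pos := rfl
theorem associator_hom_def : (α_ X Y Z).hom =
  pair (X := (X ⊗ Y) ⊗ Z) (Y := X ⊗ (Y ⊗ Z)) (α_ _ _ _).hom (α_ _ _ _).inv := rfl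
theorem associator_inv_def : (α_ X Y Z).inv =
  pair (Y := (X ⊗ Y) ⊗ Z) (X := X ⊗ (Y ⊗ Z)) (α_ _ _ _).inv (α_ _ _ _).hom := rfl
theorem leftUnitor_hom_def : (λ_ X).hom = pair (X := 𝟙_ _ ⊗ X) (λ_ _).hom (λ_ _).inv := rfl
theorem rightUnitor_hom_def : (ρ_ X).hom = pair (X := X ⊗ 𝟙_ _) (ρ_ _).hom (ρ_ _).inv := rfl
theorem rightUnitor_inv_def : (ρ_ X).inv = pair (Y := X ⊗ 𝟙_ _) (ρ_ _).inv (ρ_ _).hom := rfl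

theorem pair_tensorHom_pair (a : X.pos ⟶ Y.pos) (u : Y.neg ⟶ X.neg) (b : X'.pos ⟶ Y'.pos)
    (w : Y'.neg ⟶ X'.neg) :
    pair a u ⊗ₘ pair b w = pair (X := X ⊗ X') (Y := Y ⊗ Y') (a ⊗ₘ b) (u ⊗ₘ w) := by
  ext
  rw [tensorHom_val, pair_val, pair_val, pair_val, ← tensorHom_comp_tensorHom, Category.assoc,
    tensorμ_natural, reassoc_of% tensorμ_comp_braiding, tensorμ_tensorμ_assoc]
  rfl

theorem tensorHom_id_id : (𝟙 X ⊗ₘ 𝟙 Y) = 𝟙 (X ⊗ Y) := by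
  rw [← pair_id, ← pair_id, pair_tensorHom_pair, ← pair_id]
  congr 1
  · exact id_tensorHom_id _ _
  · exact id_tensorHom_id _ _

/-- Only the interchange law uses traces. Pentagon and triangle are identities between pairs, and
the naturality axioms reduce to `comp_pair` and `pair_comp`. -/
instance : MonoidalCategory (Diff 𝒯) :=
  MonoidalCategory.ofTensorHom
    (id_tensorHom_id := fun _ _ => tensorHom_id_id)
    (id_tensorHom := fun _ _ _ _ => rfl)
    (tensorHom_id := fun _ _ => rfl)
    (tensorHom_comp_tensorHom := fun {X₁ Y₁ Z₁ X₂ Y₂ Z₂} f f' g g' => by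
      ext
      exact diffComp_tensor Y₁.data Y₂.data (Hom.val f) (Hom.val g) (Hom.val f') (Hom.val g'))
    (associator_naturality := fun f g h => by
      ext
      rw [associator_hom_def, associator_hom_def, comp_pair, pair_comp]
      exact associator_tensorμ_tensorμ _ _ _)
    (leftUnitor_naturality := fun f => by
      ext
      rw [leftUnitor_hom_def, leftUnitor_hom_def, comp_pair, pair_comp, tensorHom_val, id_val]
      dsimp only [tensorUnit_pos, tensorUnit_neg]
      rw [braiding_tensorUnit_tensorUnit]
      exact leftUnitor_tensorμ _)
    (rightUnitor_naturality := fun f => by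
      ext
      rw [rightUnitor_hom_def, rightUnitor_hom_def, comp_pair, pair_comp, tensorHom_val, id_val]
      dsimp only [tensorUnit_pos, tensorUnit_neg]
      rw [braiding_tensorUnit_tensorUnit]
      exact rightUnitor_tensorμ _)
    (pentagon := fun W X Y Z => by
      simp only [associator_hom_def, ← pair_id]
      rw [pair_tensorHom_pair, pair_tensorHom_pair, pair_comp_pair, pair_comp_pair, pair_comp_pair]
      congr 1 <;> simp)
    (triangle := fun X Y => by
      rw [associator_hom_def, leftUnitor_hom_def, rightUnitor_hom_def, ← pair_id, ← pair_id,
        pair_tensorHom_pair, pair_tensorHom_pair, pair_comp_pair]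
      congr 1 <;> simp)

instance : SymmetricCategory (Diff 𝒯) where
  braiding X Y := pairIso (X := X ⊗ Y) (Y := Y ⊗ X) (β_ _ _) (β_ _ _)
  braiding_naturality_right X {Y Z} f := by
    ext
    refine (comp_pair _ _ _).trans (Eq.trans ?_ (pair_comp _ _ _).symm)
    exact braiding_tensorμ _ _
  braiding_naturality_left f Z := by
    ext
    refine (comp_pair _ _ _).trans (Eq.trans ?_ (pair_comp _ _ _).symm)
    exact braiding_tensorμ _ _
  hexagon_forward X Y Z := by
    simp only [associator_hom_def, pairIso_hom, ← id_tensorHom, ← tensorHom_id, ← pair_id,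
      pair_tensorHom_pair, pair_comp_pair]
    congr 1
    · simp
    · simp
  hexagon_reverse X Y Z := by
    simp only [associator_inv_def, pairIso_hom, ← id_tensorHom, ← tensorHom_id, ← pair_id,
      pair_tensorHom_pair, pair_comp_pair]
    congr 1
    · simp
    · simp
  symmetry X Y := by
    refine (pair_comp_pair _ _ _ _).trans ?_
    rw [← pair_id]
    congr 1 <;> exact SymmetricCategory.symmetry _ _

theorem pair_whiskerRight (a : X.pos ⟶ Y.pos) (u : Y.neg ⟶ X.neg) (Z : Diff 𝒯) :
    pair a u ▷ Z = pair (X := X ⊗ Z) (Y := Y ⊗ Z) (a ▷ Z.pos) (u ▷ Z.neg) := by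
  rw [← tensorHom_id, ← pair_id, pair_tensorHom_pair, tensorHom_id, tensorHom_id]

theorem whiskerLeft_pair (a : X.pos ⟶ Y.pos) (u : Y.neg ⟶ X.neg) (Z : Diff 𝒯) :
    Z ◁ pair a u = pair (X := Z ⊗ X) (Y := Z ⊗ Y) (Z.pos ◁ a) (Z.neg ◁ u) := by
  rw [← id_tensorHom, ← pair_id, pair_tensorHom_pair, id_tensorHom, id_tensorHom]

variable (𝒯) in
/-- An object as a formal difference with trivial negative part. -/
@[simps, reducible]
def ofPos (A : T) : Diff 𝒯 := ⟨A, 𝟙_ T, 𝒯.one⟩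

variable (𝒯) in
/-- The embedding as formal differences with trivial negative part. -/
def incl : T ⥤ Diff 𝒯 where
  obj A := ofPos 𝒯 A
  map {A A'} a := pair (X := ofPos 𝒯 A) (Y := ofPos 𝒯 A') a (𝟙 _)
  map_id _ := pair_id
  map_comp _ _ := by simp

theorem incl_obj (A : T) : (incl 𝒯).obj A = ofPos 𝒯 A := rfl

theorem incl_map {A A' : T} (a : A ⟶ A') :
    (incl 𝒯).map a = pair (X := ofPos 𝒯 A) (Y := ofPos 𝒯 A') a (𝟙 _) := rfl

theorem incl_map_val {A A' : T} (a : A ⟶ A') :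
    Hom.val ((incl 𝒯).map a) = (ρ_ A).hom ≫ a ≫ (λ_ A').inv := by
  rw [incl_map, pair_val, id_tensorHom]
  dsimp
  rw [braiding_tensorUnit_right]
  simp
  rfl

instance : (incl 𝒯).Faithful where
  map_injective {A A'} a a' h := by
    have : (ρ_ A).hom ≫ a ≫ (λ_ A').inv = (ρ_ A).hom ≫ a' ≫ (λ_ A').inv :=
      (incl_map_val a).symm.trans ((congrArg Hom.val h).trans (incl_map_val a'))
    simpa using this

instance : (incl 𝒯).Full where
  map_surjective {A A'} f :=
    let g : A ⊗ 𝟙_ T ⟶ 𝟙_ T ⊗ A' := Hom.val f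
    ⟨(ρ_ A).inv ≫ g ≫ (λ_ A').hom, hom_ext ((incl_map_val _).trans
      (show (ρ_ A).hom ≫ ((ρ_ A).inv ≫ g ≫ (λ_ A').hom) ≫ (λ_ A').inv = g by simp))⟩

instance : (incl 𝒯).Monoidal := Functor.CoreMonoidal.toMonoidal
  { εIso := Iso.refl (𝟙_ (Diff 𝒯))
    μIso A B := pairIso (X := ofPos 𝒯 A ⊗ ofPos 𝒯 B) (Y := ofPos 𝒯 (A ⊗ B)) (Iso.refl _)
      (λ_ _).symm
    μIso_hom_natural_left {X Y} f Z := by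
      simp only [incl_map, incl_obj, pairIso_hom]
      rw [pair_whiskerRight, pair_comp_pair, pair_comp_pair]
      congr 1 <;> simp
    μIso_hom_natural_right {X Y} Z f := by
      simp only [incl_map, incl_obj, pairIso_hom]
      rw [whiskerLeft_pair, pair_comp_pair, pair_comp_pair]
      congr 1 <;> simp
    associativity X Y Z := by
      simp only [incl_map, incl_obj, pairIso_hom]
      rw [associator_hom_def, pair_whiskerRight, whiskerLeft_pair, pair_comp_pair, pair_comp_pair,
        pair_comp_pair, pair_comp_pair]
      congr 1
      · simp
      · simp [← unitors_equal]
        monoidal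
    left_unitality X := by
      simp only [incl_map, incl_obj, pairIso_hom, Iso.refl_hom]
      have h : 𝟙 (𝟙_ (Diff 𝒯)) ▷ ofPos 𝒯 X ≫ (pair (X := ofPos 𝒯 (𝟙_ T) ⊗ ofPos 𝒯 X)
        (Y := ofPos 𝒯 (𝟙_ T ⊗ X)) (𝟙 _) (λ_ _).inv ≫
          pair (X := ofPos 𝒯 (𝟙_ T ⊗ X)) (Y := ofPos 𝒯 X) (λ_ X).hom (𝟙 _)) =
            pair (X := 𝟙_ _ ⊗ ofPos 𝒯 X) (Y := ofPos 𝒯 X) (λ_ X).hom (λ_ (𝟙_ T)).inv := by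
        rw [id_whiskerRight, Category.id_comp, pair_comp_pair]
        congr 1 <;> simp
      exact h.symm
    right_unitality X := by
      simp only [incl_map, incl_obj, pairIso_hom, Iso.refl_hom]
      have h : ofPos 𝒯 X ◁ 𝟙 (𝟙_ (Diff 𝒯)) ≫ (pair (X := ofPos 𝒯 X ⊗ ofPos 𝒯 (𝟙_ T))
        (Y := ofPos 𝒯 (X ⊗ 𝟙_ T)) (𝟙 _) (λ_ _).inv ≫
          pair (X := ofPos 𝒯 (X ⊗ 𝟙_ T)) (Y := ofPos 𝒯 X) (ρ_ X).hom (𝟙 _)) =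
            pair (X := ofPos 𝒯 X ⊗ 𝟙_ _) (Y := ofPos 𝒯 X) (ρ_ X).hom (ρ_ (𝟙_ T)).inv := by
        rw [whiskerLeft_id, Category.id_comp, pair_comp_pair]
        congr 1 <;> simp [unitors_inv_equal]
      exact h.symm }

instance : (incl 𝒯).Braided where
  braided X Y := by
    have h : pair (X := ofPos 𝒯 X ⊗ ofPos 𝒯 Y) (Y := ofPos 𝒯 (X ⊗ Y)) (𝟙 _) (λ_ _).inv ≫
        pair (X := ofPos 𝒯 (X ⊗ Y)) (Y := ofPos 𝒯 (Y ⊗ X)) (β_ X Y).hom (𝟙 _) =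
        pair (X := ofPos 𝒯 X ⊗ ofPos 𝒯 Y) (Y := ofPos 𝒯 Y ⊗ ofPos 𝒯 X) (β_ X Y).hom
          (β_ (𝟙_ T) (𝟙_ T)).hom ≫
        pair (X := ofPos 𝒯 Y ⊗ ofPos 𝒯 X) (Y := ofPos 𝒯 (Y ⊗ X)) (𝟙 _) (λ_ _).inv := by
      rw [pair_comp_pair, pair_comp_pair]
      congr 1
      · simp
      · simp [← unitors_equal]
    exact h

end Diff
end DiffCategory
end TensorCat


namespace TensorCat

/-! ### Duals in the category of formal differences -/

section DiffDual

variable {T : Type u} [Category.{v} T] [MonoidalCategory T] [SymmetricCategory T]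

/-- By the first zigzag identity, the two sides of the second have the same transpose under `e`. So
injectivity of transposition suffices. -/
theorem zigzag_of_injective {D : Type u} [Category.{v} D] [MonoidalCategory D] {V W : D}
    (c : 𝟙_ D ⟶ V ⊗ W) (e : W ⊗ V ⟶ 𝟙_ D)
    (h : c ▷ V ≫ (α_ _ _ _).hom ≫ V ◁ e = (λ_ _).hom ≫ (ρ_ _).inv)
    (inj : ∀ g g' : W ⟶ 𝟙_ D ⊗ W, g ▷ V ≫ (α_ _ _ _).hom ≫ 𝟙_ D ◁ e =
      g' ▷ V ≫ (α_ _ _ _).hom ≫ 𝟙_ D ◁ e → g = g') :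
    W ◁ c ≫ (α_ _ _ _).inv ≫ e ▷ W = (ρ_ _).hom ≫ (λ_ _).inv := by
  have hz : (ρ_ W).inv ≫ W ◁ c ≫ (α_ _ _ _).inv ≫ e ▷ W ≫ (λ_ W).hom = 𝟙 W := by
    rw [← cancel_mono (λ_ W).inv]
    apply inj
    calc _ = 𝟙 _ ⊗≫ (W ◁ c) ▷ V ⊗≫ (e ▷ (W ⊗ V) ≫ 𝟙_ D ◁ e) ⊗≫ 𝟙 _ := by monoidal
      _ = 𝟙 _ ⊗≫ W ◁ (c ▷ V ≫ (α_ _ _ _).hom ≫ V ◁ e) ⊗≫ e ⊗≫ 𝟙 _ := by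
        rw [← whisker_exchange]; monoidal
      _ = _ := by rw [h]; monoidal
  rw [← cancel_epi (ρ_ W).inv, ← cancel_mono (λ_ W).hom]
  simpa using hz

theorem tensorμ_transpose_unit {X X' Y V : T} (g : X ⊗ (𝟙_ T ⊗ V) ⟶ X' ⊗ (Y ⊗ 𝟙_ T)) :
    (X ⊗ V) ◁ ((λ_ V).inv ≫ (ρ_ _).inv) ≫ tensorμ X V (𝟙_ T ⊗ V) (𝟙_ T) ≫
      (g ⊗ₘ (β_ V (𝟙_ T)).hom) ≫ tensorμ X' (Y ⊗ 𝟙_ T) (𝟙_ T) V =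
      ((α_ X V V).hom ≫ X ◁ (β_ V V).hom ≫ (α_ X V V).inv ≫
      (X ◁ (λ_ V).inv ≫ g ≫ X' ◁ (ρ_ Y).hom) ▷ V ≫ (α_ X' Y V).hom) ≫
      X' ◁ ((ρ_ Y).inv ▷ V) ≫ (ρ_ X').inv ▷ ((Y ⊗ 𝟙_ T) ⊗ V) := by
  rw [tensorμ, tensorμ, braiding_tensorUnit_right, braiding_tensorUnit_right,
    MonoidalCategory.tensorHom_def]
  calc _ = 𝟙 _ ⊗≫ X ◁ (V ◁ (λ_ V).inv ≫ (β_ V (𝟙_ T ⊗ V)).hom) ⊗≫ g ▷ V ⊗≫ 𝟙 _ := by monoidal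
    _ = _ := by rw [BraidedCategory.braiding_naturality_right]; monoidal

theorem tensorμ_transpose_counit (Y V : T) :
    ((α_ Y (𝟙_ T) V).hom ▷ (𝟙_ T ⊗ 𝟙_ T) ≫ (tensorμ Y (𝟙_ T ⊗ V) (𝟙_ T) (𝟙_ T) ≫
      ((β_ Y (𝟙_ T)).hom ⊗ₘ ((λ_ V).hom ≫ (ρ_ V).inv) ▷ 𝟙_ T) ≫
      tensorμ (𝟙_ T) Y (V ⊗ 𝟙_ T) (𝟙_ T)) ≫ (α_ (𝟙_ T) V (𝟙_ T)).inv ▷ (Y ⊗ 𝟙_ T)) ≫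
      ((ρ_ _).hom ≫ (λ_ V).hom) ▷ (Y ⊗ 𝟙_ T) =
    ((ρ_ Y).hom ▷ V) ▷ (𝟙_ T ⊗ 𝟙_ T) ≫ ((Y ⊗ V) ◁ (λ_ _).hom) ≫
      ((ρ_ (Y ⊗ V)).hom ≫ (β_ Y V).hom) ≫ V ◁ (ρ_ Y).inv := by
  rw [tensorμ, tensorμ, braiding_tensorUnit_right, braiding_tensorUnit_right,
    MonoidalCategory.tensorHom_def]
  calc _ = 𝟙 _ ⊗≫ ((β_ Y (V ⊗ 𝟙_ T)).hom ≫ (ρ_ V).hom ▷ Y) ⊗≫ 𝟙 _ := by monoidal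
    _ = _ := by rw [← BraidedCategory.braiding_naturality_right]; monoidal

namespace TraceSystem

variable {𝒯 : TraceSystem T} {U A A' : T} (d : 𝒯.Data U)

theorem tr_one_mul (f : A ⊗ (𝟙_ T ⊗ U) ⟶ A' ⊗ (𝟙_ T ⊗ U)) :
    𝒯.tr (𝒯.mul 𝒯.one d) f = 𝒯.tr d (A ◁ (λ_ U).inv ≫ f ≫ A' ◁ (λ_ U).hom) := by
  rw [tr_mul, tr_one, ← tr_post, ← tr_pre]
  congr 1
  monoidal

theorem tr_mul_one (f : A ⊗ (U ⊗ 𝟙_ T) ⟶ A' ⊗ (U ⊗ 𝟙_ T)) :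
    𝒯.tr (𝒯.mul d 𝒯.one) f = 𝒯.tr d (A ◁ (ρ_ U).inv ≫ f ≫ A' ◁ (ρ_ U).hom) := by
  rw [tr_mul, tr_one]
  congr 1
  monoidal

theorem diffComp_congr {A₁ A₂ U' U₁ U₂ : T} (d₁ : 𝒯.Data U₁) (φ : U ≅ U₁)
    (h : ∀ {X Y} (f : X ⊗ U₁ ⟶ Y ⊗ U₁), 𝒯.tr d₁ f = 𝒯.tr d (X ◁ φ.hom ≫ f ≫ Y ◁ φ.inv))
    (f : A ⊗ U₁ ⟶ U' ⊗ A₁) (g : A₁ ⊗ U₂ ⟶ U₁ ⊗ A₂) :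
    diffComp d₁ f g = diffComp d (A ◁ φ.hom ≫ f) (g ≫ φ.inv ▷ A₂) := by
  rw [diffComp, diffComp, trMid, trMid, h]
  congr 1
  have h1 : (A ⊗ U₂) ◁ φ.hom ≫ (α_ A U₂ U₁).hom ≫ A ◁ (β_ U₂ U₁).hom =
      (α_ A U₂ U).hom ≫ A ◁ (β_ U₂ U).hom ≫ A ◁ φ.hom ▷ U₂ := by
    rw [← MonoidalCategory.whiskerLeft_comp, ← BraidedCategory.braiding_naturality_right]
    monoidal
  have h2 : U' ◁ (β_ U₁ A₂).hom ≫ (α_ U' A₂ U₁).inv ≫ (U' ⊗ A₂) ◁ φ.inv =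
      U' ◁ φ.inv ▷ A₂ ≫ U' ◁ (β_ U A₂).hom ≫ (α_ U' A₂ U).inv := by
    rw [← whiskerLeft_comp_assoc, BraidedCategory.braiding_naturality_left]; simp
  simp only [Category.assoc, h2, reassoc_of% h1]
  monoidal

/-- Adding an idle copy of `V` to `g` and then tracing it out against a symmetry is one more
instance of yanking. -/
theorem diffComp_transpose {X X' V Y : T} (d : 𝒯.Data V) (g : X ⊗ V ⟶ X' ⊗ Y) :
    diffComp d ((α_ X V V).hom ≫ X ◁ (β_ V V).hom ≫ (α_ X V V).inv ≫ g ▷ V ≫ (α_ X' Y V).hom)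
      ((ρ_ (Y ⊗ V)).hom ≫ (β_ Y V).hom) = (ρ_ (X ⊗ V)).hom ≫ g := by
  have h := 𝒯.tr_post d g ((α_ X V V).hom ≫ X ◁ (β_ V V).hom ≫ (α_ X V V).inv)
  rw [← whiskerLeft_tr, yank, whiskerLeft_id, Category.id_comp] at h
  rw [diffComp, trMid]
  conv_rhs => rw [← h, ← tr_pre]
  congr 1
  rw [braiding_tensorUnit_left]
  simp only [Category.assoc]
  calc _ = 𝟙 _ ⊗≫ X ◁ (β_ V V).hom ⊗≫ g ▷ V ⊗≫ X' ◁ ((β_ Y V).hom ≫ (β_ V Y).hom) ⊗≫ 𝟙 _ := by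
        monoidal
    _ = _ := by rw [SymmetricCategory.symmetry]; monoidal

theorem diffComp_transpose_unit {X X' V Y : T} (d : 𝒯.Data V)
    (g : X ⊗ (𝟙_ T ⊗ V) ⟶ X' ⊗ (Y ⊗ 𝟙_ T)) :
    diffComp d
      (((α_ X V V).hom ≫ X ◁ (β_ V V).hom ≫ (α_ X V V).inv ≫
      (X ◁ (λ_ V).inv ≫ g ≫ X' ◁ (ρ_ Y).hom) ▷ V ≫ (α_ X' Y V).hom) ≫
      X' ◁ ((ρ_ Y).inv ▷ V) ≫ (ρ_ X').inv ▷ ((Y ⊗ 𝟙_ T) ⊗ V))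
      (((ρ_ Y).hom ▷ V) ▷ (𝟙_ T ⊗ 𝟙_ T) ≫ ((Y ⊗ V) ◁ (λ_ _).hom) ≫
      ((ρ_ (Y ⊗ V)).hom ≫ (β_ Y V).hom) ≫ V ◁ (ρ_ Y).inv) =
    (X ⊗ V) ◁ (λ_ _).hom ≫ (ρ_ _).hom ≫ X ◁ (λ_ V).inv ≫ g ≫ (ρ_ X').inv ▷ (Y ⊗ 𝟙_ T) := by
  rw [← Category.assoc, whiskerRight_diffComp, diffComp_slide_pos, ← comp_whiskerRight_assoc,
    ← comp_whiskerRight, Iso.inv_hom_id, id_whiskerRight, id_whiskerRight, Category.id_comp,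
    diffComp_whiskerLeft_pre, diffComp_whiskerLeft, diffComp_transpose]
  simp

end TraceSystem

namespace Diff

open TraceSystem

variable {𝒯 : TraceSystem T} {X Y : Diff 𝒯} {V : T} (d : 𝒯.Data V)

/-- An object as a formal difference with trivial positive part. -/
@[simps, reducible]
def ofNeg : Diff 𝒯 := ⟨𝟙_ T, V, d⟩

def coev : 𝟙_ (Diff 𝒯) ⟶ ofPos 𝒯 V ⊗ ofNeg d where
  val := 𝟙_ T ◁ ((λ_ V).hom ≫ (ρ_ V).inv)

def ev : ofNeg d ⊗ ofPos 𝒯 V ⟶ 𝟙_ (Diff 𝒯) where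
  val := ((λ_ V).hom ≫ (ρ_ V).inv) ▷ 𝟙_ T

theorem whiskerRight_ofPos_val {Y : T} (g : X ⟶ ofPos 𝒯 Y ⊗ ofNeg d) :
    (X.pos ⊗ V) ◁ ((λ_ V).inv ≫ (ρ_ _).inv) ≫ Hom.val (g ▷ ofPos 𝒯 V) =
      ((α_ X.pos V V).hom ≫ X.pos ◁ (β_ V V).hom ≫ (α_ X.pos V V).inv ≫
      (X.pos ◁ (λ_ V).inv ≫ Hom.val g ≫ X.neg ◁ (ρ_ Y).hom) ▷ V ≫ (α_ X.neg Y V).hom) ≫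
      X.neg ◁ ((ρ_ Y).inv ▷ V) ≫ (ρ_ X.neg).inv ▷ ((Y ⊗ 𝟙_ T) ⊗ V) := by
  rw [← tensorHom_id, tensorHom_val, id_val]
  exact tensorμ_transpose_unit (Hom.val g)

theorem whiskerLeft_ev_val (Y : T) :
    Hom.val ((α_ (ofPos 𝒯 Y) (ofNeg d) (ofPos 𝒯 V)).hom ≫ ofPos 𝒯 Y ◁ ev d) ≫
      ((ρ_ _).hom ≫ (λ_ V).hom) ▷ (Y ⊗ 𝟙_ T) =
    ((ρ_ Y).hom ▷ V) ▷ (𝟙_ T ⊗ 𝟙_ T) ≫ ((Y ⊗ V) ◁ (λ_ _).hom) ≫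
      ((ρ_ (Y ⊗ V)).hom ≫ (β_ Y V).hom) ≫ V ◁ (ρ_ Y).inv := by
  rw [associator_hom_def, pair_comp, ← id_tensorHom, tensorHom_val, id_val]
  exact tensorμ_transpose_counit Y V

/-- A morphism `X ⟶ Y - V` and its transpose `X ⊗ V ⟶ Y` have, up to unitors, the same underlying
morphism `X.pos ⊗ V ⟶ X.neg ⊗ Y`. This makes transposition visibly injective. -/
theorem transpose_val {Y : T} (g : X ⟶ ofPos 𝒯 Y ⊗ ofNeg d) :
    Hom.val (g ▷ ofPos 𝒯 V ≫ (α_ _ _ _).hom ≫ ofPos 𝒯 Y ◁ ev d) =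
      (X.pos ⊗ V) ◁ (λ_ _).hom ≫ (ρ_ _).hom ≫ X.pos ◁ (λ_ V).inv ≫ Hom.val g ≫
        (ρ_ X.neg).inv ▷ (Y ⊗ 𝟙_ T) := by
  rw [comp_val]
  refine (diffComp_congr d _ ((λ_ V).symm ≪≫ (ρ_ _).symm) (fun f => ?_) _ _).trans ?_
  · refine (tr_mul_one _ f).trans ((tr_one_mul _ _).trans ?_)
    simp
  · refine (congrArg₂ (diffComp d) (whiskerRight_ofPos_val d g) (whiskerLeft_ev_val d Y)).trans ?_
    exact diffComp_transpose_unit d (Hom.val g)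

theorem coev_ev : coev d ▷ ofPos 𝒯 V ≫ (α_ _ _ _).hom ≫ ofPos 𝒯 V ◁ ev d =
    (λ_ _).hom ≫ (ρ_ _).inv := by
  ext
  rw [transpose_val, leftUnitor_hom_def, rightUnitor_inv_def, pair_comp_pair, pair_val, coev]
  dsimp only [tensorUnit_pos, tensorUnit_neg, tensorObj_pos, tensorObj_neg, ofPos, ofNeg]
  rw [BraidedCategory.braiding_tensor_right_hom, braiding_tensorUnit_right]
  monoidal

theorem transpose_injective {Y : T} {g g' : X ⟶ ofPos 𝒯 Y ⊗ ofNeg d}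
    (h : g ▷ ofPos 𝒯 V ≫ (α_ _ _ _).hom ≫ ofPos 𝒯 Y ◁ ev d =
      g' ▷ ofPos 𝒯 V ≫ (α_ _ _ _).hom ≫ ofPos 𝒯 Y ◁ ev d) : g = g' := by
  ext
  have h' := congrArg Hom.val h
  rw [transpose_val, transpose_val] at h'
  have h2 : ∀ {k k' : X.pos ⊗ (𝟙_ T ⊗ V) ⟶ X.neg ⊗ (Y ⊗ 𝟙_ T)}, (X.pos ⊗ V) ◁ (λ_ _).hom ≫
      (ρ_ _).hom ≫ X.pos ◁ (λ_ V).inv ≫ k ≫ (ρ_ X.neg).inv ▷ (Y ⊗ 𝟙_ T) =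
      (X.pos ⊗ V) ◁ (λ_ _).hom ≫
      (ρ_ _).hom ≫ X.pos ◁ (λ_ V).inv ≫ k' ≫ (ρ_ X.neg).inv ▷ (Y ⊗ 𝟙_ T) → k = k' := by
    intro k k' h
    simpa only [cancel_epi, cancel_mono] using h
  exact h2 h'

/-- The object `0 - V` is dual to `V`. -/
instance exactPairing : ExactPairing (ofPos 𝒯 V) (ofNeg d) where
  coevaluation' := coev d
  evaluation' := ev d
  coevaluation_evaluation' := by
    exact zigzag_of_injective _ _ (coev_ev d) fun g g' h => transpose_injective d (Y := 𝟙_ T) h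
  evaluation_coevaluation' := coev_ev d

end Diff
end DiffDual
end TensorCat


namespace TensorCat

namespace PowMod

/-! ### Linear structure on `PowMod B` and the embedding of `C` in degree zero -/

section Linear

variable {C : Type u} [Category.{v} C] [Preadditive C] [MonoidalCategory C] [SymmetricCategory C]
  [MonoidalPreadditive C]
variable {B : C} [MonObj B] {M N P : PowMod B}

instance : Add (M ⟶ N) where
  add f g := ⟨Hom.hom f + Hom.hom g, fun h => by rw [f.eq_zero h, g.eq_zero h, add_zero],
    fun k hk => by
      rw [Preadditive.comp_add, f.act_comp k hk, g.act_comp k hk,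
        MonoidalPreadditive.add_whiskerRight, Preadditive.add_comp]⟩

instance : Zero (M ⟶ N) where
  zero := ⟨0, fun _ => rfl, fun k hk => by simp⟩

instance : Neg (M ⟶ N) where
  neg f := ⟨-Hom.hom f, fun h => by rw [f.eq_zero h, neg_zero], fun k hk => by
      have h : (-Hom.hom f) ▷ B = -(Hom.hom f ▷ B) := (tensorRight B).map_neg
      rw [Preadditive.comp_neg, f.act_comp k hk, ← Preadditive.neg_comp, h]⟩

@[simp] theorem add_hom (f g : M ⟶ N) : Hom.hom (f + g) = Hom.hom f + Hom.hom g := rfl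
@[simp] theorem zero_hom : Hom.hom (0 : M ⟶ N) = 0 := rfl
@[simp] theorem neg_hom (f : M ⟶ N) : Hom.hom (-f) = -Hom.hom f := rfl

instance : AddCommGroup (M ⟶ N) :=
  { AddGroup.ofLeftAxioms (fun f g h => hom_ext (add_assoc (Hom.hom f) (Hom.hom g) (Hom.hom h)))
      (fun f => hom_ext (zero_add (Hom.hom f))) (fun f => hom_ext (neg_add_cancel (Hom.hom f))) with
    add_comm := fun f g => hom_ext (add_comm (Hom.hom f) (Hom.hom g)) }

instance : Preadditive (PowMod B) where
  add_comp _ _ _ f f' g := hom_ext (Preadditive.add_comp _ _ _ (Hom.hom f) (Hom.hom f') (Hom.hom g))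
  comp_add _ _ _ f g g' := hom_ext (Preadditive.comp_add _ _ _ (Hom.hom f) (Hom.hom g) (Hom.hom g'))

instance : MonoidalPreadditive (PowMod B) where
  whiskerLeft_zero := hom_ext MonoidalPreadditive.whiskerLeft_zero
  zero_whiskerRight := hom_ext MonoidalPreadditive.zero_whiskerRight
  whiskerLeft_add _ _ := hom_ext (MonoidalPreadditive.whiskerLeft_add _ _)
  add_whiskerRight _ _ := hom_ext (MonoidalPreadditive.add_whiskerRight _ _)

variable {k : Type w} [Field k] [Linear k C] [MonoidalLinear k C]

instance : SMul k (M ⟶ N) where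
  smul r f := ⟨r • Hom.hom f, fun h => by rw [f.eq_zero h, smul_zero],
    fun i hi => by
      rw [Linear.comp_smul, f.act_comp i hi, MonoidalLinear.smul_whiskerRight, Linear.smul_comp]⟩

@[simp] theorem smul_hom (r : k) (f : M ⟶ N) : Hom.hom (r • f) = r • Hom.hom f := rfl

instance : Module k (M ⟶ N) where
  one_smul f := hom_ext (one_smul k (Hom.hom f))
  mul_smul r r' f := hom_ext (mul_smul r r' (Hom.hom f))
  smul_zero r := hom_ext (smul_zero r)
  smul_add r f g := hom_ext (smul_add r (Hom.hom f) (Hom.hom g))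
  add_smul r r' f := hom_ext (add_smul r r' (Hom.hom f))
  zero_smul f := hom_ext (zero_smul k (Hom.hom f))

instance : Linear k (PowMod B) where
  smul_comp _ _ _ r f g := hom_ext (Linear.smul_comp _ _ _ r (Hom.hom f) (Hom.hom g))
  comp_smul _ _ _ f r g := hom_ext (Linear.comp_smul _ _ _ (Hom.hom f) r (Hom.hom g))

instance : MonoidalLinear k (PowMod B) where
  whiskerLeft_smul _ _ _ r f := hom_ext (MonoidalLinear.whiskerLeft_smul _ r (Hom.hom f))
  smul_whiskerRight r _ _ f _ := hom_ext (MonoidalLinear.smul_whiskerRight r (Hom.hom f) _)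

variable {U : PowMod B} (c : 𝟙_ C ⟶ U.X) (e : U.X ⟶ 𝟙_ C)

theorem traceHom_add (f g : M ⊗ U ⟶ N ⊗ U) :
    traceHom c e (f + g) = traceHom c e f + traceHom c e g := by
  ext; simp

theorem traceHom_smul (r : k) (f : M ⊗ U ⟶ N ⊗ U) :
    traceHom c e (r • f) = r • traceHom c e f := by
  ext; simp

end Linear

section OfObj

variable {C : Type u} [Category.{v} C] [Preadditive C] [MonoidalCategory C] [SymmetricCategory C]
  [MonoidalPreadditive C]
variable (B : C) [MonObj B] {s : 𝟙_ C ⟶ B ⊗ B}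

/-- The base category as the degree zero part. -/
def degZero : C ⥤ PowMod B where
  obj X := ofObj B X
  map f := ⟨f, fun h => (h rfl).elim, fun k hk => (Nat.not_lt_zero k hk).elim⟩
  map_id _ := rfl
  map_comp _ _ := rfl

instance : (degZero B).Faithful where
  map_injective h := congrArg Hom.hom h

instance : (degZero B).Full where
  map_surjective f := ⟨Hom.hom f, rfl⟩

instance : (degZero B).Monoidal := Functor.CoreMonoidal.toMonoidal
  { εIso := Iso.refl (𝟙_ (PowMod B))
    μIso X Y := mkIso (M := ofObj B X ⊗ ofObj B Y) (N := ofObj B (X ⊗ Y)) (Iso.refl _) rfl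
      fun k hk => (Nat.not_lt_zero k hk).elim
    μIso_hom_natural_left {X Y} f Z := hom_ext
      (show f ▷ Z ≫ 𝟙 (Y ⊗ Z) = 𝟙 (X ⊗ Z) ≫ f ▷ Z by simp)
    μIso_hom_natural_right {X Y} Z f := hom_ext
      (show Z ◁ f ≫ 𝟙 (Z ⊗ Y) = 𝟙 (Z ⊗ X) ≫ Z ◁ f by simp)
    associativity X Y Z := hom_ext
      (show 𝟙 (X ⊗ Y) ▷ Z ≫ 𝟙 ((X ⊗ Y) ⊗ Z) ≫ (α_ X Y Z).hom =
        (α_ X Y Z).hom ≫ X ◁ 𝟙 (Y ⊗ Z) ≫ 𝟙 (X ⊗ (Y ⊗ Z)) by simp)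
    left_unitality X := hom_ext
      (show (λ_ X).hom = 𝟙 (𝟙_ C) ▷ X ≫ 𝟙 (𝟙_ C ⊗ X) ≫ (λ_ X).hom by simp)
    right_unitality X := hom_ext
      (show (ρ_ X).hom = X ◁ 𝟙 (𝟙_ C) ≫ 𝟙 (X ⊗ 𝟙_ C) ≫ (ρ_ X).hom by simp) }

/-- The functor `degZero` is compatible with the symmetries. -/
@[reducible]
def degZeroBraided (hs : IsSwap B s) :
    letI := symmetricCategory hs
    (degZero B).Braided :=
  letI := symmetricCategory hs
  { braided X Y := by
      have h : braidingHom hs (ofObj B X) (ofObj B Y) =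
          ⟨(β_ X Y).hom, fun h => (h rfl).elim, fun k hk => (Nat.not_lt_zero k hk).elim⟩ := by
        have h1 : (blockPerm 0 0)⁻¹ = 1 := by
          ext k
          simp [blockPerm, Equiv.Perm.inv_def]
        apply hom_ext
        change (β_ X Y).hom ≫ PowMod.sym s (ofObj B Y ⊗ ofObj B X) (blockPerm 0 0)⁻¹ = (β_ X Y).hom
        rw [h1, PowMod.sym_one hs]
        exact Category.comp_id _
      have h' : 𝟙 (X ⊗ Y) ≫ (β_ X Y).hom =
          Hom.hom (braidingHom hs (ofObj B X) (ofObj B Y)) ≫ 𝟙 (Y ⊗ X) := by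
        rw [h, Category.id_comp]
        exact (Category.comp_id _).symm
      exact hom_ext h' }

instance : (degZero B).Additive where
  map_add := rfl

instance {k : Type w} [Field k] [Linear k C] [MonoidalLinear k C] : (degZero B).Linear k where
  map_smul _ _ := rfl

end OfObj

end PowMod
end TensorCat


namespace TensorCat

/-! ### Linear structure on formal differences -/

section TensorLinear

variable {T : Type u} [Category.{v} T] [Preadditive T] [MonoidalCategory T] [MonoidalPreadditive T]
  {k : Type w} [Field k] [Linear k T] [MonoidalLinear k T] {X Y X' Y' : T}

theorem tensorHom_smul (r : k) (f : X ⟶ Y) (g : X' ⟶ Y') : f ⊗ₘ (r • g) = r • (f ⊗ₘ g) := by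
  simp [MonoidalCategory.tensorHom_def]

theorem smul_tensorHom (r : k) (f : X ⟶ Y) (g : X' ⟶ Y') : (r • f) ⊗ₘ g = r • (f ⊗ₘ g) := by
  simp [MonoidalCategory.tensorHom_def]

end TensorLinear

section DiffLinear

variable {T : Type u} [Category.{v} T] [Preadditive T] [MonoidalCategory T] [SymmetricCategory T]

/-- A trace system with additive traces. -/
class TraceSystem.Additive (𝒯 : TraceSystem T) : Prop where
  tr_add {U A A' : T} (d : 𝒯.Data U) (f g : A ⊗ U ⟶ A' ⊗ U) :
    𝒯.tr d (f + g) = 𝒯.tr d f + 𝒯.tr d g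

/-- A trace system with homogeneous traces. -/
class TraceSystem.Homogeneous (k : Type w) [Field k] [Linear k T] (𝒯 : TraceSystem T) : Prop where
  tr_smul {U A A' : T} (d : 𝒯.Data U) (r : k) (f : A ⊗ U ⟶ A' ⊗ U) :
    𝒯.tr d (r • f) = r • 𝒯.tr d f

open TraceSystem

variable {𝒯 : TraceSystem T}

section

variable [MonoidalPreadditive T] [𝒯.Additive] {A A₁ A₂ U U₁ U₂ : T} (d : 𝒯.Data U₁)

theorem add_diffComp (f f' : A ⊗ U₁ ⟶ U ⊗ A₁) (g : A₁ ⊗ U₂ ⟶ U₁ ⊗ A₂) :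
    diffComp d (f + f') g = diffComp d f g + diffComp d f' g := by
  simp only [diffComp, trMid, ← Additive.tr_add, MonoidalPreadditive.add_whiskerRight,
    Preadditive.add_comp, Preadditive.comp_add]

theorem diffComp_add (f : A ⊗ U₁ ⟶ U ⊗ A₁) (g g' : A₁ ⊗ U₂ ⟶ U₁ ⊗ A₂) :
    diffComp d f (g + g') = diffComp d f g + diffComp d f g' := by
  simp only [diffComp, trMid, ← Additive.tr_add, MonoidalPreadditive.whiskerLeft_add,
    Preadditive.add_comp, Preadditive.comp_add]

end

section

variable {k : Type w} [Field k] [Linear k T] [MonoidalPreadditive T] [MonoidalLinear k T]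
  [𝒯.Homogeneous k] {A A₁ A₂ U U₁ U₂ : T} (d : 𝒯.Data U₁) (r : k)

theorem smul_diffComp (f : A ⊗ U₁ ⟶ U ⊗ A₁) (g : A₁ ⊗ U₂ ⟶ U₁ ⊗ A₂) :
    diffComp d (r • f) g = r • diffComp d f g := by
  simp only [diffComp, trMid, ← Homogeneous.tr_smul, MonoidalLinear.smul_whiskerRight,
    Linear.smul_comp, Linear.comp_smul]

theorem diffComp_smul (f : A ⊗ U₁ ⟶ U ⊗ A₁) (g : A₁ ⊗ U₂ ⟶ U₁ ⊗ A₂) :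
    diffComp d f (r • g) = r • diffComp d f g := by
  simp only [diffComp, trMid, ← Homogeneous.tr_smul, MonoidalLinear.whiskerLeft_smul,
    Linear.smul_comp, Linear.comp_smul]

end

namespace Diff

variable {X Y Z X' Y' : Diff 𝒯}

/-- Morphisms of formal differences as morphisms of the base category. -/
@[simps]
def homEquiv : (X ⟶ Y) ≃ (X.pos ⊗ Y.neg ⟶ X.neg ⊗ Y.pos) where
  toFun := Hom.val
  invFun := Hom.mk
  left_inv _ := rfl
  right_inv _ := rfl

instance : AddCommGroup (X ⟶ Y) := homEquiv.addCommGroup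

@[simp] theorem add_val (f g : X ⟶ Y) : Hom.val (f + g) = Hom.val f + Hom.val g := rfl

variable [MonoidalPreadditive T]

instance [𝒯.Additive] : Preadditive (Diff 𝒯) where
  add_comp _ Y _ f f' g := hom_ext (add_diffComp Y.data (Hom.val f) (Hom.val f') (Hom.val g))
  comp_add _ Y _ f g g' := hom_ext (diffComp_add Y.data (Hom.val f) (Hom.val g) (Hom.val g'))

theorem tensorHom_add (f : X ⟶ Y) (g g' : X' ⟶ Y') : f ⊗ₘ (g + g') = f ⊗ₘ g + f ⊗ₘ g' :=
  hom_ext <| by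
    rw [add_val]
    simp only [tensorHom_val, add_val, MonoidalPreadditive.tensor_add, Preadditive.add_comp,
      Preadditive.comp_add]

theorem add_tensorHom (f f' : X ⟶ Y) (g : X' ⟶ Y') : (f + f') ⊗ₘ g = f ⊗ₘ g + f' ⊗ₘ g :=
  hom_ext <| by
    rw [add_val]
    simp only [tensorHom_val, add_val, MonoidalPreadditive.add_tensor, Preadditive.add_comp,
      Preadditive.comp_add]

instance [𝒯.Additive] : MonoidalPreadditive (Diff 𝒯) where
  whiskerLeft_zero {X Y Z} := by
    have h := tensorHom_add (𝟙 X) (0 : Y ⟶ Z) 0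
    rw [add_zero, left_eq_add] at h
    rw [← id_tensorHom, h]
  zero_whiskerRight {X Y Z} := by
    have h := add_tensorHom (0 : Y ⟶ Z) 0 (𝟙 X)
    rw [add_zero, left_eq_add] at h
    rw [← tensorHom_id, h]
  whiskerLeft_add f g := by
    rw [← id_tensorHom, ← id_tensorHom, ← id_tensorHom, tensorHom_add]
  add_whiskerRight f g := by
    rw [← tensorHom_id, ← tensorHom_id, ← tensorHom_id, add_tensorHom]

instance [𝒯.Additive] : (incl 𝒯).Additive where
  map_add {A A'} f g := hom_ext <| by
    rw [add_val, incl_map_val, incl_map_val, incl_map_val, Preadditive.add_comp,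
      Preadditive.comp_add]
    rfl

variable {k : Type w} [Field k] [Linear k T] [MonoidalLinear k T]

instance : Module k (X ⟶ Y) := homEquiv.module k

@[simp] theorem smul_val (r : k) (f : X ⟶ Y) : Hom.val (r • f) = r • Hom.val f := rfl

theorem tensorHom_smul (r : k) (f : X ⟶ Y) (g : X' ⟶ Y') : f ⊗ₘ (r • g) = r • (f ⊗ₘ g) :=
  hom_ext <| by
    rw [smul_val]
    simp only [tensorHom_val, smul_val, TensorCat.tensorHom_smul, Linear.smul_comp,
      Linear.comp_smul]

theorem smul_tensorHom (r : k) (f : X ⟶ Y) (g : X' ⟶ Y') : (r • f) ⊗ₘ g = r • (f ⊗ₘ g) :=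
  hom_ext <| by
    rw [smul_val]
    simp only [tensorHom_val, smul_val, TensorCat.smul_tensorHom, Linear.smul_comp,
      Linear.comp_smul]

variable [𝒯.Additive] [𝒯.Homogeneous k]

instance : Linear k (Diff 𝒯) where
  smul_comp _ Y _ r f g := hom_ext (smul_diffComp Y.data r (Hom.val f) (Hom.val g))
  comp_smul _ Y _ f r g := hom_ext (diffComp_smul Y.data r (Hom.val f) (Hom.val g))

instance : MonoidalLinear k (Diff 𝒯) where
  whiskerLeft_smul X Y Z r f := by
    rw [← id_tensorHom, ← id_tensorHom, tensorHom_smul]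
  smul_whiskerRight r Y Z f X := by
    rw [← tensorHom_id, ← tensorHom_id, smul_tensorHom]

instance : (incl 𝒯).Linear k where
  map_smul f r := hom_ext <| by
    rw [smul_val, incl_map_val, incl_map_val, Linear.smul_comp, Linear.comp_smul]
    rfl

end Diff

end DiffLinear

namespace PowMod

variable {C : Type u} [Category.{v} C] [Preadditive C] [MonoidalCategory C] [SymmetricCategory C]
  [MonoidalPreadditive C] {B : C} [MonObj B] {s : 𝟙_ C ⟶ B ⊗ B}

theorem additive_traceSystem (hs : IsSwap B s) :
    letI := symmetricCategory hs
    (traceSystem B s hs).Additive :=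
  letI := symmetricCategory hs
  ⟨fun d f g => traceHom_add d.cup d.cap f g⟩

theorem homogeneous_traceSystem (hs : IsSwap B s) (k : Type w) [Field k] [Linear k C]
    [MonoidalLinear k C] :
    letI := symmetricCategory hs
    (traceSystem B s hs).Homogeneous k :=
  letI := symmetricCategory hs
  ⟨fun d r f => traceHom_smul d.cup d.cap r f⟩

end PowMod

end TensorCat


namespace TensorCat

/-! ### Direct sums: the monoidal category of matrices -/

section MatCategory

variable {C : Type u} [Category.{v} C] [Preadditive C]

namespace Mat

variable {M N P Q M' N' P' : Mat_ C}

open Classical in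
/-- The matrix with entries `φ i` at `(i, e i)`. -/
noncomputable def mono (e : M.ι ≃ N.ι) (φ : ∀ i, M.X i ⟶ N.X (e i)) : M ⟶ N :=
  fun i j => if h : e i = j then φ i ≫ eqToHom (congrArg N.X h) else 0

open Classical in
/-- The matrix with entries `φ i` at `(e i, i)`. -/
noncomputable def epi (e : M.ι ≃ N.ι) (φ : ∀ i, N.X (e i) ⟶ M.X i) : N ⟶ M :=
  fun j i => if h : j = e i then eqToHom (congrArg N.X h) ≫ φ i else 0

section

variable (e : M.ι ≃ N.ι) (φ : ∀ i, M.X i ⟶ N.X (e i)) (ψ : ∀ i, N.X (e i) ⟶ M.X i)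

@[simp]
theorem mono_apply (i : M.ι) : mono e φ i (e i) = φ i := by
  simp [mono]

theorem mono_apply_of_ne {i : M.ι} {j : N.ι} (h : e i ≠ j) : mono e φ i j = 0 := by
  simp [mono, h]

@[simp]
theorem mono_comp_apply (f : N ⟶ P) (i : M.ι) (k : P.ι) :
    (mono e φ ≫ f) i k = φ i ≫ f (e i) k := by
  rw [Mat_.comp_apply, Finset.sum_eq_single (e i), mono_apply]
  · intro j _ h
    rw [mono_apply_of_ne _ _ h.symm, Limits.zero_comp]
  · simp

@[simp]
theorem comp_mono_apply (f : P ⟶ M) (k : P.ι) (i : M.ι) :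
    (f ≫ mono e φ) k (e i) = f k i ≫ φ i := by
  rw [Mat_.comp_apply, Finset.sum_eq_single i, mono_apply]
  · intro j _ h
    rw [mono_apply_of_ne _ _ (fun h' => h (e.injective h')), Limits.comp_zero]
  · simp

@[simp]
theorem epi_apply (i : M.ι) : epi e ψ (e i) i = ψ i := by
  simp [epi]

theorem epi_apply_of_ne {i : M.ι} {j : N.ι} (h : j ≠ e i) : epi e ψ j i = 0 := by
  simp [epi, h]

@[simp]
theorem comp_epi_apply (f : P ⟶ N) (k : P.ι) (i : M.ι) :
    (f ≫ epi e ψ) k i = f k (e i) ≫ ψ i := by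
  rw [Mat_.comp_apply, Finset.sum_eq_single (e i), epi_apply]
  · intro j _ h
    rw [epi_apply_of_ne _ _ h, Limits.comp_zero]
  · simp

theorem hom_ext_equiv {f g : P ⟶ N} (h : ∀ k i, f k (e i) = g k (e i)) : f = g :=
  Mat_.hom_ext _ _ fun k j => by
    obtain ⟨i, rfl⟩ := e.surjective j
    exact h k i

end

theorem id_eq_mono (M : Mat_ C) : 𝟙 M = mono (Equiv.refl _) fun i => 𝟙 (M.X i) := by
  refine hom_ext_equiv (Equiv.refl _) fun k i => ?_
  by_cases h : k = i
  · subst h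
    exact (Mat_.id_apply_self M k).trans (mono_apply (Equiv.refl _) (fun i => 𝟙 (M.X i)) k).symm
  · exact (Mat_.id_apply_of_ne M k i h).trans (mono_apply_of_ne (Equiv.refl _) _ h).symm

/-- All structural isomorphisms between matrix objects have one nonzero entry in each row and
column. This and `mono_tensorHom_mono` reduce their coherence to that of the entries. -/
theorem mono_comp_mono (e : M.ι ≃ N.ι) (φ : ∀ i, M.X i ⟶ N.X (e i)) (e' : N.ι ≃ P.ι)
    (ψ : ∀ i, N.X i ⟶ P.X (e' i)) :
    mono e φ ≫ mono e' ψ = mono (e.trans e') fun i => φ i ≫ ψ (e i) := by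
  refine hom_ext_equiv (e.trans e') fun k i => ?_
  rw [mono_comp_apply]
  by_cases h : k = i
  · subst h
    exact (congrArg _ (mono_apply e' ψ (e k))).trans (mono_apply (e.trans e')
      (fun i => φ i ≫ ψ (e i)) k).symm
  · have h' : (e.trans e') k ≠ (e.trans e') i := fun h' => h ((e.trans e').injective h')
    rw [mono_apply_of_ne (e.trans e') _ h', mono_apply_of_ne e' _ h', Limits.comp_zero]

/-- An isomorphism of matrices from isomorphisms of entries. -/
@[simps]
noncomputable def monoIso (e : M.ι ≃ N.ι) (φ : ∀ i, M.X i ≅ N.X (e i)) : M ≅ N where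
  hom := mono e fun i => (φ i).hom
  inv := epi e fun i => (φ i).inv
  hom_inv_id := by
    refine Mat_.hom_ext _ _ fun k i => ?_
    rw [comp_epi_apply]
    by_cases h : k = i
    · subst h
      rw [mono_apply, Iso.hom_inv_id, Mat_.id_apply_self]
    · rw [mono_apply_of_ne _ _ (fun h' => h (e.injective h')), Limits.zero_comp,
        Mat_.id_apply_of_ne _ _ _ h]
  inv_hom_id := by
    refine hom_ext_equiv e fun k i => ?_
    rw [comp_mono_apply]
    by_cases h : k = e i
    · subst h
      rw [epi_apply, Iso.inv_hom_id, Mat_.id_apply_self]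
    · rw [epi_apply_of_ne _ _ h, Limits.zero_comp, Mat_.id_apply_of_ne _ _ _ h]

variable [MonoidalCategory C] [MonoidalPreadditive C]

@[simps, reducible]
def tensor (M N : Mat_ C) : Mat_ C := ⟨M.ι × N.ι, fun p => M.X p.1 ⊗ N.X p.2⟩

variable (C) in
@[simps, reducible]
def unit : Mat_ C := ⟨PUnit, fun _ => 𝟙_ C⟩

def homTensor (f : M ⟶ N) (g : M' ⟶ N') : tensor M M' ⟶ tensor N N' :=
  fun p q => f p.1 q.1 ⊗ₘ g p.2 q.2

noncomputable instance : MonoidalCategoryStruct (Mat_ C) where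
  tensorObj := tensor
  tensorUnit := unit C
  tensorHom := homTensor
  whiskerLeft M _ _ f := homTensor (𝟙 M) f
  whiskerRight f M := homTensor f (𝟙 M)
  associator M N P := monoIso (M := tensor (tensor M N) P) (N := tensor M (tensor N P))
    (Equiv.prodAssoc _ _ _) fun i => α_ (M.X i.1.1) (N.X i.1.2) (P.X i.2)
  leftUnitor M := monoIso (M := tensor (unit C) M) (Equiv.punitProd _) fun i => λ_ (M.X i.2)
  rightUnitor M := monoIso (M := tensor M (unit C)) (Equiv.prodPUnit _) fun i => ρ_ (M.X i.1)

theorem tensorHom_apply (f : M ⟶ N) (g : M' ⟶ N') (p : M.ι × M'.ι) (q : N.ι × N'.ι) :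
    (f ⊗ₘ g : tensor M M' ⟶ tensor N N') p q = f p.1 q.1 ⊗ₘ g p.2 q.2 := rfl

theorem mono_tensorHom_mono (e : M.ι ≃ N.ι) (φ : ∀ i, M.X i ⟶ N.X (e i)) (e' : M'.ι ≃ N'.ι)
    (ψ : ∀ i, M'.X i ⟶ N'.X (e' i)) : mono e φ ⊗ₘ mono e' ψ =
      mono (M := tensor M M') (N := tensor N N') (Equiv.prodCongr e e')
        fun i => φ i.1 ⊗ₘ ψ i.2 := by
  refine hom_ext_equiv (M := tensor M M') (N := tensor N N') (Equiv.prodCongr e e') fun k i => ?_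
  rw [tensorHom_apply]
  by_cases h : k = i
  · subst h
    exact (congrArg₂ _ (mono_apply e φ _) (mono_apply e' ψ _)).trans
      (mono_apply (M := tensor M M') (N := tensor N N') (Equiv.prodCongr e e')
        (fun i => φ i.1 ⊗ₘ ψ i.2) k).symm
  · have h' : (Equiv.prodCongr e e') k ≠ (Equiv.prodCongr e e') i :=
      fun h' => h ((Equiv.prodCongr e e').injective h')
    rw [mono_apply_of_ne (M := tensor M M') (N := tensor N N') (Equiv.prodCongr e e') _ h']
    by_cases h1 : k.1 = i.1
    · have h2 : e' k.2 ≠ e' i.2 := fun h2 => h (Prod.ext h1 (e'.injective h2))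
      have := mono_apply_of_ne e' ψ h2
      exact (congrArg _ this).trans (MonoidalPreadditive.tensor_zero _)
    · have h2 : e k.1 ≠ e i.1 := fun h2 => h1 (e.injective h2)
      have := mono_apply_of_ne e φ h2
      exact (congrArg (· ⊗ₘ _) this).trans (MonoidalPreadditive.zero_tensor _)


section Structure

variable (M N P : Mat_ C)

def assocEquiv : (tensor (tensor M N) P).ι ≃ (tensor M (tensor N P)).ι := Equiv.prodAssoc _ _ _

def assocEntry (i : (tensor (tensor M N) P).ι) :
    (tensor (tensor M N) P).X i ⟶ (tensor M (tensor N P)).X (assocEquiv M N P i) :=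
  (α_ (M.X i.1.1) (N.X i.1.2) (P.X i.2)).hom

def leftUnitEquiv : (tensor (unit C) M).ι ≃ M.ι := Equiv.punitProd _

def leftUnitEntry (i : (tensor (unit C) M).ι) :
    (tensor (unit C) M).X i ⟶ M.X (leftUnitEquiv M i) := (λ_ (M.X i.2)).hom

def rightUnitEquiv : (tensor M (unit C)).ι ≃ M.ι := Equiv.prodPUnit _

def rightUnitEntry (i : (tensor M (unit C)).ι) :
    (tensor M (unit C)).X i ⟶ M.X (rightUnitEquiv M i) := (ρ_ (M.X i.1)).hom

theorem associator_hom_def : (α_ M N P).hom = mono (assocEquiv M N P) (assocEntry M N P) := rfl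

theorem leftUnitor_hom_def : (λ_ M).hom = mono (leftUnitEquiv M) (leftUnitEntry M) := rfl

theorem rightUnitor_hom_def : (ρ_ M).hom = mono (rightUnitEquiv M) (rightUnitEntry M) := rfl

end Structure

theorem id_tensorHom_id (M N : Mat_ C) : 𝟙 M ⊗ₘ 𝟙 N = 𝟙 (M ⊗ N) := by
  have h := mono_tensorHom_mono (Equiv.refl M.ι) (fun i => 𝟙 (M.X i)) (Equiv.refl N.ι)
    (fun i => 𝟙 (N.X i))
  refine (congrArg₂ _ (id_eq_mono M) (id_eq_mono N)).trans (h.trans ?_)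
  refine Eq.trans ?_ (id_eq_mono (tensor M N)).symm
  exact congrArg (mono (M := tensor M N) (N := tensor M N) (Equiv.refl _))
    (funext fun i => MonoidalCategory.id_tensorHom_id _ _)

theorem mono_tensorHom_id (e : M.ι ≃ N.ι) (φ : ∀ i, M.X i ⟶ N.X (e i)) (P : Mat_ C) :
    mono e φ ⊗ₘ 𝟙 P = mono (M := tensor M P) (N := tensor N P)
      (Equiv.prodCongr e (Equiv.refl _)) fun i => φ i.1 ▷ P.X i.2 := by
  have h := mono_tensorHom_mono e φ (Equiv.refl P.ι) (fun i => 𝟙 (P.X i))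
  refine (congrArg _ (id_eq_mono P)).trans (h.trans ?_)
  exact congrArg (mono (M := tensor M P) (N := tensor N P) (Equiv.prodCongr e (Equiv.refl _)))
    (funext fun i => tensorHom_id _ _)

theorem id_tensorHom_mono (e : M.ι ≃ N.ι) (φ : ∀ i, M.X i ⟶ N.X (e i)) (P : Mat_ C) :
    𝟙 P ⊗ₘ mono e φ = mono (M := tensor P M) (N := tensor P N)
      (Equiv.prodCongr (Equiv.refl _) e) fun i => P.X i.1 ◁ φ i.2 := by
  have h := mono_tensorHom_mono (Equiv.refl P.ι) (fun i => 𝟙 (P.X i)) e φ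
  refine (congrArg (· ⊗ₘ _) (id_eq_mono P)).trans (h.trans ?_)
  exact congrArg (mono (M := tensor P M) (N := tensor P N) (Equiv.prodCongr (Equiv.refl _) e))
    (funext fun i => id_tensorHom _ _)

noncomputable instance : MonoidalCategory (Mat_ C) :=
  MonoidalCategory.ofTensorHom
    (id_tensorHom_id := id_tensorHom_id)
    (id_tensorHom := fun _ _ _ _ => rfl)
    (tensorHom_id := fun _ _ => rfl)
    (tensorHom_comp_tensorHom := fun {X₁ Y₁ Z₁ X₂ Y₂ Z₂} f f' g g' => by
      refine Mat_.hom_ext _ _ fun p q => ?_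
      refine (Mat_.comp_apply (N := tensor Y₁ Y₂) _ _ p q).trans ?_
      refine Eq.trans ?_ (tensorHom_apply _ _ _ _).symm
      -- The entry of the composite is a sum over pairs of indices; by biadditivity of the tensor
      -- product it factors into the two sums.
      rw [Mat_.comp_apply, Mat_.comp_apply, sum_tensor]
      simp_rw [tensor_sum]
      rw [← Finset.univ_product_univ, Finset.sum_product]
      exact Finset.sum_congr rfl fun _ _ => Finset.sum_congr rfl fun _ _ =>
        tensorHom_comp_tensorHom _ _ _ _)
    (associator_naturality := fun {X₁ X₂ X₃ Y₁ Y₂ Y₃} f g h => by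
      rw [associator_hom_def, associator_hom_def]
      refine hom_ext_equiv (assocEquiv Y₁ Y₂ Y₃) fun k i => ?_
      refine (comp_mono_apply (assocEquiv Y₁ Y₂ Y₃) _ _ _ _).trans ?_
      refine Eq.trans ?_ (mono_comp_apply (assocEquiv X₁ X₂ X₃) _ _ _ _).symm
      exact associator_naturality _ _ _)
    (leftUnitor_naturality := fun {X Y} f => by
      rw [leftUnitor_hom_def, leftUnitor_hom_def]
      refine hom_ext_equiv (leftUnitEquiv Y) fun k i => ?_
      refine (comp_mono_apply (leftUnitEquiv Y) _ _ _ _).trans ?_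
      refine Eq.trans ?_
        (mono_comp_apply (leftUnitEquiv X) _ _ _ _).symm
      have h : (𝟙 (𝟙_ C) ⊗ₘ f k.2 i.2) ≫ (λ_ _).hom = (λ_ _).hom ≫ f k.2 i.2 := by simp
      refine Eq.trans ?_ h
      exact congrArg (fun a => (a ⊗ₘ f k.2 i.2) ≫ (λ_ (Y.X i.2)).hom)
        (Mat_.id_apply_self (unit C) PUnit.unit))
    (rightUnitor_naturality := fun {X Y} f => by
      rw [rightUnitor_hom_def, rightUnitor_hom_def]
      refine hom_ext_equiv (rightUnitEquiv Y) fun k i => ?_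
      refine (comp_mono_apply (rightUnitEquiv Y) _ _ _ _).trans ?_
      refine Eq.trans ?_
        (mono_comp_apply (rightUnitEquiv X) _ _ _ _).symm
      have h : (f k.1 i.1 ⊗ₘ 𝟙 (𝟙_ C)) ≫ (ρ_ _).hom = (ρ_ _).hom ≫ f k.1 i.1 := by simp
      refine Eq.trans ?_ h
      exact congrArg (fun a => (f k.1 i.1 ⊗ₘ a) ≫ (ρ_ (Y.X i.1)).hom)
        (Mat_.id_apply_self (unit C) PUnit.unit))
    (pentagon := fun W X Y Z => by
      simp only [associator_hom_def, mono_tensorHom_id, id_tensorHom_mono]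
      refine (congrArg _ (mono_comp_mono _ _ _ _)).trans ((mono_comp_mono _ _ _ _).trans
        (Eq.trans ?_ (mono_comp_mono _ _ _ _).symm))
      refine congrArg (mono (M := tensor (tensor (tensor W X) Y) Z)
        (N := tensor W (tensor X (tensor Y Z))) _) (funext fun i => ?_)
      exact MonoidalCategory.pentagon _ _ _ _)
    (triangle := fun X Y => by
      rw [associator_hom_def, leftUnitor_hom_def, rightUnitor_hom_def, mono_tensorHom_id,
        id_tensorHom_mono]
      refine (mono_comp_mono _ _ _ _).trans ?_
      refine congrArg (mono (M := tensor (tensor X (unit C)) Y)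
        (N := tensor X Y) _) (funext fun i => ?_)
      exact MonoidalCategory.triangle _ _)

end Mat
end MatCategory
end TensorCat


namespace TensorCat

/-! ### Linear structure and symmetry on matrices -/

section MatSymmetric

variable {C : Type u} [Category.{v} C] [Preadditive C]

namespace Mat

variable {M N P Q M' N' P' : Mat_ C} [MonoidalCategory C] [MonoidalPreadditive C]

instance : MonoidalPreadditive (Mat_ C) where
  whiskerLeft_zero := Mat_.hom_ext _ _ fun _ _ => MonoidalPreadditive.tensor_zero _
  zero_whiskerRight := Mat_.hom_ext _ _ fun _ _ => MonoidalPreadditive.zero_tensor _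
  whiskerLeft_add _ _ := Mat_.hom_ext _ _ fun _ _ => MonoidalPreadditive.tensor_add _ _ _
  add_whiskerRight _ _ := Mat_.hom_ext _ _ fun _ _ => MonoidalPreadditive.add_tensor _ _ _

section

variable {k : Type w} [Field k] [Linear k C]

instance : Module k (M ⟶ N) := inferInstanceAs <| Module k (∀ i j, M.X i ⟶ N.X j)

@[simp] theorem smul_apply (r : k) (f : M ⟶ N) (i : M.ι) (j : N.ι) : (r • f) i j = r • f i j := rfl

instance : Linear k (Mat_ C) where
  smul_comp _ _ _ r f g := Mat_.hom_ext _ _ fun i j => by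
    simp [Finset.smul_sum]
  comp_smul _ _ _ f r g := Mat_.hom_ext _ _ fun i j => by
    simp [Finset.smul_sum]

instance [MonoidalLinear k C] : MonoidalLinear k (Mat_ C) where
  whiskerLeft_smul _ _ _ _ _ := Mat_.hom_ext _ _ fun _ _ => tensorHom_smul _ _ _
  smul_whiskerRight _ _ _ _ _ := Mat_.hom_ext _ _ fun _ _ => smul_tensorHom _ _ _

instance : (Mat_.embedding C).Linear k where
  map_smul _ _ := rfl

end

def embeddingEquiv (X Y : C) : ((Mat_.embedding C).obj X).ι ≃ ((Mat_.embedding C).obj Y).ι :=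
  Equiv.refl _

def embeddingEntry {X Y : C} (f : X ⟶ Y) (i : ((Mat_.embedding C).obj X).ι) :
    ((Mat_.embedding C).obj X).X i ⟶ ((Mat_.embedding C).obj Y).X (embeddingEquiv X Y i) := f

theorem embedding_map {X Y : C} (f : X ⟶ Y) :
    (Mat_.embedding C).map f = mono (embeddingEquiv X Y) (embeddingEntry f) :=
  hom_ext_equiv (embeddingEquiv X Y) fun k _ =>
    (mono_apply (embeddingEquiv X Y) (embeddingEntry f) k).symm

def embeddingTensorEquiv (X Y : C) :
    (tensor ((Mat_.embedding C).obj X) ((Mat_.embedding C).obj Y)).ι ≃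
      ((Mat_.embedding C).obj (X ⊗ Y)).ι := Equiv.punitProd _

def embeddingTensorEntry (X Y : C) (i : (tensor ((Mat_.embedding C).obj X)
      ((Mat_.embedding C).obj Y)).ι) :
    (tensor ((Mat_.embedding C).obj X) ((Mat_.embedding C).obj Y)).X i ≅
      ((Mat_.embedding C).obj (X ⊗ Y)).X (embeddingTensorEquiv X Y i) := Iso.refl (X ⊗ Y)

noncomputable instance : (Mat_.embedding C).Monoidal := Functor.CoreMonoidal.toMonoidal
  { εIso := Iso.refl (𝟙_ (Mat_ C))
    μIso X Y := monoIso (embeddingTensorEquiv X Y) (embeddingTensorEntry X Y)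
    μIso_hom_natural_left {X Y} f Z := by
      rw [embedding_map, embedding_map, ← tensorHom_id, mono_tensorHom_id]
      refine (mono_comp_mono _ _ _ _).trans (Eq.trans ?_ (mono_comp_mono _ _ _ _).symm)
      refine congrArg (mono (M := tensor ((Mat_.embedding C).obj X) ((Mat_.embedding C).obj Z))
        (N := (Mat_.embedding C).obj (Y ⊗ Z)) _) (funext fun i => ?_)
      exact show f ▷ Z ≫ 𝟙 (Y ⊗ Z) = 𝟙 (X ⊗ Z) ≫ f ▷ Z by simp
    μIso_hom_natural_right {X Y} Z f := by
      rw [embedding_map, embedding_map, ← id_tensorHom, id_tensorHom_mono]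
      refine (mono_comp_mono _ _ _ _).trans (Eq.trans ?_ (mono_comp_mono _ _ _ _).symm)
      refine congrArg (mono (M := tensor ((Mat_.embedding C).obj Z) ((Mat_.embedding C).obj X))
        (N := (Mat_.embedding C).obj (Z ⊗ Y)) _) (funext fun i => ?_)
      exact show Z ◁ f ≫ 𝟙 (Z ⊗ Y) = 𝟙 (Z ⊗ X) ≫ Z ◁ f by simp
    associativity X Y Z := by
      rw [monoIso_hom, monoIso_hom, monoIso_hom, monoIso_hom, ← tensorHom_id, ← id_tensorHom,
        mono_tensorHom_id, id_tensorHom_mono, associator_hom_def, embedding_map]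
      refine (congrArg _ (mono_comp_mono _ _ _ _)).trans ((mono_comp_mono _ _ _ _).trans
        (Eq.trans ?_ ((congrArg _ (mono_comp_mono _ _ _ _)).trans (mono_comp_mono _ _ _ _)).symm))
      refine congrArg (mono (M := tensor (tensor ((Mat_.embedding C).obj X)
        ((Mat_.embedding C).obj Y)) ((Mat_.embedding C).obj Z))
        (N := (Mat_.embedding C).obj (X ⊗ (Y ⊗ Z))) _) (funext fun i => ?_)
      exact show 𝟙 (X ⊗ Y) ▷ Z ≫ 𝟙 ((X ⊗ Y) ⊗ Z) ≫ (α_ X Y Z).hom =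
        (α_ X Y Z).hom ≫ X ◁ 𝟙 (Y ⊗ Z) ≫ 𝟙 (X ⊗ (Y ⊗ Z)) by simp
    left_unitality X := by
      rw [leftUnitor_hom_def, Iso.refl_hom]
      refine Eq.trans ?_ ((congrArg₂ _ (id_whiskerRight (𝟙_ (Mat_ C)) _)
        (congrArg₂ _ rfl (embedding_map _))).trans (Category.id_comp _)).symm
      refine Eq.trans ?_ (mono_comp_mono _ _ _ _).symm
      refine congrArg (mono (M := tensor (unit C) ((Mat_.embedding C).obj X))
        (N := (Mat_.embedding C).obj X) _) (funext fun i => ?_)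
      exact show (λ_ X).hom = 𝟙 (𝟙_ C ⊗ X) ≫ (λ_ X).hom by simp
    right_unitality X := by
      rw [rightUnitor_hom_def, Iso.refl_hom]
      refine Eq.trans ?_ ((congrArg₂ _ (whiskerLeft_id _ (𝟙_ (Mat_ C)))
        (congrArg₂ _ rfl (embedding_map _))).trans (Category.id_comp _)).symm
      refine Eq.trans ?_ (mono_comp_mono _ _ _ _).symm
      refine congrArg (mono (M := tensor ((Mat_.embedding C).obj X) (unit C))
        (N := (Mat_.embedding C).obj X) _) (funext fun i => ?_)
      exact show (ρ_ X).hom = 𝟙 (X ⊗ 𝟙_ C) ≫ (ρ_ X).hom by simp }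

def assocInvEntry (M N P : Mat_ C) (i : (tensor M (tensor N P)).ι) :
    (tensor M (tensor N P)).X i ⟶ (tensor (tensor M N) P).X ((assocEquiv M N P).symm i) :=
  (α_ (M.X i.1) (N.X i.2.1) (P.X i.2.2)).inv

theorem associator_inv_eq (M N P : Mat_ C) :
    (α_ M N P).inv = mono (assocEquiv M N P).symm (assocInvEntry M N P) := by
  rw [← cancel_epi (α_ M N P).hom, Iso.hom_inv_id, associator_hom_def]
  refine Eq.trans (id_eq_mono (tensor (tensor M N) P)) (Eq.trans ?_ (mono_comp_mono _ _ _ _).symm)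
  refine congrArg (mono (M := tensor (tensor M N) P) (N := tensor (tensor M N) P) _)
    (funext fun i => ?_)
  exact (Iso.hom_inv_id (α_ _ _ _)).symm

variable [SymmetricCategory C]

def braidEquiv (M N : Mat_ C) : (tensor M N).ι ≃ (tensor N M).ι := Equiv.prodComm _ _

def braidEntry (M N : Mat_ C) (i : (tensor M N).ι) :
    (tensor M N).X i ≅ (tensor N M).X (braidEquiv M N i) := β_ (M.X i.1) (N.X i.2)

noncomputable instance : SymmetricCategory (Mat_ C) where
  braiding M N := monoIso (braidEquiv M N) (braidEntry M N)
  braiding_naturality_right X {Y Z} f := by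
    rw [monoIso_hom, monoIso_hom, ← id_tensorHom, ← tensorHom_id]
    refine hom_ext_equiv (braidEquiv X Z) fun k i => ?_
    refine (comp_mono_apply (braidEquiv X Z) _ _ _ _).trans ?_
    refine Eq.trans ?_ (mono_comp_apply (braidEquiv X Y) _ _ _ _).symm
    exact BraidedCategory.braiding_naturality _ _
  braiding_naturality_left {X Y} f Z := by
    rw [monoIso_hom, monoIso_hom, ← id_tensorHom, ← tensorHom_id]
    refine hom_ext_equiv (braidEquiv Y Z) fun k i => ?_
    refine (comp_mono_apply (braidEquiv Y Z) _ _ _ _).trans ?_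
    refine Eq.trans ?_ (mono_comp_apply (braidEquiv X Z) _ _ _ _).symm
    exact BraidedCategory.braiding_naturality _ _
  hexagon_forward X Y Z := by
    rw [monoIso_hom, monoIso_hom, monoIso_hom, ← tensorHom_id, ← id_tensorHom,
      mono_tensorHom_id, id_tensorHom_mono, associator_hom_def, associator_hom_def,
      associator_hom_def]
    refine (congrArg _ (mono_comp_mono _ _ _ _)).trans ((mono_comp_mono _ _ _ _).trans
        (Eq.trans ?_ ((congrArg _ (mono_comp_mono _ _ _ _)).trans (mono_comp_mono _ _ _ _)).symm))
    refine congrArg (mono (M := tensor (tensor X Y) Z) (N := tensor Y (tensor Z X)) _)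
      (funext fun i => ?_)
    exact BraidedCategory.hexagon_forward _ _ _
  hexagon_reverse X Y Z := by
    rw [monoIso_hom, monoIso_hom, monoIso_hom, ← tensorHom_id, ← id_tensorHom,
      mono_tensorHom_id, id_tensorHom_mono, associator_inv_eq, associator_inv_eq,
      associator_inv_eq]
    refine (congrArg _ (mono_comp_mono _ _ _ _)).trans ((mono_comp_mono _ _ _ _).trans
        (Eq.trans ?_ ((congrArg _ (mono_comp_mono _ _ _ _)).trans (mono_comp_mono _ _ _ _)).symm))
    refine congrArg (mono (M := tensor X (tensor Y Z)) (N := tensor (tensor Z X) Y) _)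
      (funext fun i => ?_)
    exact BraidedCategory.hexagon_reverse _ _ _
  symmetry X Y := by
    rw [monoIso_hom, monoIso_hom]
    refine (mono_comp_mono _ _ _ _).trans (Eq.trans ?_ (id_eq_mono (tensor X Y)).symm)
    refine congrArg (mono (M := tensor X Y) (N := tensor X Y) _) (funext fun i => ?_)
    exact SymmetricCategory.symmetry _ _

noncomputable instance : (Mat_.embedding C).Braided where
  braided X Y := by
    rw [embedding_map]
    refine (mono_comp_mono (embeddingTensorEquiv X Y) (fun i => (embeddingTensorEntry X Y i).hom)
      _ _).trans (Eq.trans ?_ (mono_comp_mono (braidEquiv _ _) (fun i => (braidEntry _ _ i).hom)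
        (embeddingTensorEquiv Y X) (fun i => (embeddingTensorEntry Y X i).hom)).symm)
    refine congrArg (mono (M := tensor ((Mat_.embedding C).obj X) ((Mat_.embedding C).obj Y))
      (N := (Mat_.embedding C).obj (Y ⊗ X)) _) (funext fun i => ?_)
    exact show 𝟙 (X ⊗ Y) ≫ (β_ X Y).hom = (β_ X Y).hom ≫ 𝟙 (Y ⊗ X) by simp

end Mat
end MatSymmetric
end TensorCat


namespace TensorCat

/-! ### Endomorphisms of the unit object -/

section UnitEnd

variable {k : Type w} [Field k] {C : Type u} [Category.{v} C] [Preadditive C] [Linear k C]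
  [MonoidalCategory C] {D : Type u₁} [Category.{v₁} D] [Preadditive D] [Linear k D]
  [MonoidalCategory D]

/-- The endomorphisms of the unit of `D` are those of `F (𝟙_ C)`, hence those of `𝟙_ C`, and the
identification is linear. -/
theorem bijective_algebraMap_of_fullyFaithful (F : C ⥤ D) [F.Monoidal] [F.Full] [F.Faithful]
    [F.Additive] [F.Linear k] (h : Function.Bijective (algebraMap k (End (𝟙_ C)))) :
    Function.Bijective (algebraMap k (End (𝟙_ D))) := by
  let c : F.obj (𝟙_ C) ≅ 𝟙_ D := (Functor.Monoidal.εIso F).symm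
  have hC (r : k) : algebraMap k (End (𝟙_ C)) r = r • 𝟙 (𝟙_ C) := rfl
  have hD (r : k) : algebraMap k (End (𝟙_ D)) r = r • 𝟙 (𝟙_ D) := rfl
  have e (r : k) : F.map (r • 𝟙 (𝟙_ C)) = c.hom ≫ (r • 𝟙 (𝟙_ D)) ≫ c.inv := by
    simp [F.map_smul]
  constructor
  · intro r r' hr
    rw [hD, hD] at hr
    apply h.1
    rw [hC, hC]
    apply F.map_injective
    rw [e, e]
    exact congrArg (fun x => c.hom ≫ x ≫ c.inv) hr
  · intro g
    obtain ⟨f, hf⟩ := F.map_surjective (c.hom ≫ (show 𝟙_ D ⟶ 𝟙_ D from g) ≫ c.inv)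
    obtain ⟨r, hr⟩ := h.2 f
    refine ⟨r, ?_⟩
    rw [hC] at hr
    rw [hD]
    have := (e r).symm.trans ((congrArg F.map hr).trans hf)
    exact (cancel_mono c.inv).1 ((cancel_epi c.hom).1 this)

end UnitEnd

/-! ### Restriction to a small additive tensor subcategory -/

section Codes

variable {C : Type u} [Category.{v} C] {E : Type u₁} [Category.{v} E]

/-- Names for the objects generated by the image of a functor and two further objects under
tensor products and finite direct sums. -/
inductive Code (G : C ⥤ E) (V W : E) : Type u
  | of (X : C)
  | left
  | right
  | unit
  | tensor (c d : Code G V W)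
  | zero
  | sum (c d : Code G V W)

namespace Code

variable [Preadditive E] [MonoidalCategory E] [Limits.HasZeroObject E]
  [Limits.HasBinaryBiproducts E]
variable {G : C ⥤ E} {V W : E}

open Limits in
open scoped ZeroObject in
/-- The object with a given name. -/
noncomputable def interp : Code G V W → E
  | of X => G.obj X
  | left => V
  | right => W
  | unit => 𝟙_ E
  | tensor c d => interp c ⊗ interp d
  | zero => 0
  | sum c d => interp c ⊞ interp d

/-- Morphisms are those between interpretations, so every structure and law is inherited from `E`.
The names form a type in the universe of the objects of `C`, even when the objects of `E` live in a
larger one. -/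
noncomputable instance : Category (Code G V W) where
  Hom c d := interp c ⟶ interp d
  id c := 𝟙 (interp c)
  comp {c d e} f g := (show interp c ⟶ interp e from
    (show interp c ⟶ interp d from f) ≫ (show interp d ⟶ interp e from g))
  id_comp {c d} f := Category.id_comp (X := interp c) (Y := interp d) f
  comp_id {c d} f := Category.comp_id (X := interp c) (Y := interp d) f
  assoc {a b c d} f g h :=
    Category.assoc (W := interp a) (X := interp b) (Y := interp c) (Z := interp d) f g h

variable {a b c d : Code G V W}

/-- The interpretation is fully faithful by definition. -/
def lift (f : interp c ⟶ interp d) : c ⟶ d := f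

/-- The interpretation of morphisms. -/
def val (f : c ⟶ d) : interp c ⟶ interp d := f

theorem hom_ext {f g : c ⟶ d} (h : val f = val g) : f = g := h

@[simps]
def liftIso (e : interp c ≅ interp d) : c ≅ d where
  hom := lift e.hom
  inv := lift e.inv
  hom_inv_id := hom_ext e.hom_inv_id
  inv_hom_id := hom_ext e.inv_hom_id

noncomputable instance : Preadditive (Code G V W) where
  homGroup c d := inferInstanceAs (AddCommGroup (interp c ⟶ interp d))
  add_comp _ _ _ f f' g := Preadditive.add_comp _ _ _ (val f) (val f') (val g)
  comp_add _ _ _ f g g' := Preadditive.comp_add _ _ _ (val f) (val g) (val g')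

noncomputable instance {k : Type w} [Field k] [Linear k E] : Linear k (Code G V W) where
  homModule c d := inferInstanceAs (Module k (interp c ⟶ interp d))
  smul_comp _ _ _ r f g := Linear.smul_comp _ _ _ r (val f) (val g)
  comp_smul _ _ _ f r g := Linear.comp_smul _ _ _ (val f) r (val g)

instance : Limits.HasFiniteBiproducts (Code G V W) := by
  open scoped ZeroObject in
  have h0 : Limits.IsZero (zero : Code G V W) := by
    rw [Limits.IsZero.iff_id_eq_zero]
    exact (Limits.IsZero.iff_id_eq_zero (0 : E)).1 (Limits.isZero_zero E)
  have : Limits.HasZeroObject (Code G V W) := ⟨_, h0⟩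
  have : Limits.HasBinaryBiproducts (Code G V W) := ⟨fun c d =>
    Limits.hasBinaryBiproduct_of_total
      { pt := sum c d
        fst := lift Limits.biprod.fst
        snd := lift Limits.biprod.snd
        inl := lift Limits.biprod.inl
        inr := lift Limits.biprod.inr
        inl_fst := Limits.biprod.inl_fst (X := interp c) (Y := interp d)
        inl_snd := Limits.biprod.inl_snd (X := interp c) (Y := interp d)
        inr_fst := Limits.biprod.inr_fst (X := interp c) (Y := interp d)
        inr_snd := Limits.biprod.inr_snd (X := interp c) (Y := interp d) }
      (Limits.biprod.total (X := interp c) (Y := interp d))⟩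
  have := hasFiniteProducts_of_has_binary_and_terminal (C := Code G V W)
  exact Limits.HasFiniteBiproducts.of_hasFiniteProducts

noncomputable instance : MonoidalCategoryStruct (Code G V W) where
  tensorObj := tensor
  tensorUnit := unit
  tensorHom {a b c d} f g := lift (c := tensor a c) (d := tensor b d) (val f ⊗ₘ val g)
  whiskerLeft a {b c} f := lift (c := tensor a b) (d := tensor a c) (interp a ◁ val f)
  whiskerRight {b c} f a := lift (c := tensor b a) (d := tensor c a) (val f ▷ interp a)
  associator a b c := liftIso (c := tensor (tensor a b) c) (d := tensor a (tensor b c))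
    (α_ (interp a) (interp b) (interp c))
  leftUnitor c := liftIso (c := tensor unit c) (λ_ (interp c))
  rightUnitor c := liftIso (c := tensor c unit) (ρ_ (interp c))

noncomputable instance : MonoidalCategory (Code G V W) where
  tensorHom_def f g := MonoidalCategory.tensorHom_def (val f) (val g)
  id_tensorHom_id c d := id_tensorHom_id (interp c) (interp d)
  tensorHom_comp_tensorHom f g f' g' := tensorHom_comp_tensorHom (val f) (val g) (val f') (val g')
  whiskerLeft_id c d := whiskerLeft_id (interp c) (interp d)
  id_whiskerRight c d := id_whiskerRight (interp c) (interp d)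
  associator_naturality f g h := associator_naturality (val f) (val g) (val h)
  leftUnitor_naturality f := leftUnitor_naturality (val f)
  rightUnitor_naturality f := rightUnitor_naturality (val f)
  pentagon a b c d := pentagon (interp a) (interp b) (interp c) (interp d)
  triangle a b := triangle (interp a) (interp b)

noncomputable instance [SymmetricCategory E] : SymmetricCategory (Code G V W) where
  braiding c d := liftIso (c := tensor c d) (d := tensor d c) (β_ (interp c) (interp d))
  braiding_naturality_right c _ _ f := BraidedCategory.braiding_naturality_right (interp c) (val f)
  braiding_naturality_left f c := BraidedCategory.braiding_naturality_left (val f) (interp c)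
  hexagon_forward a b c := BraidedCategory.hexagon_forward (interp a) (interp b) (interp c)
  hexagon_reverse a b c := BraidedCategory.hexagon_reverse (interp a) (interp b) (interp c)
  symmetry c d := SymmetricCategory.symmetry (interp c) (interp d)

instance [MonoidalPreadditive E] : MonoidalPreadditive (Code G V W) where
  whiskerLeft_zero {a b c} :=
    MonoidalPreadditive.whiskerLeft_zero (X := interp a) (Y := interp b) (Z := interp c)
  zero_whiskerRight {a b c} :=
    MonoidalPreadditive.zero_whiskerRight (X := interp a) (Y := interp b) (Z := interp c)
  whiskerLeft_add {a _ _} f g :=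
    MonoidalPreadditive.whiskerLeft_add (X := interp a) (val f) (val g)
  add_whiskerRight {a _ _} f g :=
    MonoidalPreadditive.add_whiskerRight (X := interp a) (val f) (val g)

instance {k : Type w} [Field k] [Linear k E] [MonoidalPreadditive E] [MonoidalLinear k E] :
    MonoidalLinear k (Code G V W) where
  whiskerLeft_smul a _ _ r f := MonoidalLinear.whiskerLeft_smul (interp a) r (val f)
  smul_whiskerRight r _ _ f a := MonoidalLinear.smul_whiskerRight r (val f) (interp a)

noncomputable instance [ExactPairing V W] :
    ExactPairing (left : Code G V W) (right : Code G V W) where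
  coevaluation' := lift (c := unit) (d := tensor left right) (η_ V W)
  evaluation' := lift (d := unit) (c := tensor right left) (ε_ V W)
  coevaluation_evaluation' := ExactPairing.coevaluation_evaluation V W
  evaluation_coevaluation' := ExactPairing.evaluation_coevaluation V W

variable (G V W) in
/-- The given functor, with values in the category of names. -/
noncomputable def functor : C ⥤ Code G V W where
  obj := of
  map f := lift (c := of _) (d := of _) (G.map f)
  map_id X := G.map_id X
  map_comp f g := G.map_comp f g

instance [G.Faithful] : (functor G V W).Faithful where
  map_injective h := G.map_injective h

instance [G.Full] : (functor G V W).Full where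
  map_surjective f := G.map_surjective f

instance [Preadditive C] [G.Additive] : (functor G V W).Additive where
  map_add {_ _ f g} := G.map_add (f := f) (g := g)

instance {k : Type w} [Field k] [Preadditive C] [Linear k C] [Linear k E] [G.Linear k] :
    (functor G V W).Linear k where
  map_smul f r := G.map_smul r f

variable [MonoidalCategory C]

open Functor.LaxMonoidal in
noncomputable instance [G.Monoidal] : (functor G V W).Monoidal := Functor.CoreMonoidal.toMonoidal
  { εIso := liftIso (c := unit) (d := of (𝟙_ C)) (Functor.Monoidal.εIso G)
    μIso X Y := liftIso (c := tensor (of X) (of Y)) (d := of (X ⊗ Y)) (Functor.Monoidal.μIso G X Y)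
    μIso_hom_natural_left f Z := μ_natural_left G f Z
    μIso_hom_natural_right Z f := μ_natural_right G Z f
    associativity X Y Z := Functor.LaxMonoidal.associativity G X Y Z
    left_unitality X := Functor.LaxMonoidal.left_unitality G X
    right_unitality X := Functor.LaxMonoidal.right_unitality G X }

noncomputable instance [SymmetricCategory C] [SymmetricCategory E] [G.Braided] :
    (functor G V W).Braided where
  braided X Y := Functor.LaxBraided.braided (F := G) X Y

end Code

/-- A fully faithful tensor functor splitting an algebra can be corestricted to a small additive
tensor subcategory. -/
theorem splitsInFullyFaithfulExtension_of_functor {k : Type w} [Field k] [Preadditive C]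
    [Linear k C] [MonoidalCategory C] [SymmetricCategory C] [IsTensorCategory k C]
    [Preadditive E] [Linear k E] [MonoidalCategory E] [SymmetricCategory E]
    [MonoidalPreadditive E] [MonoidalLinear k E] [Limits.HasFiniteBiproducts E]
    (G : C ⥤ E) [G.Braided] [G.Additive] [G.Linear k] [G.Full] [G.Faithful] {B : Mon C}
    (h : IsSplit (G.mapMon.obj B)) :
    SplitsInFullyFaithfulExtension.{w, v, u, v, u} k B := by
  obtain ⟨V, W, p, ⟨e⟩⟩ := h
  have := Limits.hasBinaryBiproducts_of_finite_biproducts E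
  have hb := bijective_algebraMap_of_fullyFaithful (k := k) (Code.functor G V W)
    IsTensorCategory.bijective_algebraMap_end_unit
  refine ⟨Code G V W, inferInstance, inferInstance, inferInstance, inferInstance, inferInstance,
    { bijective_algebraMap_end_unit := hb }, Code.functor G V W, inferInstance, inferInstance,
    inferInstance, inferInstance, inferInstance, .left, .right, inferInstance, ⟨?_⟩⟩
  have h1 : e.hom.hom ≫ e.inv.hom = 𝟙 _ := congrArg Mon.Hom.hom e.hom_inv_id
  have h2 : e.inv.hom ≫ e.hom.hom = 𝟙 _ := congrArg Mon.Hom.hom e.inv_hom_id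
  let i : V ⊗ W ⟶ G.obj B.X := e.inv.hom
  exact
    { hom := Mon.Hom.mk' (M := (Code.functor G V W).mapMon.obj B) (N := internalEnd (C := Code G V W) .left .right)
        (Code.lift (c := .of B.X) (d := .tensor .left .right) e.hom.hom)
        (IsMonHom.one_hom (f := e.hom.hom)) (IsMonHom.mul_hom (f := e.hom.hom))
      inv := Mon.Hom.mk' (N := (Code.functor G V W).mapMon.obj B) (M := internalEnd (C := Code G V W) .left .right)
        (Code.lift (G := G) (V := V) (W := W) (c := .tensor .left .right) (d := .of B.X) i)
        (IsMonHom.one_hom (f := e.inv.hom)) (IsMonHom.mul_hom (f := e.inv.hom))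
      hom_inv_id := Mon.Hom.ext h1
      inv_hom_id := Mon.Hom.ext h2 }

end Codes
end TensorCat


namespace TensorCat

/-! ### Monoidal functors preserve split algebras -/

section MapSplit

variable {C : Type u} [Category.{v} C] [MonoidalCategory C] {D : Type u₁} [Category.{v₁} D]
  [MonoidalCategory D]

open Functor.LaxMonoidal Functor.OplaxMonoidal

/-- Monoidal functors preserve dualities. -/
@[reducible]
def mapExactPairing (F : C ⥤ D) [F.Monoidal] (V W : C) [ExactPairing V W] :
    ExactPairing (F.obj V) (F.obj W) where
  coevaluation' := ε F ≫ F.map (η_ V W) ≫ δ F V W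
  evaluation' := Functor.LaxMonoidal.μ F W V ≫ F.map (ε_ V W) ≫ Functor.OplaxMonoidal.η F
  coevaluation_evaluation' := by
    have h := congrArg F.map (ExactPairing.coevaluation_evaluation V W)
    simp only [Functor.map_comp, Functor.Monoidal.map_whiskerLeft,
      Functor.Monoidal.map_whiskerRight, Functor.Monoidal.map_associator_inv,
      Functor.Monoidal.map_rightUnitor, Functor.Monoidal.map_leftUnitor_inv, Category.assoc,
      Functor.Monoidal.μ_δ_assoc] at h
    have h' := (F.obj W ◁ ε F ≫ Functor.LaxMonoidal.μ F _ _) ≫= h =≫ (δ F _ _ ≫ Functor.OplaxMonoidal.η F ▷ F.obj W)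
    simp only [Category.assoc, Functor.Monoidal.μ_δ_assoc, Functor.Monoidal.whiskerLeft_ε_η_assoc,
      Functor.Monoidal.whiskerRight_ε_η, Category.comp_id] at h'
    simpa only [MonoidalCategory.whiskerLeft_comp, comp_whiskerRight, Category.assoc] using h'
  evaluation_coevaluation' := by
    have h := congrArg F.map (ExactPairing.evaluation_coevaluation V W)
    simp only [Functor.map_comp, Functor.Monoidal.map_whiskerLeft,
      Functor.Monoidal.map_whiskerRight, Functor.Monoidal.map_associator,
      Functor.Monoidal.map_rightUnitor_inv, Functor.Monoidal.map_leftUnitor, Category.assoc,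
      Functor.Monoidal.μ_δ_assoc] at h
    have h' := (ε F ▷ F.obj V ≫ Functor.LaxMonoidal.μ F _ _) ≫= h =≫ (δ F _ _ ≫ F.obj V ◁ Functor.OplaxMonoidal.η F)
    simp only [Category.assoc, Functor.Monoidal.μ_δ_assoc, Functor.Monoidal.whiskerRight_ε_η_assoc,
      Functor.Monoidal.whiskerLeft_ε_η, Category.comp_id] at h'
    simpa only [MonoidalCategory.whiskerLeft_comp, comp_whiskerRight, Category.assoc] using h'

theorem IsSplit.of_iso {A A' : Mon C} (e : A' ≅ A) (h : IsSplit A) : IsSplit A' := by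
  obtain ⟨V, W, p, ⟨f⟩⟩ := h
  exact ⟨V, W, p, ⟨e ≪≫ f⟩⟩

theorem IsSplit.map (F : C ⥤ D) [F.Monoidal] {A : Mon C} (h : IsSplit A) :
    IsSplit (F.mapMon.obj A) := by
  obtain ⟨V, W, p, ⟨f⟩⟩ := h
  refine IsSplit.of_iso (F.mapMon.mapIso f) ⟨F.obj V, F.obj W, mapExactPairing F V W, ⟨?_⟩⟩
  letI := mapExactPairing F V W
  refine Mon.mkIso (M := F.mapMon.obj (internalEnd V W)) (N := internalEnd (F.obj V) (F.obj W))
    (Functor.Monoidal.μIso F V W).symm ?_ ?_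
  · change (ε F ≫ F.map (η_ V W)) ≫ δ F V W = ε F ≫ F.map (η_ V W) ≫ δ F V W
    rw [Category.assoc]
  · change (Functor.LaxMonoidal.μ F (V ⊗ W) (V ⊗ W) ≫ F.map ((α_ V W (V ⊗ W)).hom ≫
      V ◁ ((α_ W V W).inv ≫ ε_ V W ▷ W ≫ (λ_ W).hom))) ≫ δ F V W =
      (δ F V W ⊗ₘ δ F V W) ≫ (α_ (F.obj V) (F.obj W) (F.obj V ⊗ F.obj W)).hom ≫
        F.obj V ◁ ((α_ (F.obj W) (F.obj V) (F.obj W)).inv ≫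
          (Functor.LaxMonoidal.μ F W V ≫ F.map (ε_ V W) ≫ Functor.OplaxMonoidal.η F) ▷ F.obj W ≫ (λ_ (F.obj W)).hom)
    rw [MonoidalCategory.tensorHom_def]
    simp only [Functor.map_comp, Functor.Monoidal.map_whiskerLeft,
      Functor.Monoidal.map_whiskerRight, Functor.Monoidal.map_associator,
      Functor.Monoidal.map_associator_inv, Functor.Monoidal.map_leftUnitor, Category.assoc,
      Functor.Monoidal.μ_δ_assoc, Functor.Monoidal.μ_δ, MonoidalCategory.whiskerLeft_comp,
      comp_whiskerRight, Functor.Monoidal.whiskerLeft_μ_δ_assoc, Category.comp_id,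
      Iso.inv_hom_id_assoc, tensor_whiskerLeft]

end MapSplit
end TensorCat


namespace TensorCat

/-! ### Recognising an internal endomorphism algebra by its action -/

section InternalEndAction

variable {C : Type u} [Category.{v} C] [MonoidalCategory C]

section

variable (V W : C) [ExactPairing V W]

/-- The action of the internal endomorphism algebra. -/
def endAction : (V ⊗ W) ⊗ V ⟶ V := (α_ V W V).hom ≫ V ◁ ε_ V W ≫ (ρ_ V).hom

/-- The product of the internal endomorphism algebra. -/
def endMul : (V ⊗ W) ⊗ (V ⊗ W) ⟶ V ⊗ W :=
  (α_ V W (V ⊗ W)).hom ≫ V ◁ ((α_ W V W).inv ≫ ε_ V W ▷ W ≫ (λ_ W).hom)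

theorem one_endAction : η_ V W ▷ V ≫ endAction V W = (λ_ V).hom := by
  rw [endAction, ExactPairing.evaluation_coevaluation_assoc]
  simp

theorem mul_endAction : endMul V W ▷ V ≫ endAction V W =
    (α_ (V ⊗ W) (V ⊗ W) V).hom ≫ (V ⊗ W) ◁ endAction V W ≫ endAction V W := by
  calc _ = 𝟙 _ ⊗≫ V ◁ (ε_ V W ▷ (W ⊗ V) ≫ 𝟙_ C ◁ ε_ V W) ⊗≫ 𝟙 _ := by
        rw [endAction, endMul]; monoidal
    _ = _ := by rw [← whisker_exchange, endAction]; monoidal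

variable {V W} {X : C}

theorem tensorRightHomEquiv_symm_eq (g : X ⟶ V ⊗ W) :
    (tensorRightHomEquiv X V W V).symm g = g ▷ V ≫ endAction V W := by
  rw [endAction]; rfl

theorem bijective_endAction :
    Function.Bijective fun g : X ⟶ V ⊗ W => g ▷ V ≫ endAction V W := by
  simp only [← tensorRightHomEquiv_symm_eq]
  exact (tensorRightHomEquiv X V W V).symm.bijective

end

/-- An algebra acting on a rigid object like the internal endomorphisms is split. -/
theorem isSplit_of_action (A : Mon C) (V W : C) [ExactPairing V W] (l : A.X ⊗ V ⟶ V)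
    (h1 : η[A.X] ▷ V ≫ l = (λ_ V).hom)
    (hm : μ[A.X] ▷ V ≫ l = (α_ A.X A.X V).hom ≫ A.X ◁ l ≫ l)
    (hl : ∀ X : C, Function.Bijective fun g : X ⟶ A.X => g ▷ V ≫ l) : IsSplit A := by
  obtain ⟨f, hf⟩ := (bijective_endAction (W := W)).2 l
  dsimp only at hf
  -- Here `f` is the transpose of the action `l`. Composing with `f` corresponds, under
  -- transposition, to the assumed bijection, so `f` is invertible by Yoneda.
  have : IsIso f := isIso_of_yoneda_map_bijective f fun X => by
    have h : (fun g : X ⟶ A.X => g ▷ V ≫ l) =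
        (fun g : X ⟶ V ⊗ W => g ▷ V ≫ endAction V W) ∘ fun g : X ⟶ A.X => g ≫ f := by
      funext g
      simp [← hf]
    have h' := hl X
    rw [h] at h'
    exact (Function.Bijective.of_comp_iff' bijective_endAction _).1 h'
  let e : A.X ≅ V ⊗ W := asIso f
  refine ⟨V, W, inferInstance, ⟨Mon.mkIso (N := internalEnd V W) e ?_ ?_⟩⟩
  · apply bijective_endAction.1
    change (η[A.X] ≫ f) ▷ V ≫ endAction V W = η_ V W ▷ V ≫ endAction V W
    rw [one_endAction, comp_whiskerRight, Category.assoc, hf, h1]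
  · apply bijective_endAction.1
    change (μ[A.X] ≫ f) ▷ V ≫ endAction V W = ((f ⊗ₘ f) ≫ endMul V W) ▷ V ≫ endAction V W
    rw [comp_whiskerRight, Category.assoc, hf, comp_whiskerRight, Category.assoc, mul_endAction,
      hm, MonoidalCategory.tensorHom_def']
    calc _ = (α_ _ _ _).hom ≫ A.X ◁ (f ▷ V ≫ endAction V W) ≫ f ▷ V ≫ endAction V W := by rw [hf]
      _ = 𝟙 _ ⊗≫ A.X ◁ f ▷ V ⊗≫ (A.X ◁ endAction V W ≫ f ▷ V) ≫ endAction V W := by monoidal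
      _ = _ := by rw [whisker_exchange]; monoidal

section

variable {D : Type u₁} [Category.{v₁} D] [MonoidalCategory D] (F : C ⥤ D) [F.Monoidal]
  (A : Mon C) {V : C} {l : A.X ⊗ V ⟶ V}

open Functor.LaxMonoidal

theorem one_map_action (h1 : η[A.X] ▷ V ≫ l = (λ_ V).hom) :
    η[(F.mapMon.obj A).X] ▷ F.obj V ≫ Functor.LaxMonoidal.μ F A.X V ≫ F.map l =
      (λ_ (F.obj V)).hom := by
  change (ε F ≫ F.map η[A.X]) ▷ F.obj V ≫ Functor.LaxMonoidal.μ F A.X V ≫ F.map l = _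
  rw [comp_whiskerRight, Category.assoc, μ_natural_left_assoc, ← F.map_comp, h1,
    ← Functor.LaxMonoidal.left_unitality]

theorem mul_map_action (hm : μ[A.X] ▷ V ≫ l = (α_ A.X A.X V).hom ≫ A.X ◁ l ≫ l) :
    μ[(F.mapMon.obj A).X] ▷ F.obj V ≫ Functor.LaxMonoidal.μ F A.X V ≫ F.map l =
      (α_ _ _ _).hom ≫ F.obj A.X ◁ (Functor.LaxMonoidal.μ F A.X V ≫ F.map l) ≫
        Functor.LaxMonoidal.μ F A.X V ≫ F.map l := by
  change (Functor.LaxMonoidal.μ F A.X A.X ≫ F.map μ[A.X]) ▷ F.obj V ≫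
    Functor.LaxMonoidal.μ F A.X V ≫ F.map l = _
  rw [comp_whiskerRight, Category.assoc, μ_natural_left_assoc, ← F.map_comp, hm, F.map_comp,
    F.map_comp, Functor.LaxMonoidal.associativity_assoc, MonoidalCategory.whiskerLeft_comp,
    Category.assoc, μ_natural_right_assoc]

end

end InternalEndAction

/-! ### Algebras acting on an object with a trace -/

section TraceAction

variable {T : Type u} [Category.{v} T] [MonoidalCategory T] [SymmetricCategory T]
variable {𝒯 : TraceSystem T} {A R : T} (d : 𝒯.Data R) (l : A ⊗ R ⟶ R) (s : 𝟙_ T ⟶ A ⊗ A)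

open TraceSystem

/-- The map `r ↦ s' ⊗ s'' r`. -/
def splitAction : R ⟶ A ⊗ R := (λ_ R).inv ≫ s ▷ R ≫ (α_ A A R).hom ≫ A ◁ l

/-- Yanking beside an idle factor `P`, followed by `h`. -/
theorem tr_braiding_whiskerRight {P Q : T} (h : P ⊗ R ⟶ Q) :
    𝒯.tr d ((α_ P R R).hom ≫ P ◁ (β_ R R).hom ≫ (α_ P R R).inv ≫ h ▷ R) = h := by
  have h' := 𝒯.tr_post d h ((α_ P R R).hom ≫ P ◁ (β_ R R).hom ≫ (α_ P R R).inv)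
  rw [← whiskerLeft_tr, yank, whiskerLeft_id, Category.id_comp] at h'
  simpa using h'

variable {l s}

/-- Up to the symmetry of `R ⊗ R`, the composite is the action of `s` on `R ⊗ R`; by assumption that
action is the symmetry too, and the two cancel. -/
theorem splitAction_braiding_action
    (h : (λ_ (R ⊗ R)).inv ≫ s ▷ (R ⊗ R) ≫ tensorμ A A R R ≫ (l ⊗ₘ l) = (β_ R R).hom) :
    splitAction l s ▷ R ≫ (α_ A R R).hom ≫ A ◁ (β_ R R).hom ≫ (α_ A R R).inv ≫ l ▷ R = 𝟙 _ := by
  calc _ = 𝟙 _ ⊗≫ s ▷ (R ⊗ R) ⊗≫ A ◁ (l ▷ R ≫ (β_ R R).hom) ⊗≫ l ▷ R := by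
        rw [splitAction]; monoidal
    _ = 𝟙 _ ⊗≫ (s ▷ (R ⊗ R) ≫ (A ⊗ A) ◁ (β_ R R).hom) ⊗≫ A ◁ (β_ A R).hom ▷ R ⊗≫
        ((A ⊗ R) ◁ l ≫ l ▷ R) := by
      rw [BraidedCategory.braiding_naturality_left, BraidedCategory.braiding_tensor_left_hom]
      monoidal
    _ = (β_ R R).hom ≫ (λ_ (R ⊗ R)).inv ≫ s ▷ (R ⊗ R) ≫ tensorμ A A R R ≫ (l ⊗ₘ l) := by
      rw [← whisker_exchange s, tensorμ, MonoidalCategory.tensorHom_def' l l]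
      monoidal
    _ = _ := by rw [h, SymmetricCategory.symmetry]

/-- Morphisms `P ⟶ Q ⊗ A` correspond to morphisms `P ⊗ R ⟶ Q ⊗ R`. -/
theorem bijective_action
    (h1 : 𝒯.tr d (l ≫ splitAction l s) = 𝟙 A)
    (h2 : (λ_ (R ⊗ R)).inv ≫ s ▷ (R ⊗ R) ≫ tensorμ A A R R ≫ (l ⊗ₘ l) = (β_ R R).hom) (P Q : T) :
    Function.Bijective fun f : P ⟶ Q ⊗ A => f ▷ R ≫ (α_ Q A R).hom ≫ Q ◁ l := by
  -- The inverse sends `h` to the partial trace over `R` of `h` followed by `r ↦ s' ⊗ s'' r`, as one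
  -- recovers a matrix from the traces of its products with matrix units. One composite is the
  -- identity by `h1`, the other because `s` acts as the symmetry.
  refine Function.bijective_iff_has_inverse.2
    ⟨fun h => 𝒯.tr d (h ≫ Q ◁ splitAction l s ≫ (α_ Q A R).inv), fun f => ?_, fun h => ?_⟩
  · dsimp only
    simp only [Category.assoc]
    rw [tr_pre, ← whiskerLeft_comp_assoc, ← whiskerLeft_tr, h1, whiskerLeft_id, Category.comp_id]
  · dsimp only
    rw [tr_whiskerRight, ← tr_post]
    refine Eq.trans ?_ (tr_braiding_whiskerRight d h)
    congr 1
    calc _ = 𝟙 _ ⊗≫ P ◁ (β_ R R).hom ⊗≫ h ▷ R ⊗≫ Q ◁ (splitAction l s ▷ R ≫ (α_ A R R).hom ≫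
          A ◁ (β_ R R).hom ≫ (α_ A R R).inv ≫ l ▷ R) ⊗≫ 𝟙 _ := by monoidal
      _ = _ := by rw [splitAction_braiding_action h2]; monoidal

theorem tensorμ_action {P Q : T} (f : P ⊗ 𝟙_ T ⟶ Q ⊗ A) (l : A ⊗ R ⟶ R) :
    (P ⊗ R) ◁ (λ_ (𝟙_ T)).inv ≫ (tensorμ P R (𝟙_ T) (𝟙_ T) ≫ (f ⊗ₘ (β_ R (𝟙_ T)).hom) ≫
      tensorμ Q A (𝟙_ T) R) ≫ (Q ⊗ 𝟙_ T) ◁ l =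
    (ρ_ (P ⊗ R)).hom ≫ (((ρ_ P).inv ≫ f) ▷ R ≫ (α_ Q A R).hom ≫ Q ◁ l) ≫ (ρ_ Q).inv ▷ R := by
  rw [tensorμ, tensorμ, braiding_tensorUnit_right, braiding_tensorUnit_right,
    MonoidalCategory.tensorHom_def]
  monoidal

namespace Diff

/-- A morphism from `X` to `A` in formal differences is a morphism `X.pos ⟶ X.neg ⊗ A` up to
unitors; this is why the bijection in the base category is needed with a second object `Q`. -/
theorem bijective_action
    (h1 : 𝒯.tr d (l ≫ splitAction l s) = 𝟙 A)
    (h2 : (λ_ (R ⊗ R)).inv ≫ s ▷ (R ⊗ R) ≫ tensorμ A A R R ≫ (l ⊗ₘ l) = (β_ R R).hom)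
    (X : Diff 𝒯) : Function.Bijective fun g : X ⟶ ofPos 𝒯 A =>
      g ▷ ofPos 𝒯 R ≫ Functor.LaxMonoidal.μ (incl 𝒯) A R ≫ (incl 𝒯).map l := by
  have hv (g : X ⟶ ofPos 𝒯 A) :
      Hom.val (g ▷ ofPos 𝒯 R ≫ Functor.LaxMonoidal.μ (incl 𝒯) A R ≫ (incl 𝒯).map l) =
        (ρ_ (X.pos ⊗ R)).hom ≫ (((ρ_ X.pos).inv ≫ Hom.val g) ▷ R ≫ (α_ X.neg A R).hom ≫
          X.neg ◁ l) ≫ (ρ_ X.neg).inv ▷ R := by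
    have hp : Functor.LaxMonoidal.μ (incl 𝒯) A R ≫ (incl 𝒯).map l =
        pair (X := ofPos 𝒯 A ⊗ ofPos 𝒯 R) (Y := ofPos 𝒯 R) l (λ_ (𝟙_ T)).inv := by
      refine (pair_comp_pair (X := ofPos 𝒯 A ⊗ ofPos 𝒯 R) (Y := ofPos 𝒯 (A ⊗ R))
        (Z := ofPos 𝒯 R) (𝟙 _) (λ_ _).inv l (𝟙 _)).trans ?_
      congr 1 <;> simp
    refine (congrArg (fun q => Hom.val (g ▷ ofPos 𝒯 R ≫ q)) hp).trans ?_
    refine (comp_pair (Y := ofPos 𝒯 A ⊗ ofPos 𝒯 R) (Z := ofPos 𝒯 R) _ _ _).trans ?_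
    rw [← tensorHom_id, tensorHom_val, id_val]
    exact tensorμ_action (Hom.val g) l
  have hb := TensorCat.bijective_action d h1 h2 X.pos X.neg
  constructor
  · intro g g' hg
    have h := (hv g).symm.trans ((congrArg Hom.val hg).trans (hv g'))
    have hc : ∀ {k k' : X.pos ⊗ R ⟶ X.neg ⊗ R}, (ρ_ (X.pos ⊗ R)).hom ≫ k ≫ (ρ_ X.neg).inv ▷ R =
        (ρ_ (X.pos ⊗ R)).hom ≫ k' ≫ (ρ_ X.neg).inv ▷ R → k = k' := by
      intro k k' h
      simpa only [cancel_epi, cancel_mono] using h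
    exact hom_ext ((cancel_epi _).1 (hb.1 (hc h)))
  · intro f
    let f' : (X.pos ⊗ R) ⊗ 𝟙_ T ⟶ (X.neg ⊗ 𝟙_ T) ⊗ R := Hom.val f
    obtain ⟨e, he⟩ := hb.2 ((ρ_ (X.pos ⊗ R)).inv ≫ f' ≫ (ρ_ X.neg).hom ▷ R)
    refine ⟨⟨(ρ_ X.pos).hom ≫ e⟩, hom_ext ((hv _).trans ?_)⟩
    dsimp only at he ⊢
    rw [Iso.inv_hom_id_assoc, he]
    change _ = f'
    simp

end Diff

end TraceAction

end TensorCat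


namespace TensorCat

/-! ### Left multiplication on the regular module -/

section RegularAction

variable {C : Type u} [Category.{v} C] [MonoidalCategory C] [SymmetricCategory C]
  {B : C} [MonObj B] {s : 𝟙_ C ⟶ B ⊗ B}

theorem inl_mul : ((ρ_ B).inv ≫ B ◁ η[B]) ▷ (B ⊗ B) ≫ μ[B ⊗ B] =
    (α_ B B B).inv ≫ μ[B] ▷ B := by
  rw [MonObj.tensorObj.mul_def, comp_whiskerRight, Category.assoc, ← id_tensorHom B η[B],
    tensorμ_natural_left_assoc, tensorHom_comp_tensorHom, MonObj.one_mul, id_whiskerRight,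
    Category.id_comp, tensorμ]
  simp only [MonoidalCategory.tensorHom_def, braiding_tensorUnit_left]
  monoidal

theorem mul_inr : (B ⊗ B) ◁ ((λ_ B).inv ≫ η[B] ▷ B) ≫ μ[B ⊗ B] =
    (α_ B B B).hom ≫ B ◁ μ[B] := by
  rw [MonObj.tensorObj.mul_def, whiskerLeft_comp, Category.assoc, ← tensorHom_id η[B] B,
    tensorμ_natural_right_assoc, tensorHom_comp_tensorHom, MonObj.mul_one, whiskerLeft_id,
    Category.id_comp, tensorμ]
  simp only [MonoidalCategory.tensorHom_def, braiding_tensorUnit_right]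
  monoidal

/-- `s (1 ⊗ y) = (y ⊗ 1) s` -/
theorem IsSwap.splitAction_eq (hs : IsSwap B s) :
    splitAction μ[B] s = (ρ_ B).inv ≫ B ◁ s ≫ (α_ B B B).inv ≫ μ[B] ▷ B := by
  have h := ((ρ_ B).inv ≫ B ◁ η[B]) ≫= hs.comm
  have e : ((ρ_ B).inv ≫ B ◁ η[B]) ≫ (β_ B B).hom = (λ_ B).inv ≫ η[B] ▷ B := by
    simp
  rw [rightMul, rightUnitor_inv_naturality_assoc, ← whisker_exchange_assoc, inl_mul,
    leftUnitor_inv_naturality_assoc, whisker_exchange_assoc, ← whiskerLeft_comp_assoc, e,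
    mul_inr] at h
  rw [h, splitAction]

/-- In elements, `s' t(s'' b) = b s' t(s'') = b`. -/
theorem IsSwap.splitAction_swapTrace (hs : IsSwap B s) {B' : C} [ExactPairing B B'] :
    splitAction μ[B] s ≫ B ◁ swapTrace s B' ≫ (ρ_ B).hom = 𝟙 B := by
  rw [hs.splitAction_eq]
  calc _ = (ρ_ B).inv ≫ B ◁ s ≫ (α_ B B B).inv ≫ (μ[B] ▷ B ≫ B ◁ swapTrace s B') ≫ (ρ_ B).hom := by
        simp
    _ = (ρ_ B).inv ≫ B ◁ (s ≫ B ◁ swapTrace s B' ≫ (ρ_ B).hom) ≫ μ[B] := by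
      rw [← whisker_exchange]; monoidal
    _ = _ := by rw [comp_whiskerLeft_swapTrace hs, MonObj.mul_one, Iso.inv_hom_id]

end RegularAction

namespace PowMod

variable {C : Type u} [Category.{v} C] [Preadditive C] [MonoidalCategory C] [SymmetricCategory C]
  [MonoidalPreadditive C]
variable {B : C} [MonObj B] {s : 𝟙_ C ⟶ B ⊗ B}

variable (B) in
/-- The left multiplication on the regular module. -/
def regularAction : ofObj B B ⊗ regular B ⟶ regular B where
  hom := μ[B]
  eq_zero h := (h rfl).elim
  act_comp k hk := by
    rw [tensorObj_act, if_neg (Nat.not_lt_zero k), rightAct]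
    exact (Category.assoc _ _ _).trans (MonObj.mul_assoc B).symm

variable (B s) in
/-- An element of `B ⊗ B` in degree zero. -/
def tensorElement : 𝟙_ (PowMod B) ⟶ ofObj B B ⊗ ofObj B B where
  hom := s
  eq_zero h := (h rfl).elim
  act_comp k hk := (Nat.not_lt_zero k hk).elim

theorem traceHom_regularAction (hs : IsSwap B s) {B' : C} [ExactPairing B B'] :
    letI := symmetricCategory hs
    traceHom (U := regular B) η[B] (swapTrace s B')
      (regularAction B ≫ splitAction (regularAction B) (tensorElement B s)) = 𝟙 (ofObj B B) := by
  ext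
  have h : (ρ_ B).inv ≫ B ◁ η[B] ≫ (μ[B] ≫ splitAction μ[B] s) ≫ B ◁ swapTrace s B' ≫ (ρ_ B).hom =
      𝟙 B := by
    rw [Category.assoc, hs.splitAction_swapTrace, Category.comp_id, MonObj.mul_one, Iso.inv_hom_id]
  exact (traceHom_hom _ _ _).trans h

theorem braidingHom_ofObj_left (hs : IsSwap B s) (X : C) :
    Hom.hom (braidingHom hs (ofObj B X) (regular B)) = (β_ X B).hom := by
  have h1 : (blockPerm 0 1)⁻¹ = 1 := by
    rw [inv_eq_one]
    ext k
    rw [blockPerm_apply, Equiv.Perm.one_apply]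
    split_ifs <;> omega
  change (β_ X B).hom ≫ PowMod.sym s (regular B ⊗ ofObj B X) (blockPerm 0 1)⁻¹ = (β_ X B).hom
  rw [h1, PowMod.sym_one hs]
  exact Category.comp_id _

theorem regular_swapOp :
    (regular B ⊗ regular B).swapOp s 0 1 = rightMul s := by
  rw [swapOp, act₂, tensorObj_act, tensorObj_act, if_pos Nat.zero_lt_one, if_neg (lt_irrefl 1),
    leftAct, rightAct, rightMul, MonObj.tensorObj.mul_def, tensorμ, MonoidalCategory.tensorHom_def]
  dsimp
  monoidal

theorem braidingHom_regular (hs : IsSwap B s) :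
    Hom.hom (braidingHom hs (regular B) (regular B)) = (β_ B B).hom ≫ rightMul s := by
  have h1 : blockPerm 1 1 = Equiv.swap 0 1 * 1 := by
    ext k
    rw [blockPerm_apply, mul_one, Equiv.swap_apply_def]
    split_ifs <;> omega
  have h2 : (regular B ⊗ regular B).sym s (blockPerm 1 1)⁻¹ =
      (regular B ⊗ regular B).swapOp s 0 1 := by
    rw [h1, mul_one, Equiv.swap_inv, ← Category.id_comp (swapOp _ _ _ _),
      ← mul_one (Equiv.swap 0 1)]
    exact Rep.sym_eq hs (Rep.step Rep.one Nat.zero_lt_two Nat.one_lt_two zero_ne_one)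
  rw [← regular_swapOp, ← h2]
  rfl

/-- On `R ⊗ R` the element `s` acts by `x ↦ s x`, while the corrected symmetry is `x ↦ τ(x) s`. They
agree by the defining property of `s`, so for the corrected symmetry `s` plays the role of the flip
in the endomorphisms of `R ⊗ R`. -/
theorem tensorμ_regularAction (hs : IsSwap B s) :
    letI := symmetricCategory hs
    (λ_ (regular B ⊗ regular B)).inv ≫ tensorElement B s ▷ (regular B ⊗ regular B) ≫
      tensorμ (ofObj B B) (ofObj B B) (regular B) (regular B) ≫
        (regularAction B ⊗ₘ regularAction B) = (β_ (regular B) (regular B)).hom := by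
  let := symmetricCategory hs
  have h1 : (Hom.hom (tensorμ (ofObj B B) (ofObj B B) (regular B) (regular B)) :
      (B ⊗ B) ⊗ (B ⊗ B) ⟶ (B ⊗ B) ⊗ (B ⊗ B)) = tensorμ B B B B := by
    rw [tensorμ, tensorμ]
    exact congrArg (fun t : B ⊗ B ⟶ B ⊗ B ↦ (α_ B B (B ⊗ B)).hom ≫ B ◁ (α_ B B B).inv ≫
      B ◁ t ▷ B ≫ B ◁ (α_ B B B).hom ≫ (α_ B B (B ⊗ B)).inv) (braidingHom_ofObj_left hs B)
  have h2 : (λ_ (B ⊗ B)).inv ≫ s ▷ (B ⊗ B) ≫ tensorμ B B B B ≫ (μ[B] ⊗ₘ μ[B]) =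
      (β_ B B).hom ≫ rightMul s := by
    rw [hs.comm, leftUnitor_inv_naturality_assoc, whisker_exchange_assoc,
      ← whiskerLeft_comp_assoc, SymmetricCategory.symmetry, whiskerLeft_id, Category.id_comp,
      MonObj.tensorObj.mul_def]
  refine hom_ext (Eq.trans ?_ (h2.trans (braidingHom_regular hs).symm))
  refine Eq.trans ?_ (congrArg (fun t : (B ⊗ B) ⊗ (B ⊗ B) ⟶ (B ⊗ B) ⊗ (B ⊗ B) ↦
    (λ_ (B ⊗ B)).inv ≫ s ▷ (B ⊗ B) ≫ t ≫ (μ[B] ⊗ₘ μ[B])) h1)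
  rw [MonoidalCategory.tensorHom_def μ[B]]
  rfl

end PowMod
end TensorCat


namespace TensorCat

/-! ### From the swap element to a splitting extension -/

section Splitting

section

variable {T : Type u} [Category.{v} T] [MonoidalCategory T] [SymmetricCategory T]
variable {𝒯 : TraceSystem T}

/-- The object `0 - R` supplies the dual, and the trace together with `s` supplies the bijection
that `isSplit_of_action` asks for. -/
theorem Diff.isSplit_incl (A : Mon T) {R : T} (d : 𝒯.Data R) (l : A.X ⊗ R ⟶ R)
    (s : 𝟙_ T ⟶ A.X ⊗ A.X) (h1 : η[A.X] ▷ R ≫ l = (λ_ R).hom)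
    (hm : μ[A.X] ▷ R ≫ l = (α_ A.X A.X R).hom ≫ A.X ◁ l ≫ l)
    (ht : 𝒯.tr d (l ≫ splitAction l s) = 𝟙 A.X)
    (hβ : (λ_ (R ⊗ R)).inv ≫ s ▷ (R ⊗ R) ≫ tensorμ A.X A.X R R ≫ (l ⊗ₘ l) = (β_ R R).hom) :
    IsSplit ((incl 𝒯).mapMon.obj A) :=
  isSplit_of_action _ (ofPos 𝒯 R) (ofNeg d) (Functor.LaxMonoidal.μ (incl 𝒯) A.X R ≫ (incl 𝒯).map l)
    (one_map_action (incl 𝒯) A h1) (mul_map_action (incl 𝒯) A hm) (Diff.bijective_action d ht hβ)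

variable {C : Type u₁} [Category.{v} C] [MonoidalCategory C] [SymmetricCategory C]
  {k : Type w} [Field k] [Preadditive C] [Linear k C] [IsTensorCategory k C]

theorem splitsInFullyFaithfulExtension_of_traceSystem [Preadditive T] [Linear k T]
    [MonoidalPreadditive T] [MonoidalLinear k T] [𝒯.Additive] [𝒯.Homogeneous k]
    (F : C ⥤ T) [F.Braided] [F.Additive] [F.Linear k] [F.Full] [F.Faithful] {B : Mon C}
    (h : IsSplit ((Diff.incl 𝒯).mapMon.obj (F.mapMon.obj B))) :
    SplitsInFullyFaithfulExtension.{w, v, u₁, v, u₁} k B := by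
  refine splitsInFullyFaithfulExtension_of_functor ((F ⋙ Diff.incl 𝒯) ⋙ Mat_.embedding (Diff 𝒯)) ?_
  refine IsSplit.of_iso ((Functor.mapMonCompIso (F := F ⋙ Diff.incl 𝒯) (G := Mat_.embedding (Diff 𝒯))).app B)
    (IsSplit.map _ ?_)
  exact IsSplit.of_iso ((Functor.mapMonCompIso (F := F) (G := Diff.incl 𝒯)).app B) h

end

open PowMod

variable {C : Type u} [Category.{v} C] [MonoidalCategory C] [SymmetricCategory C]
  {k : Type w} [Field k] [Preadditive C] [Linear k C] [IsTensorCategory k C]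

theorem splitsInFullyFaithfulExtension_of_isSwap {B : Mon C} {B' : C} [ExactPairing B.X B']
    {s : 𝟙_ C ⟶ B.X ⊗ B.X} (hs : IsSwap B.X s) :
    SplitsInFullyFaithfulExtension.{w, v, u, v, u} k B := by
  let := symmetricCategory hs
  let := degZeroBraided B.X hs
  have := additive_traceSystem hs
  have := homogeneous_traceSystem hs k
  refine splitsInFullyFaithfulExtension_of_traceSystem (𝒯 := traceSystem B.X s hs)
    (degZero B.X) ?_
  -- The rigid object splitting `B` is the regular module, its trace being given by the unit of `B`
  -- as cup and the reduced trace form as cap.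
  refine Diff.isSplit_incl (𝒯 := traceSystem B.X s hs) ((degZero B.X).mapMon.obj B)
    (R := regular B.X) ⟨η[B.X], swapTrace s B', traceHom_regular hs⟩ (regularAction B.X)
    (tensorElement B.X s) (hom_ext ?_) (hom_ext ?_) (traceHom_regularAction hs)
    (tensorμ_regularAction hs)
  · refine Eq.trans ?_ (MonObj.one_mul B.X)
    exact congrArg (fun t ↦ t ▷ B.X ≫ μ[B.X]) (Category.id_comp η[B.X])
  · refine Eq.trans ?_ (MonObj.mul_assoc B.X)
    exact congrArg (fun t ↦ t ▷ B.X ≫ μ[B.X]) (Category.id_comp μ[B.X])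

end Splitting

end TensorCat


namespace TensorCat

/-! ### From a splitting to the swap element -/

section SwapOfSplit

variable {C : Type u} [Category.{v} C] [MonoidalCategory C]

theorem bijective_comp_iso {X Y Z : C} (e : Y ≅ Z) :
    Function.Bijective fun f : X ⟶ Y => f ≫ e.hom :=
  e.homToEquiv.bijective

theorem bijective_iso_comp {X Y Z : C} (e : X ≅ Y) :
    Function.Bijective fun f : Y ⟶ Z => e.hom ≫ f :=
  e.symm.homFromEquiv.bijective

theorem bijective_whiskerLeft_endAction (V W X P : C) [ExactPairing V W] :
    Function.Bijective fun f : X ⟶ P ⊗ (V ⊗ W) =>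
      f ▷ V ≫ (α_ P (V ⊗ W) V).hom ≫ P ◁ endAction V W := by
  have h := (tensorRightHomEquiv X V W (P ⊗ V)).symm.bijective.comp
    (bijective_comp_iso (X := X) (α_ P V W).symm)
  convert h using 2 with f
  change _ = (f ≫ (α_ P V W).inv) ▷ V ≫ (α_ (P ⊗ V) W V).hom ≫ (P ⊗ V) ◁ ε_ V W ≫ (ρ_ _).hom
  rw [endAction]
  monoidal

/-- Extracts from a splitting what is needed of it: `A` acts on `V`, and morphisms into `P ⊗ A` are
determined freely by their effect on `V`. -/
theorem IsSplit.exists_action {A : Mon C} (h : IsSplit A) :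
    ∃ (V : C) (l : A.X ⊗ V ⟶ V), η[A.X] ▷ V ≫ l = (λ_ V).hom ∧
      μ[A.X] ▷ V ≫ l = (α_ A.X A.X V).hom ≫ A.X ◁ l ≫ l ∧
      ∀ X P : C, Function.Bijective fun f : X ⟶ P ⊗ A.X => f ▷ V ≫ (α_ P A.X V).hom ≫ P ◁ l := by
  obtain ⟨V, W, p, ⟨f⟩⟩ := h
  obtain ⟨e, he⟩ : ∃ e : A.X ≅ V ⊗ W, e.hom = f.hom.hom := ⟨(Mon.forget C).mapIso f, rfl⟩
  have e1 : η[A.X] ≫ e.hom = η_ V W := by rw [he]; exact IsMonHom.one_hom f.hom.hom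
  have em : μ[A.X] ≫ e.hom = (e.hom ⊗ₘ e.hom) ≫ endMul V W := by
    rw [he]; exact IsMonHom.mul_hom f.hom.hom
  refine ⟨V, e.hom ▷ V ≫ endAction V W, ?_, ?_, fun X P => ?_⟩
  · rw [← comp_whiskerRight_assoc, e1, one_endAction]
  · rw [← comp_whiskerRight_assoc, em, comp_whiskerRight, Category.assoc, mul_endAction,
      MonoidalCategory.tensorHom_def']
    calc _ = 𝟙 _ ⊗≫ A.X ◁ e.hom ▷ V ⊗≫ (e.hom ▷ ((V ⊗ W) ⊗ V) ≫ (V ⊗ W) ◁ endAction V W) ≫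
          endAction V W := by monoidal
      _ = _ := by rw [← whisker_exchange]; monoidal
  · have h := (bijective_whiskerLeft_endAction V W X P).comp
      (bijective_comp_iso (X := X) (whiskerLeftIso P e))
    convert h using 2 with f
    change _ = (f ≫ P ◁ e.hom) ▷ V ≫ (α_ P (V ⊗ W) V).hom ≫ P ◁ endAction V W
    have hg (A : C) (g : A ⟶ V ⊗ W) (f : X ⟶ P ⊗ A) :
        f ▷ V ≫ (α_ P A V).hom ≫ P ◁ (g ▷ V ≫ endAction V W) =
          (f ≫ P ◁ g) ▷ V ≫ (α_ P (V ⊗ W) V).hom ≫ P ◁ endAction V W := by monoidal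
    exact hg A.X e.hom f

variable [SymmetricCategory C]

/-- The action of `A ⊗ A` on `V ⊗ V`. -/
def squareAction {A V : C} (l : A ⊗ V ⟶ V) : (A ⊗ A) ⊗ (V ⊗ V) ⟶ V ⊗ V :=
  tensorμ A A V V ≫ (l ⊗ₘ l)

section

variable {A V : C} {l : A ⊗ V ⟶ V}

/-- Writes the action on `V ⊗ V` as two successive actions on a single `V`, up to symmetries, so
that bijectivity for `A ⊗ A` follows from two uses of bijectivity for `A`. -/
theorem whiskerRight_squareAction {X : C} (f : X ⟶ A ⊗ A) :
    f ▷ (V ⊗ V) ≫ squareAction l = (X ◁ (β_ V V).hom ≫ (α_ X V V).inv) ≫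
      ((((f ▷ V ≫ (α_ A A V).hom ≫ A ◁ l) ≫ (β_ A V).hom) ▷ V ≫ (α_ V A V).hom ≫ V ◁ l) ≫
        (β_ V V).hom) := by
  symm
  calc _ = 𝟙 _ ⊗≫ (X ◁ (β_ V V).hom ≫ f ▷ (V ⊗ V)) ⊗≫ A ◁ l ▷ V ⊗≫ (β_ A V).hom ▷ V ⊗≫
        (V ◁ l ≫ (β_ V V).hom) := by monoidal
    _ = 𝟙 _ ⊗≫ f ▷ (V ⊗ V) ⊗≫ (A ⊗ A) ◁ (β_ V V).hom ⊗≫ A ◁ l ▷ V ⊗≫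
        ((β_ A V).hom ≫ (β_ V A).hom) ▷ V ⊗≫ A ◁ (β_ V V).hom ⊗≫ l ▷ V := by
      rw [whisker_exchange, BraidedCategory.braiding_naturality_right,
        BraidedCategory.braiding_tensor_right_hom]
      monoidal
    _ = 𝟙 _ ⊗≫ f ▷ (V ⊗ V) ⊗≫ (A ⊗ A) ◁ (β_ V V).hom ⊗≫ A ◁ (l ▷ V ≫ (β_ V V).hom) ⊗≫ l ▷ V := by
      rw [SymmetricCategory.symmetry]
      monoidal
    _ = 𝟙 _ ⊗≫ f ▷ (V ⊗ V) ⊗≫ (A ⊗ A) ◁ ((β_ V V).hom ≫ (β_ V V).hom) ⊗≫ A ◁ (β_ A V).hom ▷ V ⊗≫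
        ((A ⊗ V) ◁ l ≫ l ▷ V) := by
      rw [BraidedCategory.braiding_naturality_left, BraidedCategory.braiding_tensor_left_hom]
      monoidal
    _ = _ := by
      rw [SymmetricCategory.symmetry, squareAction, tensorμ, MonoidalCategory.tensorHom_def']
      monoidal

theorem bijective_squareAction
    (hl : ∀ X P : C, Function.Bijective fun f : X ⟶ P ⊗ A => f ▷ V ≫ (α_ P A V).hom ≫ P ◁ l)
    (X : C) : Function.Bijective fun f : X ⟶ A ⊗ A => f ▷ (V ⊗ V) ≫ squareAction l := by
  have h := (bijective_iso_comp (Z := V ⊗ V)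
      ((whiskerLeftIso X (β_ V V)) ≪≫ (α_ X V V).symm)).comp
    ((bijective_comp_iso (X := (X ⊗ V) ⊗ V) (β_ V V)).comp ((hl (X ⊗ V) V).comp
    ((bijective_comp_iso (X := X ⊗ V) (β_ A V)).comp (hl X A))))
  rw [funext fun f : X ⟶ A ⊗ A => whiskerRight_squareAction f]
  exact h

theorem one_squareAction [MonObj A] (h1 : η[A] ▷ V ≫ l = (λ_ V).hom) :
    η[A ⊗ A] ▷ (V ⊗ V) ≫ squareAction l = (λ_ (V ⊗ V)).hom := by
  rw [MonObj.tensorObj.one_def, squareAction, comp_whiskerRight, Category.assoc,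
    tensorμ_natural_left_assoc, tensorHom_comp_tensorHom, h1, ← tensor_left_unitality]

theorem mul_squareAction [MonObj A] (hm : μ[A] ▷ V ≫ l = (α_ A A V).hom ≫ A ◁ l ≫ l) :
    μ[A ⊗ A] ▷ (V ⊗ V) ≫ squareAction l =
      (α_ _ _ _).hom ≫ (A ⊗ A) ◁ squareAction l ≫ squareAction l := by
  rw [MonObj.tensorObj.mul_def, squareAction, comp_whiskerRight, Category.assoc,
    tensorμ_natural_left_assoc, tensorHom_comp_tensorHom, hm, ← tensorHom_comp_tensorHom,
    ← tensorHom_comp_tensorHom, reassoc_of% tensor_associativity A A A A V V,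
    whiskerLeft_comp, Category.assoc, tensorμ_natural_right_assoc]

theorem comp_rightMul_squareAction [MonObj A] (hm : μ[A] ▷ V ≫ l = (α_ A A V).hom ≫ A ◁ l ≫ l)
    {s : 𝟙_ C ⟶ A ⊗ A} {t : V ⊗ V ⟶ V ⊗ V}
    (hs : s ▷ (V ⊗ V) ≫ squareAction l = (λ_ (V ⊗ V)).hom ≫ t) :
    rightMul s ▷ (V ⊗ V) ≫ squareAction l = (A ⊗ A) ◁ t ≫ squareAction l := by
  rw [rightMul, comp_whiskerRight, comp_whiskerRight, Category.assoc, Category.assoc,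
    mul_squareAction hm]
  calc _ = 𝟙 _ ⊗≫ (A ⊗ A) ◁ (s ▷ (V ⊗ V) ≫ squareAction l) ≫ squareAction l := by monoidal
    _ = _ := by rw [hs]; monoidal

/-- Left multiplication by an element of an algebra. -/
def leftMul {E : C} [MonObj E] (q : 𝟙_ C ⟶ E) : E ⟶ E := (λ_ E).inv ≫ q ▷ E ≫ μ[E]

theorem comp_leftMul_squareAction [MonObj A] (hm : μ[A] ▷ V ≫ l = (α_ A A V).hom ≫ A ◁ l ≫ l)
    {s : 𝟙_ C ⟶ A ⊗ A} {t : V ⊗ V ⟶ V ⊗ V}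
    (hs : s ▷ (V ⊗ V) ≫ squareAction l = (λ_ (V ⊗ V)).hom ≫ t) :
    leftMul s ▷ (V ⊗ V) ≫ squareAction l = squareAction l ≫ t := by
  rw [leftMul, comp_whiskerRight, comp_whiskerRight, Category.assoc, Category.assoc,
    mul_squareAction hm]
  calc _ = 𝟙 _ ⊗≫ (s ▷ ((A ⊗ A) ⊗ V ⊗ V) ≫ (A ⊗ A) ◁ squareAction l) ≫ squareAction l := by
        monoidal
    _ = 𝟙 _ ⊗≫ squareAction l ⊗≫ (s ▷ (V ⊗ V) ≫ squareAction l) := by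
      rw [← whisker_exchange]; monoidal
    _ = _ := by rw [hs]; monoidal

theorem braiding_squareAction :
    (β_ A A).hom ▷ (V ⊗ V) ≫ squareAction l =
      (A ⊗ A) ◁ (β_ V V).hom ≫ squareAction l ≫ (β_ V V).hom := by
  rw [squareAction, reassoc_of% braiding_whiskerRight_tensorμ A A V V]
  simp only [Category.assoc]
  rw [BraidedCategory.braiding_naturality]

theorem isSwap_iff {B : C} [MonObj B] {s : 𝟙_ C ⟶ B ⊗ B} :
    IsSwap B s ↔ s ≫ rightMul s = η[B ⊗ B] ∧ rightMul s = (β_ B B).hom ≫ leftMul s := by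
  rw [comp_rightMul, leftMul, leftUnitor_inv_naturality_assoc, whisker_exchange_assoc]
  exact ⟨fun h => ⟨h.sq, h.comm⟩, fun h => ⟨h.1, h.2⟩⟩

/-- Elements of `A ⊗ A` may be compared through their action on `V ⊗ V`. There `s` acts as the
symmetry `σ` and `τ(x)` acts as `σ x σ`, so `s² = 1` and `x s = s τ(x)` become `σ² = 1` and `x σ = σ
(σ x σ)`. -/
theorem exists_isSwap_of_action [MonObj A] (h1 : η[A] ▷ V ≫ l = (λ_ V).hom)
    (hm : μ[A] ▷ V ≫ l = (α_ A A V).hom ≫ A ◁ l ≫ l)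
    (hl : ∀ X P : C, Function.Bijective fun f : X ⟶ P ⊗ A => f ▷ V ≫ (α_ P A V).hom ≫ P ◁ l) :
    ∃ s, IsSwap A s := by
  obtain ⟨s, hs⟩ := (bijective_squareAction hl (𝟙_ C)).2 ((λ_ (V ⊗ V)).hom ≫ (β_ V V).hom)
  dsimp only at hs
  refine ⟨s, isSwap_iff.2 ⟨(bijective_squareAction hl _).1 ?_, (bijective_squareAction hl _).1 ?_⟩⟩
  · dsimp only
    rw [comp_whiskerRight, Category.assoc, comp_rightMul_squareAction hm hs, one_squareAction h1,
      ← whisker_exchange_assoc, hs, leftUnitor_naturality_assoc, SymmetricCategory.symmetry,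
      Category.comp_id]
  · dsimp only
    rw [comp_whiskerRight, Category.assoc, comp_rightMul_squareAction hm hs,
      comp_leftMul_squareAction hm hs, reassoc_of% braiding_squareAction (l := l),
      SymmetricCategory.symmetry, Category.comp_id]

end

theorem IsSplit.exists_isSwap {A : Mon C} (h : IsSplit A) : ∃ s, IsSwap A.X s := by
  obtain ⟨V, l, h1, hm, hl⟩ := h.exists_action
  exact exists_isSwap_of_action h1 hm hl

section Mul

variable {E E' : C} [MonObj E] [MonObj E'] (f : E ⟶ E') [IsMonHom f] (q : 𝟙_ C ⟶ E)

theorem rightMul_hom : rightMul q ≫ f = f ≫ rightMul (q ≫ f) := by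
  rw [rightMul, rightMul, Category.assoc, Category.assoc, IsMonHom.mul_hom,
    rightUnitor_inv_naturality_assoc, MonoidalCategory.tensorHom_def, Category.assoc,
    whiskerLeft_comp_assoc, whisker_exchange_assoc]

theorem leftMul_hom : leftMul q ≫ f = f ≫ leftMul (q ≫ f) := by
  rw [leftMul, leftMul, Category.assoc, Category.assoc, IsMonHom.mul_hom,
    leftUnitor_inv_naturality_assoc, MonoidalCategory.tensorHom_def', Category.assoc,
    comp_whiskerRight_assoc, whisker_exchange_assoc q f]

end Mul

section Reflect

variable {D : Type u₁} [Category.{v₁} D] [MonoidalCategory D] [SymmetricCategory D]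

open Functor.LaxMonoidal
open scoped Obj

variable (F : C ⥤ D)

theorem map_rightMul [F.Monoidal] {E : C} [MonObj E] (q : 𝟙_ C ⟶ E) :
    F.map (rightMul q) = rightMul (ε F ≫ F.map q) := by
  rw [rightMul, rightMul]
  change _ = (ρ_ _).inv ≫ _ ◁ (ε F ≫ F.map q) ≫ Functor.LaxMonoidal.μ F E E ≫ F.map μ[E]
  simp only [Functor.map_comp, Functor.Monoidal.map_rightUnitor_inv, whiskerLeft_comp,
    Category.assoc, Functor.Monoidal.map_whiskerLeft, Functor.Monoidal.μ_δ_assoc]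

theorem map_leftMul [F.Monoidal] {E : C} [MonObj E] (q : 𝟙_ C ⟶ E) :
    F.map (leftMul q) = leftMul (ε F ≫ F.map q) := by
  rw [leftMul, leftMul]
  change _ = (λ_ _).inv ≫ (ε F ≫ F.map q) ▷ _ ≫ Functor.LaxMonoidal.μ F E E ≫ F.map μ[E]
  simp only [Functor.map_comp, Functor.Monoidal.map_leftUnitor_inv, comp_whiskerRight,
    Category.assoc, Functor.Monoidal.map_whiskerRight, Functor.Monoidal.μ_δ_assoc]

/-- Fullness provides a preimage of `t`. The structure map of `F` on `B ⊗ B` is an isomorphism of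
algebras compatible with the symmetries, so both identities hold after applying `F`, and
faithfulness reflects them. -/
theorem exists_isSwap_of_map [F.Braided] [F.Full] [F.Faithful] {B : C} [MonObj B]
    {t : 𝟙_ D ⟶ F.obj B ⊗ F.obj B} (ht : IsSwap (F.obj B) t) : ∃ s, IsSwap B s := by
  obtain ⟨ht1, ht2⟩ := isSwap_iff.1 ht
  obtain ⟨s, hs⟩ := F.map_surjective (Functor.OplaxMonoidal.η F ≫ t ≫ Functor.LaxMonoidal.μ F B B)
  have hs' : ε F ≫ F.map s = t ≫ Functor.LaxMonoidal.μ F B B := by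
    rw [hs, Functor.Monoidal.ε_η_assoc]
  refine ⟨s, isSwap_iff.2 ⟨F.map_injective ?_, F.map_injective ?_⟩⟩
  · rw [← cancel_epi (ε F), F.map_comp, reassoc_of% hs', map_rightMul, hs', ← rightMul_hom,
      reassoc_of% ht1]
    exact IsMonHom.one_hom (Functor.LaxMonoidal.μ F B B)
  · rw [← cancel_epi (Functor.LaxMonoidal.μ F B B), F.map_comp, map_rightMul, map_leftMul, hs',
      ← rightMul_hom, ht2, Category.assoc, leftMul_hom, ← Functor.LaxBraided.braided_assoc]

end Reflect

theorem tildeEtaTrivial_of_splits {k : Type w} [Field k] [Preadditive C] [Linear k C] {B : Mon C}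
    (h : SplitsInFullyFaithfulExtension.{w, v, u, v', u'} k B) : TildeEtaTrivial B := by
  obtain ⟨D, _, _, _, _, _, _, F, _, _, _, _, _, hB⟩ := h
  obtain ⟨t, ht⟩ := hB.exists_isSwap
  exact (tildeEtaTrivial_iff B).2 (exists_isSwap_of_map F (B := B.X) ht)

end SwapOfSplit

end TensorCat

theorem mainTheorem5 (k : Type w) [Field k] (C : Type u) [Category.{v} C]
    [Preadditive C] [Linear k C] [MonoidalCategory C] [SymmetricCategory C]
    [TensorCat.IsTensorCategory k C] [IsIdempotentComplete C]
    (B : Mon C) (hB : TensorCat.IsAzumaya B) :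
    (TensorCat.SplitsInFullyFaithfulExtension.{w, v, u, v, u} k B ↔
        TensorCat.TildeEtaTrivial B) ∧
      (TensorCat.SplitsInFullyFaithfulExtension.{w, v, u, v', u'} k B →
        TensorCat.TildeEtaTrivial B) := by
  refine ⟨⟨TensorCat.tildeEtaTrivial_of_splits, fun h => ?_⟩, TensorCat.tildeEtaTrivial_of_splits⟩
  -- The dual of `B` enters through the reduced trace form, whose definition takes a trace over `B`.
  obtain ⟨B', _, _⟩ := hB
  obtain ⟨s, hs⟩ := (TensorCat.tildeEtaTrivial_iff B).1 h
  exact TensorCat.splitsInFullyFaithfulExtension_of_isSwap (B' := B') hs
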